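/- **Model.** Let $n\ge 4$, $1\le k_0<n$, $p\ge 1$, and let $\mathbf x_i=(X_{i1},\dots,X_{ip})^T$, $i=1,\dots,n$, be independent square-integrable random vectors in $\mathbb R^p$ with common mean, where $\mathbf x_1,\dots,\mathbf x_{k_0}$ have covariance matrix $\Sigma_1=(\sigma_1(a,b))$ and $\mathbf x_{k_0+1},\dots,\mathbf x_n$ have covariance matrix $\Sigma_2=(\sigma_2(a,b))\neq\Sigma_1$. Put $\dot X_{ia}=X_{ia}-\frac1n\sum_{j=1}^nX_{ja}$ and $T_i(a,b)=\dot X_{ia}\dot X_{ib}$ for $1\le a\le b\le p$, and $$V_k=\frac{1}{k(k-1)}\sum_{i\ne j\le k}T_iT_j+\frac{1}{(n-k)(n-k-1)}\sum_{i\neq j>k}T_iT_j-\frac{2}{k(n-k)}\sum_{i\le k<j}T_iT_j$$ (all at the position $(a,b)$), $D(a,b)=\frac1{n-3}\sum_{k=2}^{n-2}\frac{k(n-k)}{n}V_k(a,b)$. For a deterministic threshold $\tau>0$ let $\mathcal D_\tau=\{(a,b):a\le b,\ D(a,b)>\tau\}$, $$U_n(k)=\frac1{n^4}\sum_{i\ne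 t\le k}\ \sum_{j\ne l>k}\ \sum_{(a,b)\in\mathcal D_\tau}\bigl(T_i(a,b)-T_j(a,b)\bigr)\bigl(T_t(a,b)-T_l(a,b)\bigr),$$ and let $\hat k$ be any maximizer of $U_n$ over $\{1,\dots,n\}$. Let $\mathcal N=\{(a,b):a\le b,\ \sigma_1(a,b)=\sigma_2(a,b)\}$ and, for $\lambda\in\mathbb R$, $\mathcal P=\{(a,b):a\le b,\ |\sigma_1(a,b)-\sigma_2(a,b)|>\lambda\}$. **Assumptions.** For constants $C_1,C_2,M,C,c>0$ consider: (A1) $\mathbb P(|X_{ia}|>t)\le C_1e^{-C_2t^2}$ for all $i,a$ and $t>0$, and the spectral norms of $\Sigma_1,\Sigma_2$ are at most $M$. (A2) Every nonzero entry of $\Sigma_1-\Sigma_2$ satisfies $|\sigma_1(a,b)-\sigma_2(a,b)|>\lambda$, and $\lambda\ge C\sqrt{\tau/n}\,\max\{n^2/(n-k_0)^2,\;n^2/k_0^2\}$. (A4) (for a sequence of models with $n\to\infty$, where $p,k_0,\tau$ vary along the sequence) There are $0<\varepsilon_0<1$ and $0<K<\infty$ with $k_0>n^{\varepsilon_0}$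 eventually and $pn^{-K}\to0$; and $pn\,e^{-c\tau}\to0$. **Corollary 3.1.** For all $C_1,C_2,M>0$ there are a (sufficiently large) $C>0$ and a (sufficiently small) $c>0$ such that the following hold. 1. There are $c_1,c_2>0$ such that under (A1) $$\mathbb P\Bigl(\bigcup_{(a,b)\in\mathcal N}\{D(a,b)>\tau\}\Bigr)=\mathbb P(\mathcal N\cap\mathcal D_\tau\ne\emptyset)\le c_1p^2n\bigl[e^{-c_2\tau}+e^{-c_2n^{1/4}\sqrt\tau}+ne^{-c_2\sqrt\tau}\bigr].$$ For every sequence of models with $n\to\infty$ satisfying (A1) and (A4) this probability tends to $0$. 2. There are $c_3,c_4>0$ such that under (A1) and (A2) $$\mathbb P\Bigl(\bigcap_{(a,b)\in\mathcal P}\{D(a,b)>\tau\}\Bigr)=\mathbb P(\mathcal P\subset\mathcal D_\tau)\ge1-c_3p^2n\bigl[e^{-c_4\tau}+e^{-c_4n^{1/4}\sqrt\tau}+ne^{-c_4\sqrt\tau}\bigr].$$ For every sequence of models with $n\to\infty$ satisfying (A1), (A2) and (A4) this probability tends to $1$. 3. For every $\epsilon>0$ there are $c_5,c_6>0$ such that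 under (A1) and (A2) $$\mathbb P\Bigl(\Bigl|\frac{\hat k}{k_0}-1\Bigr|\ge\epsilon\Bigr)\le c_5p^2n\bigl[e^{-c_6\tau}+ne^{-c_6\sqrt\tau}\bigr].$$ For every sequence of models with $n\to\infty$ satisfying (A1), (A2) and (A4), $\hat k/k_0\to1$ in probability. 4. There is $A_0>0$ such that for every $A\ge A_0$ and every sequence of models with $n\to\infty$ for which $k_0>n^{\varepsilon_0}$ eventually for some $0<\varepsilon_0<1$ and $pn^{-K}\to0$ for some $0<K<\infty$, condition (A4) holds with $\tau=A\max(\log p,\log n)$. The constants $c_1,\dots,c_4$ depend only on $C_1,C_2,M,C,c$; $c_5,c_6$ may in addition depend on $\epsilon$, and $A_0$ on $c$. -/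

import Mathlib

open MeasureTheory ProbabilityTheory Filter Topology

universe u

noncomputable section

/-- A sample of `n` independent random vectors in `ℝ^p` with common mean `mean`, whose covariance
matrix is `S₁` for the first `k₀` observations and `S₂ ≠ S₁` for the last `n - k₀` observations.
Observations and coordinates are numbered from `0`: the first `k` observations are the `X i` with
`(i : ℕ) < k`. The condition `4 ≤ n` makes the screening statistic `D` below well defined. -/
structure ChangePointModel : Type (u + 1) where
  n : ℕ
  p : ℕ
  k₀ : ℕ
  four_le_n : 4 ≤ n
  one_le_k₀ : 1 ≤ k₀
  k₀_lt_n : k₀ < n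
  Ω : Type u
  [mΩ : MeasurableSpace Ω]
  P : Measure Ω
  [isProb : IsProbabilityMeasure P]
  X : Fin n → Ω → Fin p → ℝ
  measurable_X : ∀ i, Measurable (X i)
  indep : iIndepFun X P
  memLp_two : ∀ i a, MemLp (fun ω => X i ω a) 2 P
  mean : Fin p → ℝ
  mean_eq : ∀ i a, ∫ ω, X i ω a ∂P = mean a
  S₁ : Matrix (Fin p) (Fin p) ℝ
  S₂ : Matrix (Fin p) (Fin p) ℝ
  cov_before : ∀ i : Fin n, (i : ℕ) < k₀ →
    ∀ a b, covariance (fun ω => X i ω a) (fun ω => X i ω b) P = S₁ a b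
  cov_after : ∀ i : Fin n, k₀ ≤ (i : ℕ) →
    ∀ a b, covariance (fun ω => X i ω a) (fun ω => X i ω b) P = S₂ a b
  S₁_ne_S₂ : S₁ ≠ S₂

attribute [instance] ChangePointModel.mΩ ChangePointModel.isProb

namespace ChangePointModel



variable (m : ChangePointModel.{u})

/-- The centered observation `X_{ia} - n⁻¹ ∑_j X_{ja}`. -/
def centered (i : Fin m.n) (ω : m.Ω) (a : Fin m.p) : ℝ :=
  m.X i ω a - (∑ j : Fin m.n, m.X j ω a) / (m.n : ℝ)

/-- The entry at position `q = (a, b)` of `vech (ẋ_i ẋ_iᵀ)`; only positions with `a ≤ b` are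
used. -/
def T (i : Fin m.n) (ω : m.Ω) (q : Fin m.p × Fin m.p) : ℝ :=
  m.centered i ω q.1 * m.centered i ω q.2

/-- The indices of the first `k` observations. -/
def before (k : ℕ) : Finset (Fin m.n) := Finset.univ.filter fun i => (i : ℕ) < k

/-- The indices of the last `n - k` observations. -/
def after (k : ℕ) : Finset (Fin m.n) := Finset.univ.filter fun i => k ≤ (i : ℕ)

/-- The statistic `V_k(a, b)`, for `2 ≤ k ≤ n - 2`. -/
def V (k : ℕ) (q : Fin m.p × Fin m.p) (ω : m.Ω) : ℝ :=
  1 / ((k : ℝ) * ((k : ℝ) - 1)) *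
      (∑ i ∈ m.before k, ∑ j ∈ (m.before k).erase i, m.T i ω q * m.T j ω q)
  + 1 / (((m.n : ℝ) - k) * ((m.n : ℝ) - k - 1)) *
      (∑ i ∈ m.after k, ∑ j ∈ (m.after k).erase i, m.T i ω q * m.T j ω q)
  - 2 / ((k : ℝ) * ((m.n : ℝ) - k)) *
      (∑ i ∈ m.before k, ∑ j ∈ m.after k, m.T i ω q * m.T j ω q)

/-- The screening statistic `D(a, b) = (n - 3)⁻¹ ∑_{k=2}^{n-2} k (n - k) / n * V_k(a, b)`. -/
def D (q : Fin m.p × Fin m.p) (ω : m.Ω) : ℝ :=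
  1 / ((m.n : ℝ) - 3) *
    ∑ k ∈ Finset.Icc 2 (m.n - 2), (k : ℝ) * ((m.n : ℝ) - k) / (m.n : ℝ) * m.V k q ω

open Classical in
/-- The (random) set `𝒟_τ` of the positions `a ≤ b` with `D(a, b) > τ`. -/
def selected (τ : ℝ) (ω : m.Ω) : Finset (Fin m.p × Fin m.p) :=
  Finset.univ.filter fun q => q.1 ≤ q.2 ∧ τ < m.D q ω

/-- The set `𝒩` of the positions `a ≤ b` at which the two covariance matrices agree. -/
def equalEntries : Set (Fin m.p × Fin m.p) :=
  {q | q.1 ≤ q.2 ∧ m.S₁ q.1 q.2 = m.S₂ q.1 q.2}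

/-- The set `𝒫` of the positions `a ≤ b` at which the two covariance matrices differ by more
than `lam`. -/
def largeEntries (lam : ℝ) : Set (Fin m.p × Fin m.p) :=
  {q | q.1 ≤ q.2 ∧ lam < |m.S₁ q.1 q.2 - m.S₂ q.1 q.2|}

/-- The statistic `U_n(k)`, computed from the selected positions. -/
def U (τ : ℝ) (k : ℕ) (ω : m.Ω) : ℝ :=
  1 / (m.n : ℝ) ^ 4 *
    ∑ i ∈ m.before k, ∑ t ∈ (m.before k).erase i,
      ∑ j ∈ m.after k, ∑ l ∈ (m.after k).erase j,
        ∑ q ∈ m.selected τ ω, (m.T i ω q - m.T j ω q) * (m.T t ω q - m.T l ω q)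

/-- `khat` is a change point estimator: it picks a maximizer of `U_n` over `{1, …, n}`. -/
def IsEstimator (τ : ℝ) (khat : m.Ω → ℕ) : Prop :=
  ∀ ω, khat ω ∈ Finset.Icc 1 m.n ∧ ∀ k ∈ Finset.Icc 1 m.n, m.U τ k ω ≤ m.U τ (khat ω) ω

/-- All coordinates of all observations are sub-Gaussian with constants `C₁`, `C₂`, and both
covariance matrices have spectral norm at most `M`. -/
def SubGaussianBounded (C₁ C₂ M : ℝ) : Prop :=
  (∀ i a, ∀ t > 0, m.P.real {ω | t < |m.X i ω a|} ≤ C₁ * Real.exp (-C₂ * t ^ 2)) ∧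
  ‖Matrix.toEuclideanCLM (𝕜 := ℝ) m.S₁‖ ≤ M ∧ ‖Matrix.toEuclideanCLM (𝕜 := ℝ) m.S₂‖ ≤ M

/-- Size of the change: every nonzero entry of `S₁ - S₂` exceeds `lam` in absolute value, and
`lam ≥ C √(τ / n) max (n² / (n - k₀)², n² / k₀²)`. -/
def SignalSize (C τ lam : ℝ) : Prop :=
  (∀ a b, m.S₁ a b ≠ m.S₂ a b → lam < |m.S₁ a b - m.S₂ a b|) ∧
  C * √(τ / (m.n : ℝ)) *
    max ((m.n : ℝ) ^ 2 / ((m.n : ℝ) - m.k₀) ^ 2) ((m.n : ℝ) ^ 2 / (m.k₀ : ℝ) ^ 2) ≤ lam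

end ChangePointModel

/-- Growth conditions on a sequence of models with thresholds `τ`: `k₀ > n^ε` for some
`0 < ε < 1`, `p n^{-K} → 0` for some `K > 0`, and `p n e^{-c τ} → 0`. -/
def GrowthCondition (c : ℝ) (m : ℕ → ChangePointModel.{u}) (τ : ℕ → ℝ) : Prop :=
  (∃ ε : ℝ, 0 < ε ∧ ε < 1 ∧ ∀ᶠ s in atTop, ((m s).n : ℝ) ^ ε < ((m s).k₀ : ℝ)) ∧
  (∃ K : ℝ, 0 < K ∧
    Tendsto (fun s => ((m s).p : ℝ) * ((m s).n : ℝ) ^ (-K)) atTop (𝓝 0)) ∧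
  Tendsto (fun s => ((m s).p : ℝ) * ((m s).n : ℝ) * Real.exp (-c * τ s)) atTop (𝓝 0)

end

/-! Write `T_i = step_i + x + noise_i` at each position. The step takes the two covariance entries
as values, `x` is the product of the two sample means of the centered observations and does not
depend on `i`, and the noise is the centered product `W_i` minus two cross terms with these sample
means. Up to within-group sums of squares, the summands of `D` and the summands of `U_n` are squares
of the contrast `n S_k - k S_n`. The contrast annihilates `x` and maps the step to its height times
a tent function with peak at `k₀`. So a position without change sees only noise, a changed position
sees a large tent, and `U_n` loses a fixed fraction of its peak wherever `k` is far from `k₀`.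

All deterministic conclusions rest on one property of the noise, `SegBound`: sums and sums of
squares over every interval `I` are at most `δ (τ |I| + H)`. Under it `D_le_of_eq` and `lt_D_of_ne`
separate the two kinds of positions, so `selected_eq_changed` replaces the random selection by a
deterministic set.

`SegBound` is proved in two forms. The crude form (`exists_crude_event`) has `H = 0` and fails with
probability `O(p² n² exp(-c √τ))`, since products of sub-Gaussian variables have only exponential
tails. It alone gives the three finite-sample bounds, whose other exponential terms are not needed.
The fine form (`exists_fine_event`) has `H = τ²`, requires `τ ≤ n` and fails with probability `O(p²
n² exp(-c τ))`. The excess `H` is harmless if `τ ≤ √n`, because it is averaged over `k`. For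
sequences, the fine form is used if `τ ≤ √n` and the crude one if `τ ≥ √n`, where `exp(-b n^{1/4})`
beats every power of `n` (`GrowthCondition.tendsto_of_regimes`).

Consistency of the estimator needs one more idea when `τ ≤ √n`: the constant `c` is fixed before the
accuracy `ε`, so `δ` cannot shrink with `ε`. Partial sums are therefore compared with their values
on a grid of `J` blocks. The increments inside blocks are small because the blocks are short, and
the grid values are controlled in mean: summed over all changed positions, the expected noise is
`O(1/√τ)` times the signal, and Markov's inequality finishes without a union bound
(`exists_meanNoise_event`, `estimator_close_of_meanNoise`). -/

/-! ### Sums over index intervals and elementary identities. -/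

/-- The indices `i` with `l ≤ i < r`. -/
def seg {n : ℕ} (l r : ℕ) : Finset (Fin n) :=
  Finset.univ.filter fun i => l ≤ (i : ℕ) ∧ (i : ℕ) < r

lemma mem_seg {n l r : ℕ} {i : Fin n} : i ∈ (seg l r : Finset (Fin n)) ↔ l ≤ (i : ℕ) ∧ (i : ℕ) < r := by
  simp [seg]

lemma card_seg {n l r : ℕ} (hr : r ≤ n) : (seg l r : Finset (Fin n)).card = r - l := by
  have h : (seg l r : Finset (Fin n)).map Fin.valEmbedding = Finset.Ico l r := by
    ext x
    simp only [Finset.mem_map, mem_seg, Fin.valEmbedding_apply, Finset.mem_Ico]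
    constructor
    · rintro ⟨i, hi, rfl⟩; exact hi
    · intro hx; exact ⟨⟨x, by omega⟩, hx, rfl⟩
  rw [← Finset.card_map Fin.valEmbedding, h, Nat.card_Ico]

lemma card_seg_cast {n l r : ℕ} (hl : l ≤ r) (hr : r ≤ n) :
    ((seg l r : Finset (Fin n)).card : ℝ) = (r : ℝ) - l := by
  rw [card_seg hr, Nat.cast_sub hl]

lemma seg_zero_self {n : ℕ} : (seg 0 n : Finset (Fin n)) = Finset.univ := by
  ext i; simp [mem_seg]

lemma sum_seg_add {n l c r : ℕ} (hlc : l ≤ c) (hcr : c ≤ r) (y : Fin n → ℝ) :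
    ∑ i ∈ seg l c, y i + ∑ i ∈ seg c r, y i = ∑ i ∈ seg l r, y i := by
  rw [← Finset.sum_union]
  · congr 1; ext i; simp only [Finset.mem_union, mem_seg]; omega
  · rw [Finset.disjoint_left]; intro i; simp only [mem_seg]; omega

lemma sum_prefix_add_suffix {n k : ℕ} (hk : k ≤ n) (y : Fin n → ℝ) :
    ∑ i ∈ seg 0 k, y i + ∑ i ∈ seg k n, y i = ∑ i, y i := by
  rw [sum_seg_add (Nat.zero_le _) hk, seg_zero_self]

lemma sum_sum_erase_mul {ι : Type*} [DecidableEq ι] (A : Finset ι) (t : ι → ℝ) :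
    ∑ i ∈ A, ∑ j ∈ A.erase i, t i * t j = (∑ i ∈ A, t i) ^ 2 - ∑ i ∈ A, t i ^ 2 := by
  have h : ∀ i ∈ A, ∑ j ∈ A.erase i, t i * t j = t i * (∑ j ∈ A, t j) - t i ^ 2 := by
    intro i hi
    rw [← Finset.mul_sum, ← Finset.sum_erase_add A t hi]; ring
  rw [Finset.sum_congr rfl h, Finset.sum_sub_distrib, ← Finset.sum_mul, sq]

lemma sum_erase_eq {ι : Type*} [DecidableEq ι] {A : Finset ι} {i : ι} (hi : i ∈ A) (g : ι → ℝ) :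
    ∑ j ∈ A.erase i, g j = ∑ j ∈ A, g j - g i := by
  rw [← Finset.sum_erase_add A g hi]; ring

lemma sum_quadruple {ι : Type*} [DecidableEq ι] (A B : Finset ι) (t : ι → ℝ) :
    ∑ i ∈ A, ∑ r ∈ A.erase i, ∑ j ∈ B, ∑ l ∈ B.erase j, (t i - t j) * (t r - t l) =
      B.card * ((B.card : ℝ) - 1) * ((∑ i ∈ A, t i) ^ 2 - ∑ i ∈ A, t i ^ 2)
      + A.card * ((A.card : ℝ) - 1) * ((∑ i ∈ B, t i) ^ 2 - ∑ i ∈ B, t i ^ 2)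
      - 2 * ((A.card : ℝ) - 1) * ((B.card : ℝ) - 1) * ((∑ i ∈ A, t i) * ∑ i ∈ B, t i) := by
  have h1 : ∀ x y : ℝ, ∑ j ∈ B, ∑ l ∈ B.erase j, (x - t j) * (y - t l) =
      B.card * ((B.card : ℝ) - 1) * (x * y) - ((B.card : ℝ) - 1) * (∑ i ∈ B, t i) * (x + y)
        + ((∑ i ∈ B, t i) ^ 2 - ∑ i ∈ B, t i ^ 2) := by
    intro x y
    have : ∀ j ∈ B, ∑ l ∈ B.erase j, (x - t j) * (y - t l) =
        (x * (B.card * y - ∑ l ∈ B, t l) - x * y)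
          + (x - (B.card * y - ∑ l ∈ B, t l) + y) * t j - t j ^ 2 := by
      intro j hj
      rw [sum_erase_eq hj, ← Finset.mul_sum, Finset.sum_sub_distrib]
      simp only [Finset.sum_const, nsmul_eq_mul]
      ring
    rw [Finset.sum_congr rfl this, Finset.sum_sub_distrib, Finset.sum_add_distrib, ← Finset.mul_sum]
    simp only [Finset.sum_const, nsmul_eq_mul]
    ring
  have h2 : ∀ i ∈ A, ∑ r ∈ A.erase i, ∑ j ∈ B, ∑ l ∈ B.erase j, (t i - t j) * (t r - t l) =
      t i * ((B.card * ((B.card : ℝ) - 1)) * (∑ r ∈ A, t r)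
          - ((B.card : ℝ) - 1) * (∑ i ∈ B, t i) * ((A.card : ℝ) - 2))
        + (-((B.card : ℝ) - 1) * (∑ i ∈ B, t i) * (∑ r ∈ A, t r)
          + ((A.card : ℝ) - 1) * ((∑ i ∈ B, t i) ^ 2 - ∑ i ∈ B, t i ^ 2))
        - B.card * ((B.card : ℝ) - 1) * t i ^ 2 := by
    intro i hi
    rw [Finset.sum_congr rfl fun r _ => h1 (t i) (t r), sum_erase_eq hi, Finset.sum_add_distrib,
      Finset.sum_sub_distrib, ← Finset.mul_sum, ← Finset.mul_sum, ← Finset.mul_sum,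
      Finset.sum_add_distrib]
    simp only [Finset.sum_const, nsmul_eq_mul]
    ring
  rw [Finset.sum_congr rfl h2, Finset.sum_sub_distrib, Finset.sum_add_distrib, ← Finset.sum_mul,
    ← Finset.mul_sum]
  simp only [Finset.sum_const, nsmul_eq_mul]
  ring

/-- The scaled two-sample statistic in terms of the contrast of the sums and the within-group
sums of squares. -/
lemma scaled_contrast_identity {k N a b qa qb : ℝ} (hk : 1 < k) (hN : 1 < N) :
    k * N / (k + N) * (1 / (k * (k - 1)) * (a ^ 2 - qa) + 1 / (N * (N - 1)) * (b ^ 2 - qb)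
      - 2 / (k * N) * (a * b)) =
    (N * a - k * b) ^ 2 / ((k + N) * k * N) - N / ((k + N) * (k - 1)) * (qa - a ^ 2 / k)
      - k / ((k + N) * (N - 1)) * (qb - b ^ 2 / N) := by
  have h1 : k - 1 ≠ 0 := by linarith
  have h2 : N - 1 ≠ 0 := by linarith
  have h3 : k ≠ 0 := by linarith
  have h4 : N ≠ 0 := by linarith
  have h5 : k + N ≠ 0 := by linarith
  field_simp
  ring

lemma sq_sum_div_le {ι : Type*} (A : Finset ι) (t : ι → ℝ) :
    (∑ i ∈ A, t i) ^ 2 / (A.card : ℝ) ≤ ∑ i ∈ A, t i ^ 2 := by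
  rcases A.eq_empty_or_nonempty with rfl | h
  · simp
  · rw [div_le_iff₀ (by exact_mod_cast h.card_pos), mul_comm]
    exact sq_sum_le_card_mul_sum_sq

/-- The mean minimizes the sum of squared deviations, so any convenient centre `x` may be used for
an upper bound. -/
lemma within_le_sum_sub_sq {ι : Type*} (A : Finset ι) (t : ι → ℝ) (x : ℝ) :
    ∑ i ∈ A, t i ^ 2 - (∑ i ∈ A, t i) ^ 2 / (A.card : ℝ) ≤ ∑ i ∈ A, (t i - x) ^ 2 := by
  rcases A.eq_empty_or_nonempty with rfl | h
  · simp
  have hc : (0 : ℝ) < A.card := by exact_mod_cast h.card_pos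
  have e : ∑ i ∈ A, (t i - x) ^ 2 = ∑ i ∈ A, t i ^ 2 - 2 * x * ∑ i ∈ A, t i + A.card * x ^ 2 := by
    rw [Finset.mul_sum, ← nsmul_eq_mul, ← Finset.sum_const, ← Finset.sum_sub_distrib,
      ← Finset.sum_add_distrib]
    exact Finset.sum_congr rfl fun i _ => by ring
  rw [e]
  have : 0 ≤ A.card * (x - (∑ i ∈ A, t i) / A.card) ^ 2 := by positivity
  have e2 : A.card * (x - (∑ i ∈ A, t i) / A.card) ^ 2 =
      A.card * x ^ 2 - 2 * x * ∑ i ∈ A, t i + (∑ i ∈ A, t i) ^ 2 / (A.card : ℝ) := by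
    field_simp
    ring
  linarith

/-- Telescoping, from `1 / (m + 1) ≤ 2 (√(m + 1) - √m)`. The order `√m` instead of `log m` suffices
because it only meets an `H` bounded by `τ √n`. -/
lemma sum_inv_le_two_sqrt (m : ℕ) : ∑ k ∈ Finset.Icc 1 m, (1 / (k : ℝ)) ≤ 2 * √(m : ℝ) := by
  induction m with
  | zero => simp
  | succ m ih =>
    rw [Finset.sum_Icc_succ_top (by omega)]
    have h0 : (0 : ℝ) ≤ m := Nat.cast_nonneg m
    have h1 : √(m : ℝ) ^ 2 = m := Real.sq_sqrt h0
    have h2 : √((m + 1 : ℕ) : ℝ) ^ 2 = m + 1 := by rw [Real.sq_sqrt (by positivity)]; push_cast; ring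
    set u := √(m : ℝ)
    set v := √((m + 1 : ℕ) : ℝ)
    have hu : 0 ≤ u := Real.sqrt_nonneg _
    have hv : 1 ≤ v := by
      rw [← Real.sqrt_one]; exact Real.sqrt_le_sqrt (by push_cast; linarith)
    have huv : u ≤ v := Real.sqrt_le_sqrt (by push_cast; linarith)
    have : 1 / ((m + 1 : ℕ) : ℝ) ≤ 2 * (v - u) := by
      rw [div_le_iff₀ (by positivity)]
      push_cast
      rw [← h2]
      have : (v - u) * (v + u) = 1 := by nlinarith
      nlinarith [mul_nonneg (sub_nonneg.2 huv) (sub_nonneg.2 huv)]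
    linarith

/-- A single term `H / k` can be of order `τ √n` for small `k`, but the average over `k` is of order
`τ`. The two harmonic sums contribute at most `4 τ n ≤ 16 τ (n - 3)`, which uses `n ≥ 4`, and `18 =
2 + 16`. -/
lemma average_inv_le {n : ℕ} (hn : 4 ≤ n) {τ H : ℝ} (hH0 : 0 ≤ H) (hH : H ≤ τ * √(n : ℝ)) :
    1 / ((n : ℝ) - 3) * ∑ k ∈ Finset.Icc 2 (n - 2), (2 * τ + H / (k : ℝ) + H / ((n : ℝ) - k)) ≤
      18 * τ := by
  have hn' : (4 : ℝ) ≤ n := by exact_mod_cast hn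
  have hs : 0 < √(n : ℝ) := Real.sqrt_pos.2 (by linarith)
  have hτ : 0 ≤ τ := by
    by_contra! h
    nlinarith
  have hcard : ((Finset.Icc 2 (n - 2)).card : ℝ) = (n : ℝ) - 3 := by
    rw [Nat.card_Icc, show n - 2 + 1 - 2 = n - 3 by omega, Nat.cast_sub (by omega)]; norm_num
  have h1 : ∑ k ∈ Finset.Icc 2 (n - 2), (1 / (k : ℝ)) ≤ 2 * √(n : ℝ) := by
    refine le_trans (Finset.sum_le_sum_of_subset_of_nonneg ?_ fun _ _ _ => by positivity)
      (sum_inv_le_two_sqrt n)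
    intro k; simp only [Finset.mem_Icc]; omega
  have h2 : ∑ k ∈ Finset.Icc 2 (n - 2), (1 / ((n : ℝ) - k)) =
      ∑ k ∈ Finset.Icc 2 (n - 2), (1 / (k : ℝ)) := by
    refine Finset.sum_nbij' (fun k => n - k) (fun k => n - k) ?_ ?_ ?_ ?_ ?_
    · intro k; simp only [Finset.mem_Icc]; omega
    · intro k; simp only [Finset.mem_Icc]; omega
    · intro k; simp only [Finset.mem_Icc]; omega
    · intro k; simp only [Finset.mem_Icc]; omega
    · intro k hk
      simp only [Finset.mem_Icc] at hk
      rw [Nat.cast_sub (by omega)]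
  have e : ∑ k ∈ Finset.Icc 2 (n - 2), (2 * τ + H / (k : ℝ) + H / ((n : ℝ) - k)) =
      ((n : ℝ) - 3) * (2 * τ) + H * (2 * ∑ k ∈ Finset.Icc 2 (n - 2), (1 / (k : ℝ))) := by
    rw [two_mul (∑ k ∈ Finset.Icc 2 (n - 2), (1 / (k : ℝ)))]
    nth_rewrite 2 [← h2]
    rw [mul_add, Finset.mul_sum, Finset.mul_sum, ← hcard, ← nsmul_eq_mul, ← Finset.sum_const,
      ← Finset.sum_add_distrib, ← Finset.sum_add_distrib]
    exact Finset.sum_congr rfl fun i _ => by ring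
  rw [e, one_div, ← div_eq_inv_mul, div_le_iff₀ (by linarith)]
  have : H * (2 * ∑ k ∈ Finset.Icc 2 (n - 2), (1 / (k : ℝ))) ≤ 4 * τ * n := by
    calc _ ≤ (τ * √(n : ℝ)) * (2 * (2 * √(n : ℝ))) := by gcongr
      _ = 4 * τ * √(n : ℝ) ^ 2 := by ring
      _ = _ := by rw [Real.sq_sqrt (by linarith)]
  nlinarith

/-! ### Deterministic analysis of the screening statistic of one sequence. -/

/-- The within-group sum of squares of `t` over `A`. -/
noncomputable def withinSS {ι : Type*} (A : Finset ι) (t : ι → ℝ) : ℝ :=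
  ∑ i ∈ A, t i ^ 2 - (∑ i ∈ A, t i) ^ 2 / (A.card : ℝ)

lemma withinSS_nonneg {ι : Type*} (A : Finset ι) (t : ι → ℝ) : 0 ≤ withinSS A t :=
  sub_nonneg.2 (sq_sum_div_le A t)

/-- The contrast `n S_k - k S_n` of the partial sums of `t`. -/
noncomputable def contrast {n : ℕ} (t : Fin n → ℝ) (k : ℕ) : ℝ :=
  (n : ℝ) * ∑ i ∈ seg 0 k, t i - (k : ℝ) * ∑ i, t i

/-- The `k`-th summand of the screening statistic. -/
noncomputable def screenTerm {n : ℕ} (t : Fin n → ℝ) (k : ℕ) : ℝ :=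
  contrast t k ^ 2 / ((n : ℝ) * k * ((n : ℝ) - k))
    - ((n : ℝ) - k) / ((n : ℝ) * ((k : ℝ) - 1)) * withinSS (seg 0 k) t
    - (k : ℝ) / ((n : ℝ) * ((n : ℝ) - k - 1)) * withinSS (seg k n) t

/-- The screening statistic of the sequence `t`. -/
noncomputable def screen {n : ℕ} (t : Fin n → ℝ) : ℝ :=
  1 / ((n : ℝ) - 3) * ∑ k ∈ Finset.Icc 2 (n - 2), screenTerm t k

/-- Sums and sums of squares of `y` over all intervals `I` are at most of the order
`τ |I| + H`. -/
def SegBound {n : ℕ} (y : Fin n → ℝ) (δ τ H : ℝ) : Prop :=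
  ∀ l r : ℕ, l ≤ r → r ≤ n →
    (∑ i ∈ seg l r, y i) ^ 2 ≤ δ * (τ * ((r : ℝ) - l) + H) ∧
    ∑ i ∈ seg l r, y i ^ 2 ≤ δ * (τ * ((r : ℝ) - l) + H)

/-- The shape `n min(k, k₀) - k k₀` of the contrast of a step function. -/
noncomputable def tent (n k₀ k : ℕ) : ℝ := (n : ℝ) * (min k k₀ : ℕ) - (k : ℝ) * k₀

lemma tent_of_le {n k₀ k : ℕ} (h : k ≤ k₀) : tent n k₀ k = (k : ℝ) * ((n : ℝ) - k₀) := by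
  rw [tent, min_eq_left h]; ring

lemma tent_of_ge {n k₀ k : ℕ} (h : k₀ ≤ k) : tent n k₀ k = (k₀ : ℝ) * ((n : ℝ) - k) := by
  rw [tent, min_eq_right h]; ring

lemma tent_nonneg {n k₀ k : ℕ} (hk₀ : k₀ ≤ n) (hk : k ≤ n) : 0 ≤ tent n k₀ k := by
  have h1 : (k₀ : ℝ) ≤ n := by exact_mod_cast hk₀
  have h2 : (k : ℝ) ≤ n := by exact_mod_cast hk
  rcases le_total k k₀ with h | h
  · rw [tent_of_le h]; exact mul_nonneg (Nat.cast_nonneg _) (by linarith)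
  · rw [tent_of_ge h]; exact mul_nonneg (Nat.cast_nonneg _) (by linarith)

lemma sum_seg_step {n k₀ k : ℕ} (hk : k ≤ n) (s₁ s₂ : ℝ) :
    ∑ i ∈ (seg 0 k : Finset (Fin n)), (if (i : ℕ) < k₀ then s₁ else s₂) =
      (min k k₀ : ℕ) * (s₁ - s₂) + k * s₂ := by
  have h : ∀ i : Fin n, (if (i : ℕ) < k₀ then s₁ else s₂) =
      (if (i : ℕ) < k₀ then s₁ - s₂ else 0) + s₂ := by intro i; split_ifs <;> ring
  rw [Finset.sum_congr rfl fun i _ => h i, Finset.sum_add_distrib, ← Finset.sum_filter,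
    Finset.sum_const, Finset.sum_const, card_seg hk]
  have : (seg 0 k : Finset (Fin n)).filter (fun i : Fin n => (i : ℕ) < k₀) = seg 0 (min k k₀) := by
    ext i; simp only [Finset.mem_filter, mem_seg]; omega
  rw [this, card_seg (by omega)]
  simp

/-- The contrast is linear and vanishes on constants, so the common shift `x` drops out. -/
lemma contrast_step_add {n k₀ k : ℕ} (hk₀ : k₀ ≤ n) (hk : k ≤ n) {s₁ s₂ x : ℝ}
    {t y : Fin n → ℝ} (ht : ∀ i, t i = (if (i : ℕ) < k₀ then s₁ else s₂) + x + y i) :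
    contrast t k = (s₁ - s₂) * tent n k₀ k + contrast y k := by
  have h : ∀ k ≤ n, ∑ i ∈ (seg 0 k : Finset (Fin n)), t i =
      (min k k₀ : ℕ) * (s₁ - s₂) + k * s₂ + k * x + ∑ i ∈ seg 0 k, y i := by
    intro k hk
    rw [Finset.sum_congr rfl fun i _ => ht i, Finset.sum_add_distrib, Finset.sum_add_distrib,
      sum_seg_step hk, Finset.sum_const, card_seg hk]
    simp
  have hn := h n le_rfl
  rw [seg_zero_self, min_eq_right hk₀] at hn
  rw [contrast, contrast, h k hk, hn, tent]
  ring

lemma contrast_eq {n k : ℕ} (hk : k ≤ n) (y : Fin n → ℝ) :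
    contrast y k = ((n : ℝ) - k) * ∑ i ∈ seg 0 k, y i - (k : ℝ) * ∑ i ∈ seg k n, y i := by
  rw [contrast, ← sum_prefix_add_suffix hk y]; ring

lemma SegBound.prefix {n : ℕ} {y : Fin n → ℝ} {δ τ H : ℝ} (h : SegBound y δ τ H) {k : ℕ}
    (hk : k ≤ n) : (∑ i ∈ seg 0 k, y i) ^ 2 ≤ δ * (τ * k + H) ∧
      ∑ i ∈ seg 0 k, y i ^ 2 ≤ δ * (τ * k + H) := by
  simpa using h 0 k (Nat.zero_le _) hk

section terms

variable {n k : ℕ} (hk : 2 ≤ k) (hkn : k + 2 ≤ n)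
include hk hkn

lemma screenTerm_le (t : Fin n → ℝ) :
    screenTerm t k ≤ contrast t k ^ 2 / ((n : ℝ) * k * ((n : ℝ) - k)) := by
  have h1 : (2 : ℝ) ≤ k := by exact_mod_cast hk
  have h2 : (k : ℝ) + 2 ≤ n := by exact_mod_cast hkn
  have a1 : 0 ≤ ((n : ℝ) - k) / ((n : ℝ) * ((k : ℝ) - 1)) * withinSS (seg 0 k) t :=
    mul_nonneg (div_nonneg (by linarith) (mul_nonneg (by linarith) (by linarith)))
      (withinSS_nonneg _ _)
  have a2 : 0 ≤ (k : ℝ) / ((n : ℝ) * ((n : ℝ) - k - 1)) * withinSS (seg k n) t :=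
    mul_nonneg (div_nonneg (by linarith) (mul_nonneg (by linarith) (by linarith)))
      (withinSS_nonneg _ _)
  rw [screenTerm]; linarith

/-- Since `(N a - K b)² ≤ 2 N² a² + 2 K² b²`, the contrast splits into prefix and suffix. The
normalization leaves for each the squared sum divided by the length of the interval, which is what
`SegBound` controls. -/
lemma contrast_sq_div_le {y : Fin n → ℝ} {δ τ H : ℝ} (h : SegBound y δ τ H) :
    contrast y k ^ 2 / ((n : ℝ) * k * ((n : ℝ) - k)) ≤
      2 * δ * (2 * τ + H / (k : ℝ) + H / ((n : ℝ) - k)) := by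
  have h1 : (2 : ℝ) ≤ k := by exact_mod_cast hk
  have h2 : (k : ℝ) + 2 ≤ n := by exact_mod_cast hkn
  obtain ⟨hA, -⟩ := h.prefix (show k ≤ n by omega)
  obtain ⟨hB, -⟩ := h k n (by omega) le_rfl
  rw [contrast_eq (by omega)]
  set a := ∑ i ∈ seg 0 k, y i
  set b := ∑ i ∈ seg k n, y i
  obtain ⟨N, hN⟩ : ∃ N : ℝ, N = (n : ℝ) - k := ⟨_, rfl⟩
  rw [← hN] at hB ⊢
  have hn : (n : ℝ) = k + N := by linarith
  have hN2 : 2 ≤ N := by linarith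
  rw [hn]
  set K : ℝ := (k : ℝ)
  have e1 : (N * a - K * b) ^ 2 / ((K + N) * K * N) ≤ 2 * (a ^ 2 / K) + 2 * (b ^ 2 / N) := by
    have : 2 * (a ^ 2 / K) + 2 * (b ^ 2 / N) =
        (2 * N * (K + N) * a ^ 2 + 2 * K * (K + N) * b ^ 2) / ((K + N) * K * N) := by
      field_simp
    rw [this]
    gcongr
    nlinarith [sq_nonneg (N * a + K * b), mul_nonneg (by positivity : 0 ≤ K * N) (sq_nonneg a),
      mul_nonneg (by positivity : 0 ≤ K * N) (sq_nonneg b)]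
  have e2 : a ^ 2 / K ≤ δ * (τ + H / K) := by
    rw [div_le_iff₀ (by linarith)]
    calc a ^ 2 ≤ δ * (τ * K + H) := hA
      _ = _ := by field_simp
  have e3 : b ^ 2 / N ≤ δ * (τ + H / N) := by
    rw [div_le_iff₀ (by linarith)]
    calc b ^ 2 ≤ δ * (τ * N + H) := hB
      _ = _ := by field_simp
  calc _ ≤ _ := e1
    _ ≤ 2 * (δ * (τ + H / K)) + 2 * (δ * (τ + H / N)) := by linarith
    _ = _ := by ring

lemma screenTerm_ge {k₀ : ℕ} (hk₀ : k₀ ≤ n) {s₁ s₂ x : ℝ} {t y : Fin n → ℝ}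
    (ht : ∀ i, t i = (if (i : ℕ) < k₀ then s₁ else s₂) + x + y i) {δ τ H : ℝ}
    (h : SegBound y δ τ H) :
    (s₁ - s₂) ^ 2 / 2 * (tent n k₀ k ^ 2 / ((n : ℝ) * k * ((n : ℝ) - k))) - 2 * (s₁ - s₂) ^ 2
      - 6 * δ * (2 * τ + H / (k : ℝ) + H / ((n : ℝ) - k)) ≤ screenTerm t k := by
  have h1 : (2 : ℝ) ≤ k := by exact_mod_cast hk
  have h2 : (k : ℝ) + 2 ≤ n := by exact_mod_cast hkn
  have hc := contrast_sq_div_le hk hkn h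
  obtain ⟨-, hA⟩ := h.prefix (show k ≤ n by omega)
  obtain ⟨-, hB⟩ := h k n (by omega) le_rfl
  have hw : ∀ A : Finset (Fin n), withinSS A t ≤
      (A.card : ℝ) * ((s₁ - s₂) ^ 2 / 2) + 2 * ∑ i ∈ A, y i ^ 2 := by
    intro A
    -- A group may straddle `k₀`; centering at the midpoint of the two levels makes every deviation
    -- `±(s₁ - s₂)/2 + y i`, whatever the position of `A`.
    refine (within_le_sum_sub_sq A t ((s₁ + s₂) / 2 + x)).trans ?_
    rw [Finset.mul_sum, ← nsmul_eq_mul, ← Finset.sum_const, ← Finset.sum_add_distrib]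
    refine Finset.sum_le_sum fun i _ => ?_
    rw [ht i]
    split_ifs
    · nlinarith [sq_nonneg ((s₁ - s₂) / 2 - y i)]
    · nlinarith [sq_nonneg ((s₁ - s₂) / 2 + y i)]
  have wA := hw (seg 0 k)
  have wB := hw (seg k n)
  rw [card_seg_cast (Nat.zero_le _) (by omega), Nat.cast_zero, sub_zero] at wA
  rw [card_seg_cast (by omega) le_rfl] at wB
  have nA := withinSS_nonneg (seg 0 k : Finset (Fin n)) t
  have nB := withinSS_nonneg (seg k n : Finset (Fin n)) t
  rw [screenTerm, contrast_step_add hk₀ (by omega) ht]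
  set a := withinSS (seg 0 k : Finset (Fin n)) t
  set b := withinSS (seg k n : Finset (Fin n)) t
  set qa := ∑ i ∈ (seg 0 k : Finset (Fin n)), y i ^ 2
  set qb := ∑ i ∈ (seg k n : Finset (Fin n)), y i ^ 2
  set e := contrast y k
  set g := tent n k₀ k
  obtain ⟨N, hN⟩ : ∃ N : ℝ, N = (n : ℝ) - k := ⟨_, rfl⟩
  rw [← hN] at hc hB wB ⊢
  have hN2 : 2 ≤ N := by linarith
  set d := s₁ - s₂
  have e1 : d ^ 2 / 2 * (g ^ 2 / ((n : ℝ) * k * N)) - e ^ 2 / ((n : ℝ) * k * N) ≤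
      (d * g + e) ^ 2 / ((n : ℝ) * k * N) := by
    rw [← mul_div_assoc, ← sub_div]
    have : 0 < (n : ℝ) * k * N := mul_pos (mul_pos (by linarith) (by linarith)) (by linarith)
    gcongr
    nlinarith [sq_nonneg (d * g + 2 * e)]
  have aux : ∀ K R w q : ℝ, 2 ≤ K → 2 ≤ R → K + R = n → 0 ≤ w →
      w ≤ K * (d ^ 2 / 2) + 2 * q → q ≤ δ * (τ * K + H) →
      R / ((n : ℝ) * (K - 1)) * w ≤ d ^ 2 + 4 * δ * (τ + H / K) := by
    intro K R w q hK hR hKR hw0 hw hq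
    -- `R ≤ n` and, as `K ≥ 2`, also `K ≤ 2 (K - 1)`.
    have s1 : R / ((n : ℝ) * (K - 1)) ≤ 2 / K := by
      rw [div_le_div_iff₀ (mul_pos (by linarith) (by linarith)) (by linarith)]
      nlinarith
    calc R / ((n : ℝ) * (K - 1)) * w ≤ 2 / K * w := by gcongr
      _ ≤ 2 / K * (K * (d ^ 2 / 2) + 2 * (δ * (τ * K + H))) := by
        gcongr
        linarith
      _ = _ := by field_simp; ring
  have eA := aux k N a qa h1 hN2 (by linarith) nA wA hA
  have eB := aux N k b qb hN2 h1 (by linarith) nB wB hB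
  linarith

end terms

/-- With equal entries the screening statistic stays below a small multiple of the threshold. -/
lemma screen_le_of_eq {n k₀ : ℕ} (hn : 4 ≤ n) (hk₀ : k₀ ≤ n) {s x : ℝ} {t y : Fin n → ℝ}
    (ht : ∀ i, t i = (if (i : ℕ) < k₀ then s else s) + x + y i) {δ τ H : ℝ} (hδ : 0 ≤ δ)
    (hH0 : 0 ≤ H) (hH : H ≤ τ * √(n : ℝ)) (h : SegBound y δ τ H) :
    screen t ≤ 36 * δ * τ := by
  have hn' : (4 : ℝ) ≤ n := by exact_mod_cast hn
  calc screen t ≤ 1 / ((n : ℝ) - 3) * ∑ k ∈ Finset.Icc 2 (n - 2),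
        2 * δ * (2 * τ + H / (k : ℝ) + H / ((n : ℝ) - k)) := by
        refine mul_le_mul_of_nonneg_left (Finset.sum_le_sum fun k hk => ?_)
          (by rw [one_div, inv_nonneg]; linarith)
        rw [Finset.mem_Icc] at hk
        refine (screenTerm_le hk.1 (by omega) t).trans ?_
        rw [contrast_step_add hk₀ (by omega) ht, sub_self, zero_mul, zero_add]
        exact contrast_sq_div_le hk.1 (by omega) h
    _ = 2 * δ * (1 / ((n : ℝ) - 3) * ∑ k ∈ Finset.Icc 2 (n - 2),
        (2 * τ + H / (k : ℝ) + H / ((n : ℝ) - k))) := by rw [← Finset.mul_sum]; ring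
    _ ≤ 2 * δ * (18 * τ) := mul_le_mul_of_nonneg_left (average_inv_le hn hH0 hH) (by positivity)
    _ = _ := by ring

/-- Only a window next to the peak is kept: from half of `k₀` up to `k₀` if `k₀ ≤ n / 2`, and
otherwise from `k₀` half of the way to `n`. It contains at least `d / 2` indices, and each term
there is at least `d / 8`. -/
lemma average_tent_ge {n k₀ : ℕ} (hn : 4 ≤ n) {d : ℝ} (hd : 4 ≤ d) (h1 : d ≤ k₀)
    (h2 : d ≤ (n : ℝ) - k₀) :
    d ^ 2 / (16 * n) ≤ 1 / ((n : ℝ) - 3) *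
      ∑ k ∈ Finset.Icc 2 (n - 2), tent n k₀ k ^ 2 / ((n : ℝ) * k * ((n : ℝ) - k)) := by
  have hn' : (4 : ℝ) ≤ n := by exact_mod_cast hn
  have hk4 : 4 ≤ k₀ := by exact_mod_cast hd.trans h1
  have hkn : k₀ + 4 ≤ n := by
    have : (k₀ : ℝ) + 4 ≤ n := by linarith
    exact_mod_cast this
  have hnn : ∀ k ∈ Finset.Icc 2 (n - 2),
      0 ≤ tent n k₀ k ^ 2 / ((n : ℝ) * k * ((n : ℝ) - k)) := by
    intro k hk
    rw [Finset.mem_Icc] at hk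
    have : (k : ℝ) ≤ n := by exact_mod_cast (show k ≤ n by omega)
    exact div_nonneg (sq_nonneg _) (mul_nonneg (by positivity) (by linarith))
  have key : d ^ 2 / 16 ≤
      ∑ k ∈ Finset.Icc 2 (n - 2), tent n k₀ k ^ 2 / ((n : ℝ) * k * ((n : ℝ) - k)) := by
    rcases le_total (2 * k₀) n with hc | hc
    · have hc' : 2 * (k₀ : ℝ) ≤ n := by exact_mod_cast hc
      have hsub : Finset.Icc (k₀ - k₀ / 2) k₀ ⊆ Finset.Icc 2 (n - 2) := by
        intro k; simp only [Finset.mem_Icc]; omega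
      refine le_trans ?_ (Finset.sum_le_sum_of_subset_of_nonneg hsub fun k hk _ => hnn k hk)
      have hb : ∀ k ∈ Finset.Icc (k₀ - k₀ / 2) k₀, d / 8 ≤
          tent n k₀ k ^ 2 / ((n : ℝ) * k * ((n : ℝ) - k)) := by
        intro k hk
        rw [Finset.mem_Icc] at hk
        have a1 : (k₀ : ℝ) ≤ 2 * k := by exact_mod_cast (show k₀ ≤ 2 * k by omega)
        have a2 : (k : ℝ) ≤ k₀ := by exact_mod_cast hk.2
        rw [tent_of_le hk.2, le_div_iff₀ (mul_pos (mul_pos (by linarith) (by linarith))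
          (by linarith))]
        have a3 : (n : ℝ) / 2 ≤ (n : ℝ) - k₀ := by linarith
        have a6 : 0 ≤ (n : ℝ) - k := by linarith
        calc d / 8 * ((n : ℝ) * k * ((n : ℝ) - k)) ≤ (2 * k) / 8 * ((n : ℝ) * k * n) := by
              gcongr <;> linarith
          _ = ((k : ℝ) * ((n : ℝ) / 2)) ^ 2 := by ring
          _ ≤ _ := by gcongr
      have := Finset.card_nsmul_le_sum _ _ _ hb
      refine le_trans ?_ this
      rw [nsmul_eq_mul, Nat.card_Icc]
      have a4 : (k₀ : ℝ) / 2 ≤ ((k₀ + 1 - (k₀ - k₀ / 2) : ℕ) : ℝ) := by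
        rw [div_le_iff₀ (by norm_num)]
        exact_mod_cast (show k₀ ≤ (k₀ + 1 - (k₀ - k₀ / 2)) * 2 by omega)
      calc d ^ 2 / 16 = d / 2 * (d / 8) := by ring
        _ ≤ _ := by gcongr; linarith
    · have hc' : (n : ℝ) ≤ 2 * k₀ := by exact_mod_cast hc
      have hsub : Finset.Icc k₀ (k₀ + (n - k₀) / 2) ⊆ Finset.Icc 2 (n - 2) := by
        intro k; simp only [Finset.mem_Icc]; omega
      refine le_trans ?_ (Finset.sum_le_sum_of_subset_of_nonneg hsub fun k hk _ => hnn k hk)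
      have hb : ∀ k ∈ Finset.Icc k₀ (k₀ + (n - k₀) / 2), d / 8 ≤
          tent n k₀ k ^ 2 / ((n : ℝ) * k * ((n : ℝ) - k)) := by
        intro k hk
        rw [Finset.mem_Icc] at hk
        have a1 : (n : ℝ) - k₀ ≤ 2 * ((n : ℝ) - k) := by
          have : n + 2 * k ≤ 2 * n + k₀ := by omega
          have : (n : ℝ) + 2 * k ≤ 2 * n + k₀ := by exact_mod_cast this
          linarith
        have a2 : (k₀ : ℝ) ≤ k := by exact_mod_cast hk.1
        have a5 : (k : ℝ) ≤ n := by exact_mod_cast (show k ≤ n by omega)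
        rw [tent_of_ge hk.1, le_div_iff₀ (mul_pos (mul_pos (by linarith) (by linarith))
          (by linarith))]
        have a3 : (n : ℝ) / 2 ≤ k₀ := by linarith
        have a6 : 0 ≤ (n : ℝ) - k := by linarith
        calc d / 8 * ((n : ℝ) * k * ((n : ℝ) - k)) ≤
              (2 * ((n : ℝ) - k)) / 8 * ((n : ℝ) * n * ((n : ℝ) - k)) := by
              gcongr; linarith
          _ = ((n : ℝ) / 2 * ((n : ℝ) - k)) ^ 2 := by ring
          _ ≤ _ := by gcongr
      have := Finset.card_nsmul_le_sum _ _ _ hb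
      refine le_trans ?_ this
      rw [nsmul_eq_mul, Nat.card_Icc]
      have a4 : ((n : ℝ) - k₀) / 2 ≤ ((k₀ + (n - k₀) / 2 + 1 - k₀ : ℕ) : ℝ) := by
        rw [div_le_iff₀ (by norm_num), sub_le_iff_le_add]
        exact_mod_cast (show n ≤ (k₀ + (n - k₀) / 2 + 1 - k₀) * 2 + k₀ by omega)
      calc d ^ 2 / 16 = d / 2 * (d / 8) := by ring
        _ ≤ _ := by gcongr; linarith
  rw [one_div, ← div_eq_inv_mul]
  calc d ^ 2 / (16 * n) = d ^ 2 / 16 / n := by rw [div_div]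
    _ ≤ _ := by
      refine div_le_div₀ (Finset.sum_nonneg hnn) key (by linarith) (by linarith)

/-- With different entries the screening statistic is at least of the order of the signal. -/
lemma screen_ge {n k₀ : ℕ} (hn : 4 ≤ n) (hk₀ : k₀ ≤ n) {s₁ s₂ x : ℝ} {t y : Fin n → ℝ}
    (ht : ∀ i, t i = (if (i : ℕ) < k₀ then s₁ else s₂) + x + y i) {δ τ H d : ℝ} (hδ : 0 ≤ δ)
    (hH0 : 0 ≤ H) (hH : H ≤ τ * √(n : ℝ)) (h : SegBound y δ τ H)
    (hd : 4 ≤ d) (h1 : d ≤ k₀) (h2 : d ≤ (n : ℝ) - k₀) :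
    (s₁ - s₂) ^ 2 * (d ^ 2 / (32 * n)) - 2 * (s₁ - s₂) ^ 2 - 108 * δ * τ ≤ screen t := by
  have hn' : (4 : ℝ) ≤ n := by exact_mod_cast hn
  have hcard : ((Finset.Icc 2 (n - 2)).card : ℝ) = (n : ℝ) - 3 := by
    rw [Nat.card_Icc, show n - 2 + 1 - 2 = n - 3 by omega, Nat.cast_sub (by omega)]; norm_num
  have h3 : (n : ℝ) - 3 ≠ 0 := by linarith
  have hs : 1 / ((n : ℝ) - 3) * ∑ k ∈ Finset.Icc 2 (n - 2),
      ((s₁ - s₂) ^ 2 / 2 * (tent n k₀ k ^ 2 / ((n : ℝ) * k * ((n : ℝ) - k)))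
        - 2 * (s₁ - s₂) ^ 2 - 6 * δ * (2 * τ + H / (k : ℝ) + H / ((n : ℝ) - k))) ≤ screen t := by
    refine mul_le_mul_of_nonneg_left (Finset.sum_le_sum fun k hk => ?_)
      (by rw [one_div, inv_nonneg]; linarith)
    rw [Finset.mem_Icc] at hk
    exact screenTerm_ge hk.1 (by omega) hk₀ ht h
  refine le_trans ?_ hs
  rw [Finset.sum_sub_distrib, Finset.sum_sub_distrib, ← Finset.mul_sum, Finset.sum_const,
    ← Finset.mul_sum, nsmul_eq_mul, hcard]
  have a1 := average_tent_ge hn hd h1 h2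
  have a2 := average_inv_le hn hH0 hH
  set A := ∑ k ∈ Finset.Icc 2 (n - 2), tent n k₀ k ^ 2 / ((n : ℝ) * k * ((n : ℝ) - k))
  set B := ∑ k ∈ Finset.Icc 2 (n - 2), (2 * τ + H / (k : ℝ) + H / ((n : ℝ) - k))
  have e : 1 / ((n : ℝ) - 3) * ((s₁ - s₂) ^ 2 / 2 * A - ((n : ℝ) - 3) * (2 * (s₁ - s₂) ^ 2)
      - 6 * δ * B) = (s₁ - s₂) ^ 2 / 2 * (1 / ((n : ℝ) - 3) * A) - 2 * (s₁ - s₂) ^ 2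
      - 6 * δ * (1 / ((n : ℝ) - 3) * B) := by field_simp
  rw [e]
  have b1 := mul_le_mul_of_nonneg_left a1 (by positivity : 0 ≤ (s₁ - s₂) ^ 2 / 2)
  have b2 := mul_le_mul_of_nonneg_left a2 (by positivity : 0 ≤ 6 * δ)
  have e2 : (s₁ - s₂) ^ 2 / 2 * (d ^ 2 / (16 * n)) = (s₁ - s₂) ^ 2 * (d ^ 2 / (32 * n)) := by
    field_simp; ring
  linarith

/-! ### Deterministic analysis of the change point statistic of one sequence. -/

/-- The unnormalized change point statistic of a single sequence. -/
noncomputable def quadStat {n : ℕ} (t : Fin n → ℝ) (k : ℕ) : ℝ :=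
  ∑ i ∈ seg 0 k, ∑ r ∈ (seg 0 k).erase i, ∑ j ∈ seg k n, ∑ l ∈ (seg k n).erase j,
    (t i - t j) * (t r - t l)

/-- As for the screening statistic, a squared contrast minus within-group sums of squares. The
factors `1 - 1 / k` and `1 - 1 / (n - k)` are the price of omitting the diagonal terms. -/
lemma quadStat_eq {n k : ℕ} (hk : 0 < k) (hkn : k < n) (t : Fin n → ℝ) :
    quadStat t k = (1 - 1 / (k : ℝ)) * (1 - 1 / ((n : ℝ) - k)) * contrast t k ^ 2
      - ((n : ℝ) - k) * ((n : ℝ) - k - 1) * withinSS (seg 0 k) t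
      - (k : ℝ) * ((k : ℝ) - 1) * withinSS (seg k n) t := by
  have h1 : (0 : ℝ) < k := by exact_mod_cast hk
  have h2 : (0 : ℝ) < (n : ℝ) - k := by rw [sub_pos]; exact_mod_cast hkn
  rw [quadStat, sum_quadruple, contrast_eq hkn.le, withinSS, withinSS,
    card_seg_cast (Nat.zero_le k) hkn.le, card_seg_cast hkn.le le_rfl]
  simp only [Nat.cast_zero, sub_zero]
  field_simp
  ring

lemma natCast_sub_one_nonneg {k : ℕ} (hk : 0 < k) : 0 ≤ (k : ℝ) - 1 := by
  rw [sub_nonneg]; exact_mod_cast hk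

lemma quadStat_le {n k : ℕ} (hk : 0 < k) (hkn : k ≤ n) (t : Fin n → ℝ) :
    quadStat t k ≤ contrast t k ^ 2 := by
  rcases hkn.lt_or_eq with h | rfl
  · have h1 := natCast_sub_one_nonneg hk
    have h2 : 0 ≤ (n : ℝ) - k - 1 := by
      rw [← Nat.cast_sub hkn]; exact natCast_sub_one_nonneg (by omega)
    have a1 : 0 ≤ ((n : ℝ) - k) * ((n : ℝ) - k - 1) * withinSS (seg 0 k) t :=
      mul_nonneg (mul_nonneg (by linarith) h2) (withinSS_nonneg _ _)
    have a2 : 0 ≤ (k : ℝ) * ((k : ℝ) - 1) * withinSS (seg k n) t :=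
      mul_nonneg (mul_nonneg (by linarith) h1) (withinSS_nonneg _ _)
    have a3 : (1 - 1 / (k : ℝ)) * (1 - 1 / ((n : ℝ) - k)) ≤ 1 := by
      have b1 : 0 ≤ 1 / (k : ℝ) := by positivity
      have b2 : 0 ≤ 1 / ((n : ℝ) - k) := by rw [one_div, inv_nonneg]; linarith
      have b3 : 1 / (k : ℝ) ≤ 1 := by rw [div_le_one (by linarith)]; linarith
      exact mul_le_one₀ (by linarith) (by
        rw [sub_nonneg, div_le_one (by linarith)]; linarith) (by linarith)
    rw [quadStat_eq hk h]
    nlinarith [mul_le_mul_of_nonneg_right a3 (sq_nonneg (contrast t k))]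
  -- At `k = n` the second group is empty and the statistic is `0`.
  · have : (seg k k : Finset (Fin k)) = ∅ := by
      ext i; simp only [mem_seg, Finset.notMem_empty, iff_false]; omega
    rw [quadStat, this]
    simp only [Finset.sum_empty, Finset.sum_const_zero]
    positivity

lemma quadStat_ge {n k₀ : ℕ} (hk : 0 < k₀) (hkn : k₀ < n) {s₁ s₂ x : ℝ} {t y : Fin n → ℝ}
    (ht : ∀ i, t i = (if (i : ℕ) < k₀ then s₁ else s₂) + x + y i) :
    (1 - 1 / (k₀ : ℝ) - 1 / ((n : ℝ) - k₀)) * contrast t k₀ ^ 2 - (n : ℝ) ^ 2 * ∑ i, y i ^ 2 ≤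
      quadStat t k₀ := by
  have h1 := natCast_sub_one_nonneg hk
  have h2 : 0 ≤ (n : ℝ) - k₀ - 1 := by
    rw [← Nat.cast_sub hkn.le]; exact natCast_sub_one_nonneg (by omega)
  -- At `k₀` each group lies on one side of the change, so centering at its own level leaves noise
  -- only.
  have w1 : withinSS (seg 0 k₀) t ≤ ∑ i ∈ seg 0 k₀, y i ^ 2 := by
    refine (within_le_sum_sub_sq _ t (s₁ + x)).trans (Finset.sum_le_sum fun i hi => ?_)
    rw [ht i, if_pos (mem_seg.1 hi).2]; ring_nf; rfl
  have w2 : withinSS (seg k₀ n) t ≤ ∑ i ∈ seg k₀ n, y i ^ 2 := by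
    refine (within_le_sum_sub_sq _ t (s₂ + x)).trans (Finset.sum_le_sum fun i hi => ?_)
    rw [ht i, if_neg (not_lt.2 (mem_seg.1 hi).1)]; ring_nf; rfl
  have e := sum_prefix_add_suffix hkn.le fun i => y i ^ 2
  have b1 : 0 ≤ 1 / (k₀ : ℝ) := by positivity
  have b2 : 0 ≤ 1 / ((n : ℝ) - k₀) := by rw [one_div, inv_nonneg]; linarith
  have c1 : ((n : ℝ) - k₀) * ((n : ℝ) - k₀ - 1) ≤ (n : ℝ) ^ 2 := by nlinarith
  have c2 : (k₀ : ℝ) * ((k₀ : ℝ) - 1) ≤ (n : ℝ) ^ 2 := by nlinarith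
  have d1 := mul_le_mul c1 w1 (withinSS_nonneg _ _) (sq_nonneg _)
  have d2 := mul_le_mul c2 w2 (withinSS_nonneg _ _) (sq_nonneg _)
  rw [quadStat_eq hk hkn, ← e]
  nlinarith [mul_nonneg (mul_nonneg b1 b2) (sq_nonneg (contrast t k₀))]

/-- The tent function loses a fixed fraction of its maximum away from the peak. -/
lemma tent_gap {n k₀ k : ℕ} (hk₀ : k₀ ≤ n) (hn : 0 < n) {ε : ℝ} (hε : 0 < ε)
    (h : ε * k₀ ≤ |(k : ℝ) - k₀|) :
    ε * k₀ / n * tent n k₀ k₀ ≤ tent n k₀ k₀ - tent n k₀ k := by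
  have hn' : (0 : ℝ) < n := by exact_mod_cast hn
  have h1 : (k₀ : ℝ) ≤ n := by exact_mod_cast hk₀
  have h0 : (0 : ℝ) ≤ k₀ := Nat.cast_nonneg _
  rw [div_mul_eq_mul_div, div_le_iff₀ hn']
  -- The drop from the peak is `(k₀ - k)(n - k₀)` on the left and `k₀ (k - k₀)` on the right. The
  -- left one is at least `ε` times the peak; only the right one needs the weaker fraction `ε k₀ /
  -- n`.
  rcases le_total k k₀ with hc | hc
  · have hc' : (k : ℝ) ≤ k₀ := by exact_mod_cast hc
    rw [abs_of_nonpos (by linarith)] at h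
    rw [tent_of_le hc, tent_of_le le_rfl]
    have a : ε * k₀ * ((n : ℝ) - k₀) ≤ (k₀ - k) * ((n : ℝ) - k₀) :=
      mul_le_mul_of_nonneg_right (by linarith) (by linarith)
    have b : 0 ≤ ε * k₀ * ((n : ℝ) - k₀) := mul_nonneg (by positivity) (by linarith)
    nlinarith [mul_le_mul_of_nonneg_right a hn'.le, mul_nonneg b (by linarith : 0 ≤ (n : ℝ) - k₀)]
  · have hc' : (k₀ : ℝ) ≤ k := by exact_mod_cast hc
    rw [abs_of_nonneg (by linarith)] at h
    rw [tent_of_ge hc, tent_of_ge le_rfl]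
    have a : k₀ * (ε * k₀) ≤ k₀ * ((k : ℝ) - k₀) := mul_le_mul_of_nonneg_left h h0
    nlinarith [mul_le_mul_of_nonneg_right a hn'.le, mul_nonneg (mul_nonneg hε.le h0)
      (mul_nonneg h0 h0)]

/-- Away from the change point the statistic is smaller, up to noise. -/
lemma quadStat_gap {n k₀ k : ℕ} (hk₀ : 0 < k₀) (hk₀n : k₀ < n) (hk : 0 < k) (hkn : k ≤ n)
    {s₁ s₂ x : ℝ} {t y : Fin n → ℝ}
    (ht : ∀ i, t i = (if (i : ℕ) < k₀ then s₁ else s₂) + x + y i) {ε M : ℝ} (hε : 0 < ε)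
    (hfar : ε * k₀ ≤ |(k : ℝ) - k₀|)
    (hsize : 4 * (1 / (k₀ : ℝ) + 1 / ((n : ℝ) - k₀)) ≤ ε * k₀ / (2 * n))
    (hM : ∀ j ≤ n, |contrast y j| ≤ M)
    (hS : ∀ j ≤ n, |contrast y j| ≤ |s₁ - s₂| * tent n k₀ k₀) :
    ε * k₀ / (2 * n) * ((s₁ - s₂) ^ 2 * tent n k₀ k₀ ^ 2)
        - (5 * (|s₁ - s₂| * tent n k₀ k₀) * M + (n : ℝ) ^ 2 * ∑ i, y i ^ 2) ≤
      quadStat t k₀ - quadStat t k := by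
  have hn' : (0 : ℝ) < n := by exact_mod_cast (by omega : 0 < n)
  have u1 := quadStat_le hk hkn t
  have u2 := quadStat_ge hk₀ hk₀n ht
  have g := tent_gap hk₀n.le (by omega) hε hfar
  have g0 := tent_nonneg hk₀n.le hkn
  have g1 := tent_nonneg hk₀n.le hk₀n.le
  have hgap : tent n k₀ k ≤ tent n k₀ k₀ := by
    have : 0 ≤ ε * k₀ / n * tent n k₀ k₀ := by positivity
    linarith
  rw [contrast_step_add hk₀n.le hkn ht] at u1
  rw [contrast_step_add hk₀n.le hk₀n.le ht] at u2
  have m1 := hM k hkn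
  have m0 := hM k₀ hk₀n.le
  have n1 := hS k hkn
  have n0 := hS k₀ hk₀n.le
  set G := tent n k₀ k₀
  set g' := tent n k₀ k
  set a := contrast y k
  set b := contrast y k₀
  set Q := (n : ℝ) ^ 2 * ∑ i, y i ^ 2
  set d := s₁ - s₂
  have hd : |d| ^ 2 = d ^ 2 := sq_abs d
  have hd0 : 0 ≤ |d| := abs_nonneg d
  have hM0 : 0 ≤ M := (abs_nonneg _).trans m1
  -- By `hS` the noise never exceeds the peak signal, so the square of the noise is bounded linearly
  -- in `M`. The coefficient `3` here and `2` at the peak add up to the `5` of the statement.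
  have ha : (d * g' + a) ^ 2 ≤ d ^ 2 * (g' * G) + 3 * (|d| * G) * M := by
    have x1 : d * g' * a ≤ |d| * G * M := by
      calc d * g' * a ≤ |d * g' * a| := le_abs_self _
        _ = |d| * g' * |a| := by rw [abs_mul, abs_mul, abs_of_nonneg g0]
        _ ≤ _ := by gcongr
    have x2 : a ^ 2 ≤ |d| * G * M := by
      rw [← sq_abs, sq]; exact mul_le_mul n1 m1 (abs_nonneg _) (by positivity)
    have x3 : d ^ 2 * (g' * g') ≤ d ^ 2 * (g' * G) := by gcongr
    nlinarith
  have hb1 : d ^ 2 * G ^ 2 - 2 * (|d| * G) * M ≤ (d * G + b) ^ 2 := by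
    have x1 : -(d * G * b) ≤ |d| * G * M := by
      calc -(d * G * b) ≤ |d * G * b| := neg_le_abs _
        _ = |d| * G * |b| := by rw [abs_mul, abs_mul, abs_of_nonneg g1]
        _ ≤ _ := by gcongr
    nlinarith [sq_nonneg b]
  have hb2 : (d * G + b) ^ 2 ≤ 4 * (d ^ 2 * G ^ 2) := by
    have : |d * G + b| ≤ 2 * (|d| * G) := by
      calc _ ≤ |d * G| + |b| := abs_add_le _ _
        _ ≤ _ := by rw [abs_mul, abs_of_nonneg g1]; linarith
    rw [← sq_abs]
    calc _ ≤ (2 * (|d| * G)) ^ 2 := by gcongr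
      _ = _ := by rw [mul_pow, mul_pow, hd]; ring
  have hN : 0 < (n : ℝ) - k₀ := by rw [sub_pos]; exact_mod_cast hk₀n
  have hr : 0 ≤ 1 / (k₀ : ℝ) + 1 / ((n : ℝ) - k₀) := by positivity
  -- The diagonal correction at the peak costs half of the tent gap; `hsize` is calibrated for this,
  -- the factor `4` coming from `hb2`.
  have e1 : (1 / (k₀ : ℝ) + 1 / ((n : ℝ) - k₀)) * (d * G + b) ^ 2 ≤
      ε * k₀ / (2 * n) * (d ^ 2 * G ^ 2) := by
    calc _ ≤ (1 / (k₀ : ℝ) + 1 / ((n : ℝ) - k₀)) * (4 * (d ^ 2 * G ^ 2)) := by gcongr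
      _ = 4 * (1 / (k₀ : ℝ) + 1 / ((n : ℝ) - k₀)) * (d ^ 2 * G ^ 2) := by ring
      _ ≤ _ := by gcongr
  have e2 : ε * k₀ / n * G * (d ^ 2 * G) ≤ (G - g') * (d ^ 2 * G) :=
    mul_le_mul_of_nonneg_right g (by positivity)
  have e3 : ε * k₀ / n = 2 * (ε * k₀ / (2 * n)) := by field_simp
  rw [e3] at e2
  nlinarith

/-- A maximizer of the summed statistic is close to the change point when the noise is dominated by
the signal. -/
lemma sum_quadStat_lt {ι : Type*} {n k₀ k : ℕ} (hk₀ : 0 < k₀) (hk₀n : k₀ < n) (hk : 0 < k)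
    (hkn : k ≤ n) (A : Finset ι) {s₁ s₂ x M : ι → ℝ} {t y : ι → Fin n → ℝ}
    (ht : ∀ q i, t q i = (if (i : ℕ) < k₀ then s₁ q else s₂ q) + x q + y q i) {ε : ℝ} (hε : 0 < ε)
    (hfar : ε * k₀ ≤ |(k : ℝ) - k₀|)
    (hsize : 4 * (1 / (k₀ : ℝ) + 1 / ((n : ℝ) - k₀)) ≤ ε * k₀ / (2 * n))
    (hM : ∀ q ∈ A, ∀ j ≤ n, |contrast (y q) j| ≤ M q)
    (hS : ∀ q ∈ A, ∀ j ≤ n, |contrast (y q) j| ≤ |s₁ q - s₂ q| * tent n k₀ k₀)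
    (hlt : ∑ q ∈ A, (5 * (|s₁ q - s₂ q| * tent n k₀ k₀) * M q + (n : ℝ) ^ 2 * ∑ i, y q i ^ 2) <
      ε * k₀ / (2 * n) * ∑ q ∈ A, (s₁ q - s₂ q) ^ 2 * tent n k₀ k₀ ^ 2) :
    ∑ q ∈ A, quadStat (t q) k < ∑ q ∈ A, quadStat (t q) k₀ := by
  have := Finset.sum_le_sum fun q hq =>
    quadStat_gap hk₀ hk₀n hk hkn (ht q) hε hfar hsize (hM q hq) (hS q hq)
  rw [Finset.sum_sub_distrib, Finset.sum_sub_distrib, ← Finset.mul_sum] at this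
  linarith

/-! ### The model statistics in terms of single sequences. -/

namespace ChangePointModel

variable (m : ChangePointModel.{u})

lemma before_eq_seg (k : ℕ) : m.before k = seg 0 k := by
  ext i; simp [before, mem_seg]

lemma after_eq_seg (k : ℕ) : m.after k = seg k m.n := by
  ext i; simp [after, mem_seg]

lemma D_eq_screen (q : Fin m.p × Fin m.p) (ω : m.Ω) : m.D q ω = screen fun i => m.T i ω q := by
  rw [D, screen]
  congr 1
  refine Finset.sum_congr rfl fun k hk => ?_
  rw [Finset.mem_Icc] at hk
  have h1 : (2 : ℝ) ≤ k := by exact_mod_cast hk.1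
  have hkn : k + 2 ≤ m.n := by have := m.four_le_n; omega
  have h2 : (k : ℝ) + 2 ≤ m.n := by exact_mod_cast hkn
  have := scaled_contrast_identity (k := k) (N := (m.n : ℝ) - k) (a := ∑ i ∈ seg 0 k, m.T i ω q)
    (b := ∑ i ∈ seg k m.n, m.T i ω q) (qa := ∑ i ∈ seg 0 k, m.T i ω q ^ 2)
    (qb := ∑ i ∈ seg k m.n, m.T i ω q ^ 2) (by linarith) (by linarith)
  rw [add_sub_cancel] at this
  rw [screenTerm, withinSS, withinSS, card_seg_cast (Nat.zero_le k) (by omega),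
    card_seg_cast (by omega) le_rfl, contrast_eq (by omega), Nat.cast_zero, sub_zero, ← this, V,
    before_eq_seg, after_eq_seg, sum_sum_erase_mul, sum_sum_erase_mul, Finset.sum_mul_sum]

lemma U_eq_sum (τ : ℝ) (k : ℕ) (ω : m.Ω) :
    m.U τ k ω = 1 / (m.n : ℝ) ^ 4 * ∑ q ∈ m.selected τ ω, quadStat (fun i => m.T i ω q) k := by
  rw [U, before_eq_seg, after_eq_seg]
  congr 1
  simp_rw [Finset.sum_comm (t := m.selected τ ω)]
  rfl

end ChangePointModel

/-! ### Moment generating functions and deviation inequalities. -/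

section
variable {Ω : Type*} [MeasurableSpace Ω] {P : Measure Ω}

/-- The moment generating function of `Y` is bounded by `exp (v s²)` on `[-r, r]`. -/
def MGFBound (Y : Ω → ℝ) (P : Measure Ω) (v r : ℝ) : Prop :=
  ∀ s : ℝ, |s| ≤ r → Integrable (fun ω => Real.exp (s * Y ω)) P ∧
    ∫ ω, Real.exp (s * Y ω) ∂P ≤ Real.exp (v * s ^ 2)

lemma MGFBound.neg {Y : Ω → ℝ} {v r : ℝ} (h : MGFBound Y P v r) :
    MGFBound (fun ω => -Y ω) P v r := by
  intro s hs
  have := h (-s) (by rwa [abs_neg])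
  simpa only [neg_mul, mul_neg, neg_sq] using this

lemma MGFBound.sum [IsProbabilityMeasure P] {ι : Type*} {Y : ι → Ω → ℝ} {v r : ℝ}
    (hi : iIndepFun Y P) (hm : ∀ i, Measurable (Y i)) (h : ∀ i, MGFBound (Y i) P v r)
    (A : Finset ι) : MGFBound (fun ω => ∑ i ∈ A, Y i ω) P (v * A.card) r := by
  intro s hs
  have h1 := hi.integrable_exp_mul_sum hm (s := A) fun i _ => (h i s hs).1
  have h2 := hi.mgf_sum (t := s) hm A
  simp only [mgf, Finset.sum_apply] at h1 h2
  refine ⟨h1, ?_⟩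
  rw [h2]
  calc _ ≤ ∏ _i ∈ A, Real.exp (v * s ^ 2) :=
        Finset.prod_le_prod (fun i _ => integral_nonneg fun ω => (Real.exp_pos _).le)
          fun i _ => (h i s hs).2
    _ = _ := by rw [Finset.prod_const, ← Real.exp_nat_mul]; ring_nf

lemma MGFBound.tail [IsProbabilityMeasure P] {Y : Ω → ℝ} {v r : ℝ} (h : MGFBound Y P v r) {s x : ℝ}
    (hs : 0 ≤ s) (hsr : s ≤ r) : P.real {ω | x ≤ Y ω} ≤ Real.exp (-s * x + v * s ^ 2) := by
  have h1 := h s (by rwa [abs_of_nonneg hs])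
  rw [Real.exp_add]
  exact (measure_ge_le_exp_mul_mgf x hs h1.1).trans
    (mul_le_mul_of_nonneg_left h1.2 (Real.exp_pos _).le)

/-- A two-sided deviation inequality in scale-free form. -/
lemma MGFBound.tail_sq [IsProbabilityMeasure P] {Y : Ω → ℝ} {v r κ : ℝ}
    (h : MGFBound Y P (v * κ) r) {α δ ξ η T : ℝ} (hα : 0 ≤ α) (hδ : 0 ≤ δ) (hαδ : v * α ≤ √δ / 2)
    (hξ : 0 ≤ ξ) (hη : 0 ≤ η) (hr : α * η ≤ r) (hT : ξ * η = T) (hκ : κ * η ^ 2 ≤ T) (hv : 0 ≤ v) :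
    P.real {ω | δ * ξ ^ 2 < Y ω ^ 2} ≤ 2 * Real.exp (-(α * √δ / 2) * T) := by
  have hs : 0 ≤ α * η := mul_nonneg hα hη
  have hsub : {ω | δ * ξ ^ 2 < Y ω ^ 2} ⊆ {ω | √δ * ξ ≤ Y ω} ∪ {ω | √δ * ξ ≤ -Y ω} := by
    intro ω hω
    have h1 : (√δ * ξ) ^ 2 < Y ω ^ 2 := by
      rw [mul_pow, Real.sq_sqrt hδ]; exact hω
    have h2 := abs_lt_of_sq_lt_sq' (a := √δ * ξ) (b := |Y ω|) (by rwa [sq_abs]) (abs_nonneg _)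
    rcases le_total 0 (Y ω) with h3 | h3
    · left; rw [abs_of_nonneg h3] at h2; exact h2.2.le
    · right; rw [abs_of_nonpos h3] at h2; exact h2.2.le
  -- With the tilt `α η` the linear term is `-α √δ T`, and by `hκ` and `hαδ` the variance term is at
  -- most half of it.
  have hexp : -(α * η) * (√δ * ξ) + v * κ * (α * η) ^ 2 ≤ -(α * √δ / 2) * T := by
    have hT0 : 0 ≤ T := hT ▸ mul_nonneg hξ hη
    have e1 : -(α * η) * (√δ * ξ) = -(α * √δ) * T := by rw [← hT]; ring
    have e2 : v * κ * (α * η) ^ 2 ≤ α * √δ / 2 * T := by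
      calc v * κ * (α * η) ^ 2 = v * α ^ 2 * (κ * η ^ 2) := by ring
        _ ≤ v * α ^ 2 * T := by gcongr
        _ = α * (v * α) * T := by ring
        _ ≤ α * (√δ / 2) * T := by gcongr
        _ = _ := by ring
    linarith
  calc _ ≤ P.real ({ω | √δ * ξ ≤ Y ω} ∪ {ω | √δ * ξ ≤ -Y ω}) := measureReal_mono hsub
    _ ≤ _ := measureReal_union_le _ _
    _ ≤ Real.exp (-(α * √δ / 2) * T) + Real.exp (-(α * √δ / 2) * T) :=
      add_le_add ((h.tail hs hr).trans (Real.exp_le_exp.2 hexp))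
        ((h.neg.tail hs hr).trans (Real.exp_le_exp.2 hexp))
    _ = _ := by ring

lemma MGFBound.integral_abs_le {Y : Ω → ℝ} (hm : Measurable Y) {v r s : ℝ} (h : MGFBound Y P v r)
    (hs : 0 < s) (hsr : s ≤ r) :
    Integrable (fun ω => |Y ω|) P ∧ ∫ ω, |Y ω| ∂P ≤ 2 * Real.exp (v * s ^ 2) / s := by
  have h1 := h s (by rwa [abs_of_pos hs])
  have h2 := h.neg s (by rwa [abs_of_pos hs])
  have hpt : ∀ ω, |Y ω| ≤ (Real.exp (s * Y ω) + Real.exp (s * -Y ω)) / s := by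
    intro ω
    rw [le_div_iff₀ hs]
    have a1 := Real.add_one_le_exp (s * Y ω)
    have a2 := Real.add_one_le_exp (s * -Y ω)
    have p1 := Real.exp_pos (s * Y ω)
    have p2 := Real.exp_pos (s * -Y ω)
    rcases le_total 0 (Y ω) with h3 | h3
    · rw [abs_of_nonneg h3]; linarith
    · rw [abs_of_nonpos h3]; linarith
  have hi : Integrable (fun ω => (Real.exp (s * Y ω) + Real.exp (s * -Y ω)) / s) P :=
    (h1.1.add h2.1).div_const s
  have hi' : Integrable (fun ω => |Y ω|) P := by
    refine hi.mono' (by fun_prop) (ae_of_all _ fun ω => ?_)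
    rw [Real.norm_eq_abs, abs_abs]; exact hpt ω
  refine ⟨hi', (integral_mono hi' hi hpt).trans ?_⟩
  rw [integral_div, integral_add h1.1 h2.1]
  gcongr
  linarith [h1.2, h2.2]

lemma exp_le_one_add_add_sq_mul_exp_abs (x : ℝ) :
    Real.exp x ≤ 1 + x + x ^ 2 * Real.exp |x| := by
  have h := Complex.norm_exp_sub_sum_le_norm_mul_exp (x : ℂ) 2
  have e : Complex.exp x - ∑ m ∈ Finset.range 2, (x : ℂ) ^ m / (m.factorial : ℂ) =
      ((Real.exp x - (1 + x) : ℝ) : ℂ) := by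
    simp [Finset.sum_range_succ]
  rw [e, Complex.norm_real, Complex.norm_real, Real.norm_eq_abs, Real.norm_eq_abs, sq_abs] at h
  linarith [le_abs_self (Real.exp x - (1 + x))]

/-- A centered variable with an exponential moment has a quadratically bounded log-MGF near
zero. -/
lemma mgfBound_of_exp_abs [IsProbabilityMeasure P] {Y : Ω → ℝ} (hm : Measurable Y)
    (h0 : ∫ ω, Y ω ∂P = 0) {a B : ℝ} (ha : 0 < a)
    (hi : Integrable (fun ω => Real.exp (a * |Y ω|)) P)
    (hB : ∫ ω, Real.exp (a * |Y ω|) ∂P ≤ B) : MGFBound Y P (8 * B / a ^ 2) (a / 2) := by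
  intro s hs
  have hYi : Integrable Y P := by
    refine (hi.div_const a).mono' hm.aestronglyMeasurable (ae_of_all _ fun ω => ?_)
    rw [Real.norm_eq_abs, le_div_iff₀ ha]
    linarith [Real.add_one_le_exp (a * |Y ω|)]
  have hsi : Integrable (fun ω => Real.exp (s * Y ω)) P := by
    refine hi.mono' (by fun_prop) (ae_of_all _ fun ω => ?_)
    rw [Real.norm_eq_abs, abs_of_pos (Real.exp_pos _), Real.exp_le_exp]
    calc s * Y ω ≤ |s * Y ω| := le_abs_self _
      _ = |s| * |Y ω| := abs_mul _ _
      _ ≤ a * |Y ω| := by gcongr; linarith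
  refine ⟨hsi, ?_⟩
  -- Second order expansion: the linear term integrates to zero. Half of the exponent `a |Y|`
  -- absorbs `Y²` and the other half absorbs `exp |s Y|`, hence the restriction `|s| ≤ a / 2`.
  have hpt : ∀ ω, Real.exp (s * Y ω) ≤
      1 + s * Y ω + 8 / a ^ 2 * s ^ 2 * Real.exp (a * |Y ω|) := by
    intro ω
    refine (exp_le_one_add_add_sq_mul_exp_abs _).trans ?_
    have hz : 0 ≤ a * |Y ω| / 2 := by positivity
    have e1 : Y ω ^ 2 ≤ 8 / a ^ 2 * Real.exp (a * |Y ω| / 2) := by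
      rw [div_mul_eq_mul_div, le_div_iff₀ (by positivity)]
      have := Real.quadratic_le_exp_of_nonneg hz
      have e : Y ω ^ 2 * a ^ 2 = 8 * ((a * |Y ω| / 2) ^ 2 / 2) := by
        rw [div_pow, mul_pow, sq_abs]; ring
      rw [e]; linarith
    have e2 : Real.exp |s * Y ω| ≤ Real.exp (a * |Y ω| / 2) := by
      rw [Real.exp_le_exp, abs_mul]
      calc |s| * |Y ω| ≤ a / 2 * |Y ω| := by gcongr
        _ = _ := by ring
    have e3 : (s * Y ω) ^ 2 * Real.exp |s * Y ω| ≤ 8 / a ^ 2 * s ^ 2 * Real.exp (a * |Y ω|) := by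
      calc (s * Y ω) ^ 2 * Real.exp |s * Y ω| = s ^ 2 * (Y ω ^ 2 * Real.exp |s * Y ω|) := by ring
        _ ≤ s ^ 2 * (8 / a ^ 2 * Real.exp (a * |Y ω| / 2) * Real.exp (a * |Y ω| / 2)) := by gcongr
        _ = 8 / a ^ 2 * s ^ 2 * (Real.exp (a * |Y ω| / 2) * Real.exp (a * |Y ω| / 2)) := by ring
        _ = _ := by rw [← Real.exp_add, add_halves]
    linarith
  have hint : Integrable (fun ω => 1 + s * Y ω) P := (integrable_const _).add (hYi.const_mul s)
  have hint2 : Integrable (fun ω => 8 / a ^ 2 * s ^ 2 * Real.exp (a * |Y ω|)) P := hi.const_mul _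
  calc ∫ ω, Real.exp (s * Y ω) ∂P
      ≤ ∫ ω, (1 + s * Y ω + 8 / a ^ 2 * s ^ 2 * Real.exp (a * |Y ω|)) ∂P :=
        integral_mono hsi (hint.add hint2) hpt
    _ = 1 + 8 / a ^ 2 * s ^ 2 * ∫ ω, Real.exp (a * |Y ω|) ∂P := by
        rw [integral_add hint hint2, integral_add (integrable_const _) (hYi.const_mul s),
          integral_const_mul, integral_const_mul, h0]
        simp
    _ ≤ 1 + 8 / a ^ 2 * s ^ 2 * B := by gcongr
    _ = 8 * B / a ^ 2 * s ^ 2 + 1 := by ring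
    _ ≤ _ := Real.add_one_le_exp _

/-- A centered variable with a Gaussian-type exponential moment is sub-Gaussian. -/
lemma mgfBound_of_exp_sq [IsProbabilityMeasure P] {Y : Ω → ℝ} (hm : Measurable Y)
    (h0 : ∫ ω, Y ω ∂P = 0) {a B : ℝ} (ha : 0 < a) (hB1 : 1 ≤ B)
    (hi : Integrable (fun ω => Real.exp (a * Y ω ^ 2)) P)
    (hB : ∫ ω, Real.exp (a * Y ω ^ 2) ∂P ≤ B) (r : ℝ) :
    MGFBound Y P (8 * (Real.exp (1 / (4 * a)) * B) + (1 / (4 * a) + 4 * Real.log B)) r := by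
  have key : ∀ s ω, s * Y ω ≤ a * Y ω ^ 2 + s ^ 2 / (4 * a) := by
    intro s ω
    have : a * Y ω ^ 2 + s ^ 2 / (4 * a) - s * Y ω = a * (Y ω - s / (2 * a)) ^ 2 := by
      field_simp; ring
    nlinarith [mul_nonneg ha.le (sq_nonneg (Y ω - s / (2 * a)))]
  have hlog : 0 ≤ Real.log B := Real.log_nonneg hB1
  intro s _
  have hsi : ∀ s, Integrable (fun ω => Real.exp (s * Y ω)) P := by
    intro s
    refine (hi.mul_const (Real.exp (s ^ 2 / (4 * a)))).mono' (by fun_prop) (ae_of_all _ fun ω => ?_)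
    rw [Real.norm_eq_abs, abs_of_pos (Real.exp_pos _), ← Real.exp_add, Real.exp_le_exp]
    exact key s ω
  refine ⟨hsi s, ?_⟩
  -- Near zero centering gives the quadratic bound. For `|s| > 1 / 2` completing the square gives
  -- `exp (s² / (4 a)) B`, and the factor `B` is absorbed because `log B ≤ 4 s² log B`. The variance
  -- constant is the sum of those of the two ranges.
  rcases le_or_gt |s| (1 / 2) with hs | hs
  · have hpt : ∀ ω, Real.exp (1 * |Y ω|) ≤ Real.exp (1 / (4 * a)) * Real.exp (a * Y ω ^ 2) := by
      intro ω
      rw [← Real.exp_add, Real.exp_le_exp, one_mul]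
      rcases abs_cases (Y ω) with h | h
      · have := key 1 ω; rw [h.1]; linarith
      · have := key (-1) ω; rw [h.1]; norm_num at this ⊢; linarith
    have hi2 : Integrable (fun ω => Real.exp (1 * |Y ω|)) P := by
      refine (hi.const_mul (Real.exp (1 / (4 * a)))).mono' (by fun_prop) (ae_of_all _ fun ω => ?_)
      rw [Real.norm_eq_abs, abs_of_pos (Real.exp_pos _)]
      exact hpt ω
    have hB2 : ∫ ω, Real.exp (1 * |Y ω|) ∂P ≤ Real.exp (1 / (4 * a)) * B := by
      refine (integral_mono hi2 (hi.const_mul _) hpt).trans ?_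
      rw [integral_const_mul]
      gcongr
    refine ((mgfBound_of_exp_abs hm h0 one_pos hi2 hB2) s hs).2.trans ?_
    rw [Real.exp_le_exp]
    have : 0 ≤ 1 / (4 * a) + 4 * Real.log B := by positivity
    nlinarith [sq_nonneg s]
  · have h1 : ∫ ω, Real.exp (s * Y ω) ∂P ≤ Real.exp (s ^ 2 / (4 * a)) * B := by
      refine (integral_mono (hsi s) (hi.const_mul (Real.exp (s ^ 2 / (4 * a)))) fun ω => ?_).trans ?_
      · simp only
        rw [← Real.exp_add, Real.exp_le_exp]
        linarith [key s ω]
      · rw [integral_const_mul]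
        gcongr
    refine h1.trans ?_
    nth_rewrite 1 [← Real.exp_log (by linarith : 0 < B)]
    rw [← Real.exp_add, Real.exp_le_exp]
    have hs2 : 1 / 4 ≤ s ^ 2 := by rw [← sq_abs]; nlinarith
    have e : s ^ 2 / (4 * a) = 1 / (4 * a) * s ^ 2 := by ring
    have : 0 ≤ 8 * (Real.exp (1 / (4 * a)) * B) * s ^ 2 := by positivity
    rw [e]
    nlinarith [mul_le_mul_of_nonneg_left hs2 hlog]

/-- Sub-Gaussian tails give a Gaussian-type exponential moment. -/
lemma exp_sq_moment_of_tail [IsProbabilityMeasure P] {Y : Ω → ℝ} (hm : Measurable Y) {C₁ C₂ : ℝ}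
    (hC₁ : 0 < C₁) (hC₂ : 0 < C₂)
    (h : ∀ t > 0, P.real {ω | t < |Y ω|} ≤ C₁ * Real.exp (-C₂ * t ^ 2)) :
    Integrable (fun ω => Real.exp (C₂ / 2 * Y ω ^ 2)) P ∧
      ∫ ω, Real.exp (C₂ / 2 * Y ω ^ 2) ∂P ≤ 1 + C₁ := by
  have hmeas : Measurable fun ω => Real.exp (C₂ / 2 * Y ω ^ 2) := by fun_prop
  have hlin : ∫⁻ ω, ENNReal.ofReal (Real.exp (C₂ / 2 * Y ω ^ 2)) ∂P ≤ ENNReal.ofReal (1 + C₁) := by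
    -- Layer-cake formula: levels `t ≤ 1` contribute at most `1`, and above `1` the tail is at most
    -- `C₁ t⁻²`, with integral `C₁`.
    rw [lintegral_eq_lintegral_meas_lt P (ae_of_all _ fun ω => (Real.exp_pos _).le)
      hmeas.aemeasurable, ← Set.Ioc_union_Ioi_eq_Ioi (zero_le_one (α := ℝ)),
      lintegral_union measurableSet_Ioi (Set.Ioc_disjoint_Ioi le_rfl),
      ENNReal.ofReal_add zero_le_one hC₁.le]
    refine add_le_add ?_ ?_
    · calc _ ≤ ∫⁻ _t in Set.Ioc (0 : ℝ) 1, 1 := lintegral_mono fun t => prob_le_one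
        _ = _ := by simp
    · have hb : ∀ t ∈ Set.Ioi (1 : ℝ), P {ω | t < Real.exp (C₂ / 2 * Y ω ^ 2)} ≤
          ENNReal.ofReal (C₁ * t ^ (-2 : ℝ)) := by
        intro t ht
        have ht1 : (1 : ℝ) < t := ht
        have hl : 0 < Real.log t := Real.log_pos ht1
        have hx : 0 < √(2 * Real.log t / C₂) := Real.sqrt_pos.2 (by positivity)
        have hsub : {ω | t < Real.exp (C₂ / 2 * Y ω ^ 2)} ⊆ {ω | √(2 * Real.log t / C₂) < |Y ω|} := by
          intro ω hω
          have h2 : Real.log t < C₂ / 2 * Y ω ^ 2 := by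
            rw [← Real.log_exp (C₂ / 2 * Y ω ^ 2)]
            exact Real.log_lt_log (by linarith) hω
          change √(2 * Real.log t / C₂) < |Y ω|
          rw [← Real.sqrt_sq_eq_abs]
          refine Real.sqrt_lt_sqrt (by positivity) ?_
          rw [div_lt_iff₀ hC₂]; linarith
        refine (measure_mono hsub).trans ?_
        rw [← ofReal_measureReal]
        refine ENNReal.ofReal_le_ofReal ((h _ hx).trans (le_of_eq ?_))
        rw [Real.sq_sqrt (by positivity), Real.rpow_def_of_pos (by linarith)]
        congr 2
        field_simp
      calc _ ≤ ∫⁻ t in Set.Ioi (1 : ℝ), ENNReal.ofReal (C₁ * t ^ (-2 : ℝ)) :=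
            setLIntegral_mono' measurableSet_Ioi hb
        _ = ENNReal.ofReal (∫ t in Set.Ioi (1 : ℝ), C₁ * t ^ (-2 : ℝ)) := by
            rw [ofReal_integral_eq_lintegral_ofReal]
            · exact (integrableOn_Ioi_rpow_of_lt (by norm_num) one_pos).const_mul _
            · filter_upwards [ae_restrict_mem measurableSet_Ioi] with t ht
              have : (0 : ℝ) < t := lt_trans one_pos ht
              positivity
        _ = _ := by
            rw [integral_const_mul, integral_Ioi_rpow_of_lt (by norm_num) one_pos]
            norm_num
  have hi : Integrable (fun ω => Real.exp (C₂ / 2 * Y ω ^ 2)) P := by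
    refine ⟨hmeas.aestronglyMeasurable, ?_⟩
    rw [hasFiniteIntegral_iff_ofReal (ae_of_all _ fun ω => (Real.exp_pos _).le)]
    exact hlin.trans_lt ENNReal.ofReal_lt_top
  refine ⟨hi, ?_⟩
  rw [integral_eq_lintegral_of_nonneg_ae (ae_of_all _ fun ω => (Real.exp_pos _).le)
    hmeas.aestronglyMeasurable]
  exact ENNReal.toReal_le_of_le_ofReal (by linarith) hlin

/-- Chernoff bound for sums of nonnegative variables with an exponential moment. -/
lemma tail_sum_of_exp_moment [IsProbabilityMeasure P] {ι : Type*} {Y : ι → Ω → ℝ}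
    (hind : iIndepFun Y P) (hm : ∀ i, Measurable (Y i)) {a B L : ℝ} (ha : 0 < a)
    (hi : ∀ i, Integrable (fun ω => Real.exp (a * Y i ω)) P)
    (hB : ∀ i, ∫ ω, Real.exp (a * Y i ω) ∂P ≤ B) (hL : B ≤ Real.exp (a * L)) (A : Finset ι)
    (x : ℝ) :
    P.real {ω | L * A.card + x ≤ ∑ i ∈ A, Y i ω} ≤ Real.exp (-a * x) := by
  have h1 := hind.integrable_exp_mul_sum hm (s := A) fun i _ => hi i
  have h2 := hind.mgf_sum (t := a) hm A
  have h3 := measure_ge_le_exp_mul_mgf (L * A.card + x) ha.le h1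
  rw [h2] at h3
  simp only [mgf, Finset.sum_apply] at h3
  refine h3.trans ?_
  have h4 : ∏ i ∈ A, ∫ ω, Real.exp (a * Y i ω) ∂P ≤ Real.exp (A.card * (a * L)) := by
    rw [Real.exp_nat_mul, ← Finset.prod_const]
    exact Finset.prod_le_prod (fun i _ => integral_nonneg fun ω => (Real.exp_pos _).le)
      fun i _ => (hB i).trans hL
  calc _ ≤ Real.exp (-a * (L * A.card + x)) * Real.exp (A.card * (a * L)) := by gcongr
    _ = _ := by rw [← Real.exp_add]; ring_nf

end

/-! ### Decomposition of the statistic and moment bounds for its noise. -/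

namespace ChangePointModel

variable (m : ChangePointModel.{u})

/-- The observation centered at its mean. -/
def Z (i : Fin m.n) (a : Fin m.p) (ω : m.Ω) : ℝ := m.X i ω a - m.mean a

/-- The sample mean of the centered observations. -/
noncomputable def Zbar (a : Fin m.p) (ω : m.Ω) : ℝ := (∑ i, m.Z i a ω) / (m.n : ℝ)

/-- The covariance of the coordinates `q` of the observation `i`. -/
noncomputable def cov (i : Fin m.n) (q : Fin m.p × Fin m.p) : ℝ :=
  if (i : ℕ) < m.k₀ then m.S₁ q.1 q.2 else m.S₂ q.1 q.2

/-- The centered product of two coordinates of an observation. -/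
noncomputable def W (i : Fin m.n) (q : Fin m.p × Fin m.p) (ω : m.Ω) : ℝ :=
  m.Z i q.1 ω * m.Z i q.2 ω - m.cov i q

/-- The noise in the statistic `T`. -/
noncomputable def noise (i : Fin m.n) (q : Fin m.p × Fin m.p) (ω : m.Ω) : ℝ :=
  m.W i q ω - m.Zbar q.1 ω * m.Z i q.2 ω - m.Zbar q.2 ω * m.Z i q.1 ω

/-- An envelope of the noise. -/
noncomputable def env (i : Fin m.n) (q : Fin m.p × Fin m.p) (ω : m.Ω) : ℝ :=
  |m.W i q ω| + |m.Z i q.1 ω| + |m.Z i q.2 ω|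

lemma n_pos : (0 : ℝ) < m.n := by
  have := m.four_le_n
  exact_mod_cast (by omega : 0 < m.n)

lemma centered_eq (i : Fin m.n) (a : Fin m.p) (ω : m.Ω) :
    m.centered i ω a = m.Z i a ω - m.Zbar a ω := by
  have := m.n_pos
  simp only [centered, Zbar, Z, Finset.sum_sub_distrib, Finset.sum_const, Finset.card_univ,
    Fintype.card_fin, nsmul_eq_mul]
  field_simp
  ring

lemma T_eq (i : Fin m.n) (q : Fin m.p × Fin m.p) (ω : m.Ω) :
    m.T i ω q = (if (i : ℕ) < m.k₀ then m.S₁ q.1 q.2 else m.S₂ q.1 q.2)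
      + m.Zbar q.1 ω * m.Zbar q.2 ω + m.noise i q ω := by
  rw [T, centered_eq, centered_eq, noise, W, cov]
  ring

@[fun_prop]
lemma measurable_Z (i : Fin m.n) (a : Fin m.p) : Measurable (m.Z i a) :=
  ((measurable_pi_apply a).comp (m.measurable_X i)).sub_const _

@[fun_prop]
lemma measurable_W (i : Fin m.n) (q : Fin m.p × Fin m.p) : Measurable (m.W i q) := by
  unfold W; fun_prop

@[fun_prop]
lemma measurable_env (i : Fin m.n) (q : Fin m.p × Fin m.p) : Measurable (m.env i q) := by
  unfold env; fun_prop

lemma indep_comp (g : Fin m.n → (Fin m.p → ℝ) → ℝ) (hg : ∀ i, Measurable (g i)) :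
    iIndepFun (fun i ω => g i (m.X i ω)) m.P := m.indep.comp g hg

lemma indep_Z (a : Fin m.p) : iIndepFun (fun i => m.Z i a) m.P :=
  m.indep_comp (fun _ x => x a - m.mean a) fun _ => by fun_prop

lemma indep_W (q : Fin m.p × Fin m.p) : iIndepFun (fun i => m.W i q) m.P :=
  m.indep_comp (fun i x => (x q.1 - m.mean q.1) * (x q.2 - m.mean q.2) - m.cov i q)
    fun _ => by fun_prop

lemma indep_env (q : Fin m.p × Fin m.p) : iIndepFun (fun i => m.env i q) m.P :=
  m.indep_comp (fun i x => |(x q.1 - m.mean q.1) * (x q.2 - m.mean q.2) - m.cov i q|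
    + |x q.1 - m.mean q.1| + |x q.2 - m.mean q.2|) fun _ => by fun_prop

lemma env_nonneg (i : Fin m.n) (q : Fin m.p × Fin m.p) (ω : m.Ω) : 0 ≤ m.env i q ω := by
  unfold env; positivity

lemma integral_Z (i : Fin m.n) (a : Fin m.p) : ∫ ω, m.Z i a ω ∂m.P = 0 := by
  have h : Integrable (fun ω => m.X i ω a) m.P := (m.memLp_two i a).integrable one_le_two
  simp only [Z]
  rw [integral_sub h (integrable_const _), m.mean_eq]
  simp

lemma memLp_Z (i : Fin m.n) (a : Fin m.p) : MemLp (m.Z i a) 2 m.P :=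
  (m.memLp_two i a).sub (memLp_const _)

lemma integrable_Z_mul_Z (i : Fin m.n) (a b : Fin m.p) :
    Integrable (fun ω => m.Z i a ω * m.Z i b ω) m.P :=
  (m.memLp_Z i a).integrable_mul (m.memLp_Z i b)

lemma integral_Z_mul_Z (i : Fin m.n) (q : Fin m.p × Fin m.p) :
    ∫ ω, m.Z i q.1 ω * m.Z i q.2 ω ∂m.P = m.cov i q := by
  have h : covariance (fun ω => m.X i ω q.1) (fun ω => m.X i ω q.2) m.P = m.cov i q := by
    rw [cov]
    split_ifs with hi
    · exact m.cov_before i hi _ _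
    · exact m.cov_after i (not_lt.1 hi) _ _
  rw [← h, covariance, m.mean_eq, m.mean_eq]
  rfl

lemma integral_W (i : Fin m.n) (q : Fin m.p × Fin m.p) : ∫ ω, m.W i q ω ∂m.P = 0 := by
  simp only [W]
  rw [integral_sub (m.integrable_Z_mul_Z i q.1 q.2) (integrable_const _), integral_Z_mul_Z]
  simp

/-- Exponential moment bounds for the centered observations and their products. -/
structure NoiseBounds (a B v : ℝ) : Prop where
  integrable_env : ∀ i q, Integrable (fun ω => Real.exp (a * m.env i q ω)) m.P
  exp_env : ∀ i q, ∫ ω, Real.exp (a * m.env i q ω) ∂m.P ≤ B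
  mgf_W : ∀ i q, MGFBound (m.W i q) m.P v (a / 2)
  mgf_Z : ∀ i b r, MGFBound (m.Z i b) m.P v r
  abs_S₁ : ∀ b c, |m.S₁ b c| ≤ B
  abs_S₂ : ∀ b c, |m.S₂ b c| ≤ B

lemma MGFBound_mono {Ω : Type*} [MeasurableSpace Ω] {P : Measure Ω} {Y : Ω → ℝ} {v v' r : ℝ}
    (h : MGFBound Y P v r) (hv : v ≤ v') : MGFBound Y P v' r := fun s hs =>
  ⟨(h s hs).1, (h s hs).2.trans (Real.exp_le_exp.2 (by gcongr))⟩

/-- The square of a sub-Gaussian centered observation has an exponential moment. -/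
lemma exp_Z_sq_moment {C₁ C₂ M : ℝ} (hC₁ : 0 < C₁) (hC₂ : 0 < C₂)
    (h : m.SubGaussianBounded C₁ C₂ M) (i : Fin m.n) (b : Fin m.p) :
    Integrable (fun ω => Real.exp (C₂ / 4 * m.Z i b ω ^ 2)) m.P ∧
      ∫ ω, Real.exp (C₂ / 4 * m.Z i b ω ^ 2) ∂m.P ≤ Real.exp (1 + C₁) * (1 + C₁) := by
  have hX : Measurable fun ω => m.X i ω b := (measurable_pi_apply b).comp (m.measurable_X i)
  obtain ⟨h1, h2⟩ := exp_sq_moment_of_tail hX hC₁ hC₂ (h.1 i b)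
  -- The unknown mean is bounded through the moment itself: integrate `2 μ X - μ² ≤ X²`, using that
  -- `C₂ X² / 2` is below its exponential.
  have hm : C₂ / 2 * m.mean b ^ 2 ≤ 1 + C₁ := by
    have hL := m.memLp_two i b
    have hi1 : Integrable (fun ω => m.X i ω b) m.P := hL.integrable one_le_two
    have hi2 : Integrable (fun ω => m.X i ω b ^ 2) m.P := hL.integrable_sq
    have hpt : ∀ ω, C₂ / 2 * (2 * m.mean b * m.X i ω b - m.mean b ^ 2) ≤
        Real.exp (C₂ / 2 * m.X i ω b ^ 2) := by
      intro ω
      have := Real.add_one_le_exp (C₂ / 2 * m.X i ω b ^ 2)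
      nlinarith [mul_nonneg hC₂.le (sq_nonneg (m.X i ω b - m.mean b))]
    have hi3 : Integrable (fun ω => 2 * m.mean b * m.X i ω b - m.mean b ^ 2) m.P :=
      (hi1.const_mul _).sub (integrable_const _)
    have := (integral_mono (hi3.const_mul (C₂ / 2)) h1 hpt).trans h2
    rw [integral_const_mul, integral_sub (hi1.const_mul _) (integrable_const _),
      integral_const_mul, m.mean_eq] at this
    simp only [integral_const, probReal_univ, smul_eq_mul, one_mul] at this
    linarith
  have hpt : ∀ ω, Real.exp (C₂ / 4 * m.Z i b ω ^ 2) ≤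
      Real.exp (1 + C₁) * Real.exp (C₂ / 2 * m.X i ω b ^ 2) := by
    intro ω
    rw [← Real.exp_add, Real.exp_le_exp, Z]
    nlinarith [mul_nonneg hC₂.le (sq_nonneg (m.X i ω b + m.mean b))]
  have hi : Integrable (fun ω => Real.exp (C₂ / 4 * m.Z i b ω ^ 2)) m.P := by
    refine (h1.const_mul (Real.exp (1 + C₁))).mono' ?_ (ae_of_all _ fun ω => ?_)
    · have := m.measurable_Z i b
      exact Measurable.aestronglyMeasurable (by fun_prop)
    · rw [Real.norm_eq_abs, abs_of_pos (Real.exp_pos _)]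
      exact hpt ω
  refine ⟨hi, (integral_mono hi (h1.const_mul _) hpt).trans ?_⟩
  rw [integral_const_mul]
  gcongr

section moments

variable {c B₀ : ℝ} (hc : 0 < c) (hZ : ∀ i b, Integrable (fun ω => Real.exp (c * m.Z i b ω ^ 2)) m.P ∧
  ∫ ω, Real.exp (c * m.Z i b ω ^ 2) ∂m.P ≤ B₀)
include hZ

lemma integrable_exp_sq_add (i : Fin m.n) (q : Fin m.p × Fin m.p) :
    Integrable (fun ω => Real.exp (c * m.Z i q.1 ω ^ 2) + Real.exp (c * m.Z i q.2 ω ^ 2)) m.P :=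
  (hZ i q.1).1.add (hZ i q.2).1

lemma integral_exp_sq_add_le (i : Fin m.n) (q : Fin m.p × Fin m.p) :
    ∫ ω, (Real.exp (c * m.Z i q.1 ω ^ 2) + Real.exp (c * m.Z i q.2 ω ^ 2)) ∂m.P ≤ 2 * B₀ := by
  rw [integral_add (hZ i q.1).1 (hZ i q.2).1]
  linarith [(hZ i q.1).2, (hZ i q.2).2]

include hc

lemma abs_cov_le (i : Fin m.n) (q : Fin m.p × Fin m.p) : |m.cov i q| ≤ B₀ / c := by
  rw [← integral_Z_mul_Z]
  have hpt : ∀ ω, |m.Z i q.1 ω * m.Z i q.2 ω| ≤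
      1 / (2 * c) * (Real.exp (c * m.Z i q.1 ω ^ 2) + Real.exp (c * m.Z i q.2 ω ^ 2)) := by
    intro ω
    have e1 := Real.add_one_le_exp (c * m.Z i q.1 ω ^ 2)
    have e2 := Real.add_one_le_exp (c * m.Z i q.2 ω ^ 2)
    rw [one_div, ← div_eq_inv_mul, le_div_iff₀ (by positivity), abs_mul]
    nlinarith [mul_nonneg hc.le (sq_nonneg (|m.Z i q.1 ω| - |m.Z i q.2 ω|)),
      sq_abs (m.Z i q.1 ω), sq_abs (m.Z i q.2 ω)]
  refine abs_integral_le_integral_abs.trans ((integral_mono (m.integrable_Z_mul_Z i q.1 q.2).abs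
    ((m.integrable_exp_sq_add hZ i q).const_mul _) hpt).trans ?_)
  rw [integral_const_mul]
  calc _ ≤ 1 / (2 * c) * (2 * B₀) := by
        gcongr
        exact m.integral_exp_sq_add_le hZ i q
    _ = _ := by field_simp

/-- By the arithmetic-geometric mean inequality `env ≤ B₀ / c + 1 + Z₁² + Z₂²`. The exponentials of
the two squares are decoupled by `2 u v ≤ u² + v²`, which is why the exponent drops from `c` to `c /
2`. -/
lemma exp_env_moment (i : Fin m.n) (q : Fin m.p × Fin m.p) :
    Integrable (fun ω => Real.exp (c / 2 * m.env i q ω)) m.P ∧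
      ∫ ω, Real.exp (c / 2 * m.env i q ω) ∂m.P ≤ Real.exp (c / 2 * (B₀ / c + 1)) * B₀ := by
  have henv : ∀ ω, Real.exp (c / 2 * m.env i q ω) ≤ Real.exp (c / 2 * (B₀ / c + 1)) * (1 / 2) *
      (Real.exp (c * m.Z i q.1 ω ^ 2) + Real.exp (c * m.Z i q.2 ω ^ 2)) := by
    intro ω
    have e0 : m.env i q ω ≤ B₀ / c + 1 + (m.Z i q.1 ω ^ 2 + m.Z i q.2 ω ^ 2) := by
      have h1 : |m.W i q ω| ≤ |m.Z i q.1 ω| * |m.Z i q.2 ω| + B₀ / c := by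
        rw [W, ← abs_mul]
        exact (abs_sub _ _).trans (by linarith [m.abs_cov_le hc hZ i q])
      rw [env]
      nlinarith [sq_nonneg (|m.Z i q.1 ω| - |m.Z i q.2 ω|), sq_nonneg (|m.Z i q.1 ω| - 1),
        sq_nonneg (|m.Z i q.2 ω| - 1), sq_abs (m.Z i q.1 ω), sq_abs (m.Z i q.2 ω)]
    have e1 : Real.exp (c / 2 * m.env i q ω) ≤ Real.exp (c / 2 * (B₀ / c + 1)) *
        (Real.exp (c / 2 * m.Z i q.1 ω ^ 2) * Real.exp (c / 2 * m.Z i q.2 ω ^ 2)) := by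
      rw [← Real.exp_add, ← Real.exp_add, Real.exp_le_exp]
      calc c / 2 * m.env i q ω ≤ c / 2 * (B₀ / c + 1 + (m.Z i q.1 ω ^ 2 + m.Z i q.2 ω ^ 2)) := by
            gcongr
        _ = _ := by ring
    refine e1.trans ?_
    rw [mul_assoc]
    refine mul_le_mul_of_nonneg_left ?_ (Real.exp_pos _).le
    have e2 : ∀ x : ℝ, Real.exp (c * x) = Real.exp (c / 2 * x) ^ 2 := by
      intro x; rw [← Real.exp_nat_mul]; congr 1; push_cast; ring
    rw [e2, e2]
    nlinarith [sq_nonneg (Real.exp (c / 2 * m.Z i q.1 ω ^ 2) - Real.exp (c / 2 * m.Z i q.2 ω ^ 2))]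
  have hi0 := (m.integrable_exp_sq_add hZ i q).const_mul
    (Real.exp (c / 2 * (B₀ / c + 1)) * (1 / 2))
  have hi : Integrable (fun ω => Real.exp (c / 2 * m.env i q ω)) m.P := by
    refine hi0.mono' ?_ (ae_of_all _ fun ω => ?_)
    · have := m.measurable_env i q
      exact Measurable.aestronglyMeasurable (by fun_prop)
    · rw [Real.norm_eq_abs, abs_of_pos (Real.exp_pos _)]
      exact henv ω
  refine ⟨hi, (integral_mono hi hi0 henv).trans ?_⟩
  rw [integral_const_mul]
  calc _ ≤ Real.exp (c / 2 * (B₀ / c + 1)) * (1 / 2) * (2 * B₀) := by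
        gcongr
        exact m.integral_exp_sq_add_le hZ i q
    _ = _ := by ring

lemma exp_abs_W_moment (i : Fin m.n) (q : Fin m.p × Fin m.p) :
    Integrable (fun ω => Real.exp (c / 2 * |m.W i q ω|)) m.P ∧
      ∫ ω, Real.exp (c / 2 * |m.W i q ω|) ∂m.P ≤ Real.exp (c / 2 * (B₀ / c + 1)) * B₀ := by
  obtain ⟨h1, h2⟩ := m.exp_env_moment hc hZ i q
  have hW : ∀ ω, Real.exp (c / 2 * |m.W i q ω|) ≤ Real.exp (c / 2 * m.env i q ω) := by
    intro ω
    rw [Real.exp_le_exp, env]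
    have := abs_nonneg (m.Z i q.1 ω)
    have := abs_nonneg (m.Z i q.2 ω)
    gcongr
    linarith
  have hi : Integrable (fun ω => Real.exp (c / 2 * |m.W i q ω|)) m.P := by
    refine h1.mono' ?_ (ae_of_all _ fun ω => ?_)
    · have := m.measurable_W i q
      exact Measurable.aestronglyMeasurable (by fun_prop)
    · rw [Real.norm_eq_abs, abs_of_pos (Real.exp_pos _)]
      exact hW ω
  exact ⟨hi, (integral_mono hi h1 hW).trans h2⟩

end moments

theorem exists_noiseBounds (C₁ C₂ M : ℝ) (hC₁ : 0 < C₁) (hC₂ : 0 < C₂) :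
    ∃ a > 0, ∃ B ≥ 1, ∃ v > 0, ∀ m : ChangePointModel.{u}, m.SubGaussianBounded C₁ C₂ M →
      m.NoiseBounds a B v := by
  obtain ⟨c, hc⟩ : ∃ c, c = C₂ / 4 := ⟨_, rfl⟩
  obtain ⟨B₀, hB₀⟩ : ∃ B₀, B₀ = Real.exp (1 + C₁) * (1 + C₁) := ⟨_, rfl⟩
  have hc0 : 0 < c := by rw [hc]; positivity
  have hB1 : 1 ≤ B₀ := by
    rw [hB₀]
    exact one_le_mul_of_one_le_of_one_le (Real.one_le_exp (by linarith)) (by linarith)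
  have hK0 : 0 < B₀ / c := by positivity
  obtain ⟨E, hE⟩ : ∃ E, E = Real.exp (c / 2 * (B₀ / c + 1)) * B₀ := ⟨_, rfl⟩
  have hE1 : 1 ≤ E := by
    rw [hE]
    exact one_le_mul_of_one_le_of_one_le (Real.one_le_exp (by positivity)) hB1
  obtain ⟨v₁, hv₁⟩ : ∃ v₁, v₁ = 8 * E / (c / 2) ^ 2 := ⟨_, rfl⟩
  obtain ⟨v₂, hv₂⟩ : ∃ v₂, v₂ = 8 * (Real.exp (1 / (4 * c)) * B₀) +
    (1 / (4 * c) + 4 * Real.log B₀) := ⟨_, rfl⟩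
  refine ⟨c / 2, by positivity, E + B₀ / c, by linarith, max 1 (max v₁ v₂), by positivity,
    fun m h => ?_⟩
  have hZ := m.exp_Z_sq_moment hC₁ hC₂ h
  rw [← hc, ← hB₀] at hZ
  have hW := m.exp_abs_W_moment hc0 hZ
  have henv := m.exp_env_moment hc0 hZ
  have hcov := m.abs_cov_le hc0 hZ
  rw [← hE] at hW henv
  refine ⟨fun i q => (henv i q).1, fun i q => (henv i q).2.trans (by linarith), fun i q => ?_,
    fun i b r => ?_, fun b d => ?_, fun b d => ?_⟩
  · refine MGFBound_mono (mgfBound_of_exp_abs (m.measurable_W i q) (m.integral_W i q)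
      (by positivity : 0 < c / 2) (hW i q).1 (hW i q).2) ?_
    rw [← hv₁]; exact (le_max_left _ _).trans (le_max_right _ _)
  · refine MGFBound_mono (mgfBound_of_exp_sq (m.measurable_Z i b) (m.integral_Z i b) hc0 hB1
      (hZ i b).1 (hZ i b).2 r) ?_
    rw [← hv₂]; exact (le_max_right _ _).trans (le_max_right _ _)
  · have := hcov ⟨0, by have := m.four_le_n; omega⟩ (b, d)
    rw [cov, if_pos (by exact m.one_le_k₀)] at this
    exact this.trans (by linarith)
  · have := hcov ⟨m.k₀, m.k₀_lt_n⟩ (b, d)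
    rw [cov, if_neg (lt_irrefl _)] at this
    exact this.trans (by linarith)

end ChangePointModel

/-! ### Uniform control of the noise over all positions and intervals. -/

lemma sq_sub_sub_le (x y z : ℝ) : (x - y - z) ^ 2 ≤ 3 * (x ^ 2 + y ^ 2 + z ^ 2) := by
  nlinarith [sq_nonneg (x + y), sq_nonneg (x + z), sq_nonneg (y - z)]

lemma seg_self {n l : ℕ} : (seg l l : Finset (Fin n)) = ∅ := by
  ext i; simp only [mem_seg, Finset.notMem_empty, iff_false]; omega

lemma seg_succ {n : ℕ} (i : Fin n) : (seg (i : ℕ) ((i : ℕ) + 1) : Finset (Fin n)) = {i} := by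
  ext j; simp only [mem_seg, Finset.mem_singleton, Fin.ext_iff]; omega

/-- Union bound over all index pairs and all intervals. -/
lemma measureReal_exists_le {Ω : Type*} [MeasurableSpace Ω] {P : Measure Ω} [IsProbabilityMeasure P]
    {n p : ℕ} (bad : Fin p × Fin p → ℕ → ℕ → Set Ω) {β : ℝ} (hβ : 0 ≤ β)
    (h : ∀ q l r, l < r → r ≤ n → P.real (bad q l r) ≤ β) :
    P.real {ω | ∃ q l r, l < r ∧ r ≤ n ∧ ω ∈ bad q l r} ≤ (p : ℝ) ^ 2 * (n : ℝ) ^ 2 * β := by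
  classical
  let s : Finset ((Fin p × Fin p) × ℕ × ℕ) :=
    Finset.univ ×ˢ (Finset.range n ×ˢ Finset.range n)
  -- Intervals are coded by `(l, r - 1)`, so that both numbers lie below `n`.
  let f : (Fin p × Fin p) × ℕ × ℕ → Set Ω := fun x =>
    if x.2.1 < x.2.2 + 1 then bad x.1 x.2.1 (x.2.2 + 1) else ∅
  have hsub : {ω | ∃ q l r, l < r ∧ r ≤ n ∧ ω ∈ bad q l r} ⊆ ⋃ x ∈ s, f x := by
    rintro ω ⟨q, l, r, hlr, hr, hω⟩
    refine Set.mem_biUnion (x := (q, l, r - 1)) ?_ ?_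
    · simp only [s, Finset.coe_product, Set.mem_prod, Finset.mem_coe, Finset.mem_univ, true_and,
        Finset.mem_range]
      omega
    · have e : r - 1 + 1 = r := by omega
      simp only [f, e, if_pos hlr]
      exact hω
  refine (measureReal_mono hsub (measure_ne_top _ _)).trans ((measureReal_biUnion_finset_le s f).trans ?_)
  have hb : ∀ x ∈ s, P.real (f x) ≤ β := by
    intro x hx
    simp only [s, Finset.mem_product, Finset.mem_univ, true_and, Finset.mem_range] at hx
    by_cases hc : x.2.1 < x.2.2 + 1
    · simp only [f, if_pos hc]
      exact h _ _ _ hc (by omega)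
    · simp only [f, if_neg hc, measureReal_empty]
      exact hβ
  refine (Finset.sum_le_card_nsmul _ _ _ hb).trans (le_of_eq ?_)
  simp only [s, Finset.card_product, Finset.card_univ, Fintype.card_prod, Fintype.card_fin,
    Finset.card_range, nsmul_eq_mul]
  push_cast
  ring

namespace ChangePointModel

variable (m : ChangePointModel.{u})

lemma sum_noise (A : Finset (Fin m.n)) (q : Fin m.p × Fin m.p) (ω : m.Ω) :
    ∑ i ∈ A, m.noise i q ω = ∑ i ∈ A, m.W i q ω - m.Zbar q.1 ω * ∑ i ∈ A, m.Z i q.2 ω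
      - m.Zbar q.2 ω * ∑ i ∈ A, m.Z i q.1 ω := by
  simp only [noise, Finset.sum_sub_distrib, Finset.mul_sum]

lemma Zbar_sq_le {b : Fin m.p} {ω : m.Ω} {x : ℝ}
    (h : (∑ i ∈ seg 0 m.n, m.Z i b ω) ^ 2 ≤ x * (m.n : ℝ) ^ 2) : m.Zbar b ω ^ 2 ≤ x := by
  rw [seg_zero_self] at h
  rw [Zbar, div_pow, div_le_iff₀ (by have := m.n_pos; positivity)]
  exact h

/-- The sums of `Z` are required at level `√τ` only: in the cross terms such a sum is multiplied by
a sample mean with square at most `√τ`, and `√τ · √τ = τ`. -/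
lemma segBound_of_crude {δ τ : ℝ} (hδ : δ ≤ 1) (hτ : 0 ≤ τ)
    (q : Fin m.p × Fin m.p) (ω : m.Ω)
    (hW : ∀ l r : ℕ, l < r → r ≤ m.n →
      (∑ i ∈ seg l r, m.W i q ω) ^ 2 ≤ δ * (τ * ((r : ℝ) - l)))
    (hZ₁ : ∀ l r : ℕ, l < r → r ≤ m.n →
      (∑ i ∈ seg l r, m.Z i q.1 ω) ^ 2 ≤ δ * (√τ * ((r : ℝ) - l)))
    (hZ₂ : ∀ l r : ℕ, l < r → r ≤ m.n →
      (∑ i ∈ seg l r, m.Z i q.2 ω) ^ 2 ≤ δ * (√τ * ((r : ℝ) - l))) :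
    SegBound (fun i => m.noise i q ω) (9 * δ) τ 0 := by
  have hn := m.n_pos
  have hn1 : (1 : ℝ) ≤ m.n := by have := m.four_le_n; exact_mod_cast (by omega : 1 ≤ m.n)
  have hs : √τ * √τ = τ := Real.mul_self_sqrt hτ
  have hs0 : 0 ≤ √τ := Real.sqrt_nonneg τ
  have hbar : ∀ b, (∑ i ∈ seg 0 m.n, m.Z i b ω) ^ 2 ≤ δ * (√τ * ((m.n : ℝ) - (0 : ℕ))) →
      m.Zbar b ω ^ 2 ≤ √τ := by
    intro b hb
    refine m.Zbar_sq_le (hb.trans ?_)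
    have h1 : √τ * (m.n : ℝ) ≤ √τ * (m.n : ℝ) ^ 2 := by gcongr; nlinarith
    have h2 : 0 ≤ √τ * (m.n : ℝ) := by positivity
    push_cast
    rw [sub_zero]
    nlinarith
  have hn0 : 0 < m.n := by exact_mod_cast hn
  have b1 := hbar q.1 (hZ₁ 0 m.n hn0 le_rfl)
  have b2 := hbar q.2 (hZ₂ 0 m.n hn0 le_rfl)
  have hsum : ∀ l r : ℕ, l < r → r ≤ m.n →
      (∑ i ∈ seg l r, m.noise i q ω) ^ 2 ≤ 9 * δ * (τ * ((r : ℝ) - l)) := by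
    intro l r hlr hr
    have hk : 0 ≤ (r : ℝ) - l := by rw [sub_nonneg]; exact_mod_cast hlr.le
    rw [sum_noise]
    refine (sq_sub_sub_le _ _ _).trans ?_
    have c1 := hW l r hlr hr
    have c2 := mul_le_mul b1 (hZ₂ l r hlr hr) (sq_nonneg _) hs0
    have c3 := mul_le_mul b2 (hZ₁ l r hlr hr) (sq_nonneg _) hs0
    have e : √τ * (δ * (√τ * ((r : ℝ) - l))) = δ * (τ * ((r : ℝ) - l)) := by
      rw [← hs]; ring_nf; rw [Real.sq_sqrt (by positivity)]
    rw [e] at c2 c3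
    rw [mul_pow, mul_pow]
    linarith
  intro l r hlr hr
  rcases hlr.eq_or_lt with rfl | hlr
  · simp [seg_self]
  rw [add_zero]
  refine ⟨hsum l r hlr hr, ?_⟩
  -- The bound on intervals of length one is pointwise, and adding it up gives the sums of squares.
  have hone : ∀ i ∈ (seg l r : Finset (Fin m.n)), m.noise i q ω ^ 2 ≤ 9 * δ * τ := by
    intro i _
    have := hsum i (i + 1) (by omega) (by omega)
    rw [seg_succ, Finset.sum_singleton] at this
    push_cast at this
    calc _ ≤ _ := this
      _ = _ := by ring
  refine (Finset.sum_le_card_nsmul _ _ _ hone).trans (le_of_eq ?_)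
  rw [nsmul_eq_mul, card_seg_cast hlr.le hr]
  ring

lemma abs_noise_le_env {q : Fin m.p × Fin m.p} {ω : m.Ω} (h1 : |m.Zbar q.1 ω| ≤ 1)
    (h2 : |m.Zbar q.2 ω| ≤ 1) (i : Fin m.n) : |m.noise i q ω| ≤ m.env i q ω := by
  rw [noise, env]
  have e1 : |m.Zbar q.1 ω * m.Z i q.2 ω| ≤ |m.Z i q.2 ω| := by
    rw [abs_mul]; exact mul_le_of_le_one_left (abs_nonneg _) h1
  have e2 : |m.Zbar q.2 ω * m.Z i q.1 ω| ≤ |m.Z i q.1 ω| := by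
    rw [abs_mul]; exact mul_le_of_le_one_left (abs_nonneg _) h2
  have e3 := abs_sub (m.W i q ω - m.Zbar q.1 ω * m.Z i q.2 ω) (m.Zbar q.2 ω * m.Z i q.1 ω)
  have e4 := abs_sub (m.W i q ω) (m.Zbar q.1 ω * m.Z i q.2 ω)
  linarith

/-- For `τ ≤ n` the sample means are at most `1`, so the noise is below its envelope. Squares are
summed as maximum times sum: one envelope factor is at most `δ τ`, and the envelopes add up to at
most `L |I| + τ`. This product is the origin of the excess `H = τ²`. -/
lemma segBound_of_fine {δ τ L : ℝ} (hδ0 : 0 ≤ δ) (hδ : δ ≤ 1 / 2) (hτ : 0 ≤ τ)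
    (hτn : τ ≤ m.n) (hL : 0 ≤ L) (q : Fin m.p × Fin m.p) (ω : m.Ω)
    (hW : ∀ l r : ℕ, l < r → r ≤ m.n →
      (∑ i ∈ seg l r, m.W i q ω) ^ 2 ≤ δ * (τ * (((r : ℝ) - l) + τ)))
    (hZ₁ : ∀ l r : ℕ, l < r → r ≤ m.n →
      (∑ i ∈ seg l r, m.Z i q.1 ω) ^ 2 ≤ δ * (τ * (((r : ℝ) - l) + τ)))
    (hZ₂ : ∀ l r : ℕ, l < r → r ≤ m.n →
      (∑ i ∈ seg l r, m.Z i q.2 ω) ^ 2 ≤ δ * (τ * (((r : ℝ) - l) + τ)))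
    (henv : ∀ i, m.env i q ω ≤ δ * τ)
    (hsumenv : ∀ l r : ℕ, l < r → r ≤ m.n →
      ∑ i ∈ seg l r, m.env i q ω ≤ L * ((r : ℝ) - l) + τ) :
    SegBound (fun i => m.noise i q ω) ((10 + L) * δ) τ (τ ^ 2) ∧ |m.Zbar q.1 ω| ≤ 1 ∧
      |m.Zbar q.2 ω| ≤ 1 := by
  have hn := m.n_pos
  have hn0 : 0 < m.n := by exact_mod_cast hn
  have hbar : ∀ b, (∑ i ∈ seg 0 m.n, m.Z i b ω) ^ 2 ≤ δ * (τ * (((m.n : ℝ) - (0 : ℕ)) + τ)) →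
      |m.Zbar b ω| ≤ 1 := by
    intro b hb
    refine (sq_le_one_iff_abs_le_one _).1 (m.Zbar_sq_le (hb.trans ?_))
    push_cast
    rw [sub_zero]
    calc δ * (τ * (m.n + τ)) ≤ 1 / 2 * (m.n * (m.n + m.n)) := by gcongr
      _ = _ := by ring
  have b1 := hbar q.1 (hZ₁ 0 m.n hn0 le_rfl)
  have b2 := hbar q.2 (hZ₂ 0 m.n hn0 le_rfl)
  refine ⟨?_, b1, b2⟩
  intro l r hlr hr
  rcases hlr.eq_or_lt with rfl | hlr
  · have : 0 ≤ (10 + L) * δ * (τ ^ 2) := by positivity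
    simpa [seg_self] using this
  have hk : 0 ≤ (r : ℝ) - l := by rw [sub_nonneg]; exact_mod_cast hlr.le
  have hX : 0 ≤ δ * (τ * (((r : ℝ) - l) + τ)) := by positivity
  constructor
  · rw [sum_noise]
    refine (sq_sub_sub_le _ _ _).trans ?_
    have c1 := hW l r hlr hr
    have c2 := mul_le_mul ((sq_le_one_iff_abs_le_one _).2 b1) (hZ₂ l r hlr hr) (sq_nonneg _)
      zero_le_one
    have c3 := mul_le_mul ((sq_le_one_iff_abs_le_one _).2 b2) (hZ₁ l r hlr hr) (sq_nonneg _)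
      zero_le_one
    rw [mul_pow, mul_pow]
    have : 0 ≤ L * (δ * (τ * (((r : ℝ) - l) + τ))) := by positivity
    nlinarith
  · have hone : ∀ i ∈ (seg l r : Finset (Fin m.n)), m.noise i q ω ^ 2 ≤ δ * τ * m.env i q ω := by
      intro i _
      rw [← sq_abs, sq]
      exact mul_le_mul ((m.abs_noise_le_env b1 b2 i).trans (henv i)) (m.abs_noise_le_env b1 b2 i)
        (abs_nonneg _) (by positivity)
    refine (Finset.sum_le_sum hone).trans ?_
    rw [← Finset.mul_sum]
    calc δ * τ * ∑ i ∈ seg l r, m.env i q ω ≤ δ * τ * (L * ((r : ℝ) - l) + τ) := by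
          gcongr
          exact hsumenv l r hlr hr
      _ ≤ _ := by
        have : 0 ≤ δ * τ * (10 * ((r : ℝ) - l) + 9 * τ + L * τ) := by positivity
        nlinarith

variable {m}

section events
variable {a B v : ℝ} (ha : 0 < a) (hv : 0 < v)
include ha hv

/-- Outside an event of probability `O(p² n² exp(-c √τ))` all partial sums of the noise are small
compared with `√τ`. -/
lemma exists_crude_event {δ : ℝ} (hδ : 0 < δ) :
    ∃ c > 0, ∀ m : ChangePointModel.{u}, m.NoiseBounds a B v → ∀ τ : ℝ, 1 ≤ τ →
      m.P.real {ω | ¬ ∀ q, SegBound (fun i => m.noise i q ω) δ τ 0} ≤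
        (m.p : ℝ) ^ 2 * (m.n : ℝ) ^ 2 * (6 * Real.exp (-c * √τ)) := by
  obtain ⟨d, hd⟩ : ∃ d, d = min 1 (δ / 9) := ⟨_, rfl⟩
  have hd0 : 0 < d := by rw [hd]; positivity
  have hd1 : d ≤ 1 := by rw [hd]; exact min_le_left _ _
  have hdδ : 9 * d ≤ δ := by
    have : d ≤ δ / 9 := by rw [hd]; exact min_le_right _ _
    linarith
  have hsd : 0 < √d := Real.sqrt_pos.2 hd0
  obtain ⟨α, hα⟩ : ∃ α, α = min (a / 2) (√d / (2 * v)) := ⟨_, rfl⟩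
  have hα0 : 0 < α := by rw [hα]; positivity
  have hαa : α ≤ a / 2 := by rw [hα]; exact min_le_left _ _
  have hαv : v * α ≤ √d / 2 := by
    have : α ≤ √d / (2 * v) := by rw [hα]; exact min_le_right _ _
    calc v * α ≤ v * (√d / (2 * v)) := by gcongr
      _ = _ := by field_simp
  refine ⟨α * √d / 2, by positivity, fun m hm τ hτ => ?_⟩
  have hτ0 : 0 < τ := by linarith
  have hsτ : 1 ≤ √τ := by rw [← Real.sqrt_one]; exact Real.sqrt_le_sqrt hτ
  let bad : Fin m.p × Fin m.p → ℕ → ℕ → Set m.Ω := fun q l r =>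
    {ω | d * √(τ * ((r : ℝ) - l)) ^ 2 < (∑ i ∈ seg l r, m.W i q ω) ^ 2} ∪
    ({ω | d * √(√τ * ((r : ℝ) - l)) ^ 2 < (∑ i ∈ seg l r, m.Z i q.1 ω) ^ 2} ∪
      {ω | d * √(√τ * ((r : ℝ) - l)) ^ 2 < (∑ i ∈ seg l r, m.Z i q.2 ω) ^ 2})
  have hbad : ∀ q l r, l < r → r ≤ m.n →
      m.P.real (bad q l r) ≤ 6 * Real.exp (-(α * √d / 2) * √τ) := by
    intro q l r hlr hr
    obtain ⟨k, hk⟩ : ∃ k : ℝ, k = (r : ℝ) - l := ⟨_, rfl⟩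
    have hk1 : 1 ≤ k := by
      have : (l : ℝ) + 1 ≤ r := by exact_mod_cast hlr
      linarith
    have hk0 : 0 < k := by linarith
    have hcard : ((seg l r : Finset (Fin m.n)).card : ℝ) = k := by
      rw [card_seg_cast hlr.le hr, hk]
    have tW := (MGFBound.sum (m.indep_W q) (fun i => m.measurable_W i q) (fun i => hm.mgf_W i q)
      (seg l r)).tail_sq (ξ := √(τ * k)) (η := √(1 / k)) (T := √τ) hα0.le hd0.le hαv
      (Real.sqrt_nonneg _) (Real.sqrt_nonneg _) (by
        have : √(1 / k) ≤ 1 := by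
          exact (Real.sqrt_le_sqrt ((div_le_one hk0).2 hk1)).trans_eq Real.sqrt_one
        exact (mul_le_of_le_one_right hα0.le this).trans hαa) (by
        rw [← Real.sqrt_mul (by positivity)]; congr 1; field_simp) (by
        rw [hcard, Real.sq_sqrt (by positivity)]; field_simp; linarith) hv.le
    have tZ : ∀ b, _ := fun b =>
      (MGFBound.sum (m.indep_Z b) (fun i => m.measurable_Z i b)
      (fun i => hm.mgf_Z i b (α * √(√τ / k)))
      (seg l r)).tail_sq (ξ := √(√τ * k)) (η := √(√τ / k)) (T := √τ) hα0.le hd0.le hαv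
      (Real.sqrt_nonneg _) (Real.sqrt_nonneg _) le_rfl (by
        rw [← Real.sqrt_mul (by positivity),
          show √τ * k * (√τ / k) = √τ * √τ by field_simp, Real.sqrt_mul_self (by positivity)]) (by
        rw [hcard, Real.sq_sqrt (by positivity)]; field_simp; exact le_rfl) hv.le
    refine (measureReal_union_le _ _).trans ?_
    have h2 := measureReal_union_le (μ := m.P)
      {ω | d * √(√τ * ((r : ℝ) - l)) ^ 2 < (∑ i ∈ seg l r, m.Z i q.1 ω) ^ 2}
      {ω | d * √(√τ * ((r : ℝ) - l)) ^ 2 < (∑ i ∈ seg l r, m.Z i q.2 ω) ^ 2}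
    rw [← hk] at h2 ⊢
    linarith [tZ q.1, tZ q.2]
  refine (measureReal_mono ?_).trans (measureReal_exists_le bad (by positivity) hbad)
  intro ω hω
  by_contra hcon
  apply hω
  intro q
  simp only [Set.mem_ofPred_eq, not_exists, not_and, bad, Set.mem_union, not_or, not_lt] at hcon
  have hSB := m.segBound_of_crude hd1 hτ0.le q ω
    (fun l r hlr hr => by
      have := (hcon q l r hlr hr).1
      rwa [Real.sq_sqrt (mul_nonneg hτ0.le (by rw [sub_nonneg]; exact_mod_cast hlr.le))] at this)
    (fun l r hlr hr => by
      have := (hcon q l r hlr hr).2.1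
      rwa [Real.sq_sqrt (mul_nonneg (Real.sqrt_nonneg _)
        (by rw [sub_nonneg]; exact_mod_cast hlr.le))] at this)
    (fun l r hlr hr => by
      have := (hcon q l r hlr hr).2.2
      rwa [Real.sq_sqrt (mul_nonneg (Real.sqrt_nonneg _)
        (by rw [sub_nonneg]; exact_mod_cast hlr.le))] at this)
  intro l r hlr hr
  obtain ⟨h1, h2⟩ := hSB l r hlr hr
  have hk : 0 ≤ τ * ((r : ℝ) - l) + 0 := by
    rw [add_zero]; exact mul_nonneg hτ0.le (by rw [sub_nonneg]; exact_mod_cast hlr)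
  exact ⟨h1.trans (by gcongr), h2.trans (by gcongr)⟩

/-- For moderate thresholds the exceptional probability is `O(p² n² exp(-c τ))`, at the price of
an additional term that is negligible on long intervals. -/
lemma exists_fine_event (hB : 1 ≤ B) {δ : ℝ} (hδ : 0 < δ) :
    ∃ c > 0, ∃ K > 0, ∀ m : ChangePointModel.{u}, m.NoiseBounds a B v → ∀ τ : ℝ, 0 < τ → τ ≤ m.n →
      m.P.real {ω | ¬ ∀ q, SegBound (fun i => m.noise i q ω) δ τ (τ ^ 2) ∧
        |m.Zbar q.1 ω| ≤ 1 ∧ |m.Zbar q.2 ω| ≤ 1} ≤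
        (m.p : ℝ) ^ 2 * (m.n : ℝ) ^ 2 * (K * Real.exp (-c * τ)) := by
  obtain ⟨L, hL⟩ : ∃ L, L = Real.log B / a := ⟨_, rfl⟩
  have hL0 : 0 ≤ L := by rw [hL]; exact div_nonneg (Real.log_nonneg hB) ha.le
  have hBL : B = Real.exp (a * L) := by
    rw [hL, mul_div_cancel₀ _ ha.ne', Real.exp_log (by linarith)]
  obtain ⟨d, hd⟩ : ∃ d, d = min (1 / 2) (δ / (10 + L)) := ⟨_, rfl⟩
  have hd0 : 0 < d := by rw [hd]; positivity
  have hd1 : d ≤ 1 / 2 := by rw [hd]; exact min_le_left _ _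
  have hdδ : (10 + L) * d ≤ δ := by
    have : d ≤ δ / (10 + L) := by rw [hd]; exact min_le_right _ _
    rwa [le_div_iff₀ (by positivity), mul_comm] at this
  have hsd : 0 < √d := Real.sqrt_pos.2 hd0
  obtain ⟨α, hα⟩ : ∃ α, α = min (a / 2) (√d / (2 * v)) := ⟨_, rfl⟩
  have hα0 : 0 < α := by rw [hα]; positivity
  have hαa : α ≤ a / 2 := by rw [hα]; exact min_le_left _ _
  have hαv : v * α ≤ √d / 2 := by
    have : α ≤ √d / (2 * v) := by rw [hα]; exact min_le_right _ _
    calc v * α ≤ v * (√d / (2 * v)) := by gcongr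
      _ = _ := by field_simp
  obtain ⟨c, hc⟩ : ∃ c, c = min (α * √d / 2) (a * d) := ⟨_, rfl⟩
  have hc0 : 0 < c := by rw [hc]; positivity
  have hc1 : c ≤ α * √d / 2 := by rw [hc]; exact min_le_left _ _
  have hc2 : c ≤ a * d := by rw [hc]; exact min_le_right _ _
  have hca : c ≤ a := hc2.trans (mul_le_of_le_one_right ha.le (by linarith))
  refine ⟨c, hc0, 7 + B, by linarith, fun m hm τ hτ0 hτn => ?_⟩
  -- The last set concerns intervals of length one and is the pointwise event `d τ ≤ env`, written
  -- in the form of the Chernoff bound for the sum. Its probability bound carries the factor `exp (a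
  -- L) = B`; with three two-sided tails and one further Chernoff bound the total is `7 + B`.
  let bad : Fin m.p × Fin m.p → ℕ → ℕ → Set m.Ω := fun q l r =>
    ({ω | d * √(τ * (((r : ℝ) - l) + τ)) ^ 2 < (∑ i ∈ seg l r, m.W i q ω) ^ 2} ∪
    ({ω | d * √(τ * (((r : ℝ) - l) + τ)) ^ 2 < (∑ i ∈ seg l r, m.Z i q.1 ω) ^ 2} ∪
      {ω | d * √(τ * (((r : ℝ) - l) + τ)) ^ 2 < (∑ i ∈ seg l r, m.Z i q.2 ω) ^ 2})) ∪
    ({ω | L * ((r : ℝ) - l) + τ ≤ ∑ i ∈ seg l r, m.env i q ω} ∪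
      {ω | L * ((r : ℝ) - l) + (d * τ - L * ((r : ℝ) - l)) ≤ ∑ i ∈ seg l r, m.env i q ω ∧
        r = l + 1})
  have hbad : ∀ q l r, l < r → r ≤ m.n →
      m.P.real (bad q l r) ≤ (7 + B) * Real.exp (-c * τ) := by
    intro q l r hlr hr
    obtain ⟨k, hk⟩ : ∃ k : ℝ, k = (r : ℝ) - l := ⟨_, rfl⟩
    have hk1 : 1 ≤ k := by
      have : (l : ℝ) + 1 ≤ r := by exact_mod_cast hlr
      linarith
    have hk0 : 0 < k := by linarith
    have hcard : ((seg l r : Finset (Fin m.n)).card : ℝ) = k := by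
      rw [card_seg_cast hlr.le hr, hk]
    -- Enlarging the permitted deviation from `√(τ k)` to `√(τ (k + τ))` keeps the tilt below `a /
    -- 2` while the full exponent `τ` is retained.
    have hη : α * √(τ / (k + τ)) ≤ a / 2 := by
      have : √(τ / (k + τ)) ≤ 1 := by
        exact (Real.sqrt_le_sqrt ((div_le_one (by positivity)).2 (by linarith))).trans_eq
          Real.sqrt_one
      exact (mul_le_of_le_one_right hα0.le this).trans hαa
    have hT : √(τ * (k + τ)) * √(τ / (k + τ)) = τ := by
      rw [← Real.sqrt_mul (by positivity), show τ * (k + τ) * (τ / (k + τ)) = τ * τ by field_simp,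
        Real.sqrt_mul_self hτ0.le]
    have hκ : ((seg l r : Finset (Fin m.n)).card : ℝ) * √(τ / (k + τ)) ^ 2 ≤ τ := by
      rw [hcard, Real.sq_sqrt (by positivity), mul_div_assoc', div_le_iff₀ (by positivity)]
      nlinarith
    have hexp : Real.exp (-(α * √d / 2) * τ) ≤ Real.exp (-c * τ) := by
      rw [Real.exp_le_exp]; linarith [mul_le_mul_of_nonneg_right hc1 hτ0.le]
    have tW := (MGFBound.sum (m.indep_W q) (fun i => m.measurable_W i q) (fun i => hm.mgf_W i q)
      (seg l r)).tail_sq hα0.le hd0.le hαv (Real.sqrt_nonneg _) (Real.sqrt_nonneg _) hη hT hκ hv.le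
    have tZ := fun b => (MGFBound.sum (m.indep_Z b) (fun i => m.measurable_Z i b)
      (fun i => hm.mgf_Z i b (a / 2)) (seg l r)).tail_sq hα0.le hd0.le hαv (Real.sqrt_nonneg _)
      (Real.sqrt_nonneg _) hη hT hκ hv.le
    have tE := tail_sum_of_exp_moment (m.indep_env q) (fun i => m.measurable_env i q) ha
      (fun i => hm.integrable_env i q) (fun i => hm.exp_env i q) hBL.le (seg l r)
    have tE1 : m.P.real {ω | L * k + τ ≤ ∑ i ∈ seg l r, m.env i q ω} ≤ Real.exp (-c * τ) := by
      have := tE τ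
      rw [hcard] at this
      refine this.trans ?_
      rw [Real.exp_le_exp]
      linarith [mul_le_mul_of_nonneg_right hca hτ0.le]
    have tE2 : m.P.real {ω | L * k + (d * τ - L * k) ≤ ∑ i ∈ seg l r, m.env i q ω ∧
        r = l + 1} ≤ B * Real.exp (-c * τ) := by
      by_cases hrl : r = l + 1
      · have hk1' : k = 1 := by rw [hk, hrl]; push_cast; ring
        have := tE (d * τ - L * k)
        rw [hcard] at this
        refine (measureReal_mono fun ω hω => hω.1).trans (this.trans ?_)
        rw [hBL, ← Real.exp_add, Real.exp_le_exp, hk1']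
        linarith [mul_le_mul_of_nonneg_right hc2 hτ0.le]
      · simp only [hrl, and_false, Set.ofPred_false, measureReal_empty]
        have : 0 ≤ B := by linarith
        positivity
    have h1 := measureReal_union_le (μ := m.P)
      ({ω | d * √(τ * (((r : ℝ) - l) + τ)) ^ 2 < (∑ i ∈ seg l r, m.W i q ω) ^ 2} ∪
      ({ω | d * √(τ * (((r : ℝ) - l) + τ)) ^ 2 < (∑ i ∈ seg l r, m.Z i q.1 ω) ^ 2} ∪
      {ω | d * √(τ * (((r : ℝ) - l) + τ)) ^ 2 < (∑ i ∈ seg l r, m.Z i q.2 ω) ^ 2}))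
      ({ω | L * ((r : ℝ) - l) + τ ≤ ∑ i ∈ seg l r, m.env i q ω} ∪
      {ω | L * ((r : ℝ) - l) + (d * τ - L * ((r : ℝ) - l)) ≤ ∑ i ∈ seg l r, m.env i q ω ∧
        r = l + 1})
    refine h1.trans ?_
    rw [← hk]
    clear h1
    have h2 := measureReal_union_le (μ := m.P)
      {ω | d * √(τ * (k + τ)) ^ 2 < (∑ i ∈ seg l r, m.W i q ω) ^ 2}
      ({ω | d * √(τ * (k + τ)) ^ 2 < (∑ i ∈ seg l r, m.Z i q.1 ω) ^ 2} ∪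
      {ω | d * √(τ * (k + τ)) ^ 2 < (∑ i ∈ seg l r, m.Z i q.2 ω) ^ 2})
    have h3 := measureReal_union_le (μ := m.P)
      {ω | d * √(τ * (k + τ)) ^ 2 < (∑ i ∈ seg l r, m.Z i q.1 ω) ^ 2}
      {ω | d * √(τ * (k + τ)) ^ 2 < (∑ i ∈ seg l r, m.Z i q.2 ω) ^ 2}
    have h4 := measureReal_union_le (μ := m.P)
      {ω | L * k + τ ≤ ∑ i ∈ seg l r, m.env i q ω}
      {ω | L * k + (d * τ - L * k) ≤ ∑ i ∈ seg l r, m.env i q ω ∧ r = l + 1}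
    linarith [tZ q.1, tZ q.2]
  refine (measureReal_mono ?_).trans (measureReal_exists_le bad (by positivity) hbad)
  intro ω hω
  by_contra hcon
  apply hω
  intro q
  simp only [Set.mem_ofPred_eq, not_exists, not_and, bad, Set.mem_union, not_or, not_lt, not_le,
    add_sub_cancel] at hcon
  have hpos : ∀ l r : ℕ, l < r → 0 ≤ τ * (((r : ℝ) - l) + τ) := by
    intro l r hlr
    have : 0 ≤ (r : ℝ) - l := by rw [sub_nonneg]; exact_mod_cast hlr.le
    positivity
  obtain ⟨hSB, hb⟩ := m.segBound_of_fine hd0.le hd1 hτ0.le hτn hL0 q ω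
    (fun l r hlr hr => by
      have := (hcon q l r hlr hr).1.1
      rwa [Real.sq_sqrt (hpos l r hlr)] at this)
    (fun l r hlr hr => by
      have := (hcon q l r hlr hr).1.2.1
      rwa [Real.sq_sqrt (hpos l r hlr)] at this)
    (fun l r hlr hr => by
      have := (hcon q l r hlr hr).1.2.2
      rwa [Real.sq_sqrt (hpos l r hlr)] at this)
    (fun i => by
      by_contra! hlt
      refine (hcon q i (i + 1) (by omega) (by omega)).2.2 ?_ rfl
      rw [seg_succ, Finset.sum_singleton]
      exact hlt.le)
    (fun l r hlr hr => ((hcon q l r hlr hr).2.1).le)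
  refine ⟨fun l r hlr hr => ?_, hb⟩
  obtain ⟨h1, h2⟩ := hSB l r hlr hr
  have hk : 0 ≤ τ * ((r : ℝ) - l) + τ ^ 2 := by
    have : 0 ≤ (r : ℝ) - l := by rw [sub_nonneg]; exact_mod_cast hlr
    positivity
  exact ⟨h1.trans (by gcongr), h2.trans (by gcongr)⟩

end events

end ChangePointModel

/-! ### Consequences of the signal size and correctness of the screening. -/

namespace ChangePointModel

variable (m : ChangePointModel.{u})

/-- The smaller of the two sample sizes. -/
noncomputable def side : ℝ := min (m.k₀ : ℝ) ((m.n : ℝ) - m.k₀)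

/-- The natural scale `√τ n^{3/2}` of the contrasts. -/
noncomputable def scale (τ : ℝ) : ℝ := √τ * ((m.n : ℝ) * √(m.n : ℝ))

lemma n_ge_four : (4 : ℝ) ≤ m.n := by exact_mod_cast m.four_le_n

lemma k₀_pos : (0 : ℝ) < m.k₀ := by exact_mod_cast m.one_le_k₀

lemma n_sub_k₀_pos : (0 : ℝ) < (m.n : ℝ) - m.k₀ := by rw [sub_pos]; exact_mod_cast m.k₀_lt_n

lemma side_pos : 0 < m.side := lt_min m.k₀_pos m.n_sub_k₀_pos

lemma two_mul_side_le : 2 * m.side ≤ m.n := by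
  have h1 : m.side ≤ m.k₀ := min_le_left _ _
  have h2 : m.side ≤ (m.n : ℝ) - m.k₀ := min_le_right _ _
  linarith

lemma scale_pos {τ : ℝ} (hτ : 0 < τ) : 0 < m.scale τ := by
  have := m.n_pos
  unfold scale
  positivity

lemma scale_sq {τ : ℝ} (hτ : 0 ≤ τ) : m.scale τ ^ 2 = τ * (m.n : ℝ) ^ 3 := by
  rw [scale, mul_pow, mul_pow, Real.sq_sqrt hτ, Real.sq_sqrt m.n_pos.le]; ring

lemma scale_eq (τ : ℝ) : √(τ / (m.n : ℝ)) * (m.n : ℝ) ^ 2 = m.scale τ := by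
  have hn := m.n_pos
  have h := Real.mul_self_sqrt hn.le
  have hs : √(m.n : ℝ) ≠ 0 := (Real.sqrt_pos.2 hn).ne'
  rw [Real.sqrt_div' _ hn.le, scale]
  field_simp
  rw [Real.sq_sqrt hn.le]

lemma sqrt_mul_n_le_scale (τ : ℝ) : √τ * m.n ≤ m.scale τ := by
  have h : (1 : ℝ) ≤ √(m.n : ℝ) := by
    rw [← Real.sqrt_one]; exact Real.sqrt_le_sqrt (by linarith [m.n_ge_four])
  rw [scale]
  have := m.n_pos
  gcongr
  nlinarith

variable {m}

/-- The maximum in the assumption on `lam` equals `n² / side²`. -/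
lemma SignalSize.le_lam {C τ lam : ℝ} (hC : 0 ≤ C) (h : m.SignalSize C τ lam) :
    C * m.scale τ ≤ lam * m.side ^ 2 := by
  have h1 : C * m.scale τ / m.side ^ 2 ≤ lam := by
    refine le_trans ?_ h.2
    rw [← m.scale_eq, ← mul_assoc, mul_div_assoc]
    gcongr
    rw [side]
    rcases min_choice (m.k₀ : ℝ) ((m.n : ℝ) - m.k₀) with h | h
    · rw [h]; exact le_max_right _ _
    · rw [h]; exact le_max_left _ _
  rwa [div_le_iff₀ (by have := m.side_pos; positivity)] at h1

lemma SignalSize.scale_le {C τ lam : ℝ} (hC : 0 ≤ C) (h : m.SignalSize C τ lam) {b c : Fin m.p}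
    (hbc : m.S₁ b c ≠ m.S₂ b c) : C * m.scale τ ≤ |m.S₁ b c - m.S₂ b c| * m.side ^ 2 :=
  (h.le_lam hC).trans (by have := (h.1 b c hbc).le; gcongr)

variable (m)

lemma exists_ne : ∃ b c, m.S₁ b c ≠ m.S₂ b c := by
  by_contra! h
  exact m.S₁_ne_S₂ (Matrix.ext h)

lemma one_le_p : (1 : ℝ) ≤ m.p := by
  obtain ⟨b, _, _⟩ := m.exists_ne
  exact_mod_cast (by have := b.2; omega : 1 ≤ m.p)

lemma S₁_symm (b c : Fin m.p) : m.S₁ b c = m.S₁ c b := by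
  have hi : ((⟨0, by have := m.four_le_n; omega⟩ : Fin m.n) : ℕ) < m.k₀ := m.one_le_k₀
  rw [← m.cov_before _ hi, ← m.cov_before _ hi, covariance_comm]

lemma S₂_symm (b c : Fin m.p) : m.S₂ b c = m.S₂ c b := by
  have hi : m.k₀ ≤ ((⟨m.k₀, m.k₀_lt_n⟩ : Fin m.n) : ℕ) := le_rfl
  rw [← m.cov_after _ hi, ← m.cov_after _ hi, covariance_comm]

open Classical in
/-- The positions `a ≤ b` at which the covariance matrices differ. -/
noncomputable def changed : Finset (Fin m.p × Fin m.p) :=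
  Finset.univ.filter fun q => q.1 ≤ q.2 ∧ m.S₁ q.1 q.2 ≠ m.S₂ q.1 q.2

lemma mem_changed {q : Fin m.p × Fin m.p} :
    q ∈ m.changed ↔ q.1 ≤ q.2 ∧ m.S₁ q.1 q.2 ≠ m.S₂ q.1 q.2 := by
  simp [changed]

lemma changed_nonempty : m.changed.Nonempty := by
  obtain ⟨b, c, h⟩ := m.exists_ne
  rcases le_total b c with hbc | hbc
  · exact ⟨(b, c), m.mem_changed.2 ⟨hbc, h⟩⟩
  · refine ⟨(c, b), m.mem_changed.2 ⟨hbc, ?_⟩⟩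
    rwa [m.S₁_symm c b, m.S₂_symm c b]

lemma mem_selected {τ : ℝ} {ω : m.Ω} {q : Fin m.p × Fin m.p} :
    q ∈ m.selected τ ω ↔ q.1 ≤ q.2 ∧ τ < m.D q ω := by
  simp [selected]

variable {m}

/-- Some entry differs, yet by at most `2 B`. The required signal size therefore keeps the change
point away from both ends, and `512 B = 2 B · 256` is the source of the constant `C`. -/
lemma SignalSize.side_sq_ge {C τ lam B : ℝ} (hB : 1 ≤ B) (hC : 512 * B ≤ C)
    (h : m.SignalSize C τ lam) (h₁ : ∀ b c, |m.S₁ b c| ≤ B) (h₂ : ∀ b c, |m.S₂ b c| ≤ B) :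
    256 * m.scale τ ≤ m.side ^ 2 := by
  obtain ⟨b, c, hbc⟩ := m.exists_ne
  have h3 := h.scale_le (by linarith) hbc
  have h4 : |m.S₁ b c - m.S₂ b c| ≤ 2 * B := (abs_sub _ _).trans (by linarith [h₁ b c, h₂ b c])
  have h0 : 0 ≤ m.scale τ := by unfold scale; positivity
  have h5 : 512 * B * m.scale τ ≤ 2 * B * m.side ^ 2 :=
    (mul_le_mul_of_nonneg_right hC h0).trans (h3.trans (by gcongr))
  have h6 : 2 * B * (256 * m.scale τ) ≤ 2 * B * m.side ^ 2 := by linarith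
  exact le_of_mul_le_mul_left h6 (by linarith)

/-- A position with equal entries is not selected. -/
lemma D_le_of_eq {δ τ H : ℝ} (hδ : 0 ≤ δ) (hδ' : 36 * δ ≤ 1) (hτ : 0 ≤ τ) (hH0 : 0 ≤ H)
    (hH : H ≤ τ * √(m.n : ℝ)) {q : Fin m.p × Fin m.p} {ω : m.Ω}
    (h : SegBound (fun i => m.noise i q ω) δ τ H) (hq : m.S₁ q.1 q.2 = m.S₂ q.1 q.2) :
    m.D q ω ≤ τ := by
  rw [D_eq_screen]
  refine (screen_le_of_eq (x := m.Zbar q.1 ω * m.Zbar q.2 ω) (s := m.S₁ q.1 q.2) m.four_le_n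
    m.k₀_lt_n.le (fun i => ?_) hδ hH0 hH h).trans ?_
  · rw [T_eq, ← hq]
  · exact mul_le_of_le_one_left hτ hδ'

/-- A position with different entries is selected. -/
lemma lt_D_of_ne {C τ lam B δ H : ℝ} (hB : 1 ≤ B) (hC : 512 * B ≤ C) (hτ : 1 ≤ τ)
    (hs : m.SignalSize C τ lam) (h₁ : ∀ b c, |m.S₁ b c| ≤ B) (h₂ : ∀ b c, |m.S₂ b c| ≤ B)
    (hδ : 0 ≤ δ) (hδ' : 108 * δ ≤ 1) (hH0 : 0 ≤ H) (hH : H ≤ τ * √(m.n : ℝ))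
    {q : Fin m.p × Fin m.p} {ω : m.Ω} (h : SegBound (fun i => m.noise i q ω) δ τ H)
    (hq : m.S₁ q.1 q.2 ≠ m.S₂ q.1 q.2) : τ < m.D q ω := by
  have hn := m.n_ge_four
  have hn0 := m.n_pos
  have hd := m.side_pos
  have hd2 := m.two_mul_side_le
  have hside := hs.side_sq_ge hB hC h₁ h₂
  have hsτ : 1 ≤ √τ := by rw [← Real.sqrt_one]; exact Real.sqrt_le_sqrt hτ
  have hsc : (m.n : ℝ) ≤ m.scale τ :=
    (le_mul_of_one_le_left hn0.le hsτ).trans (m.sqrt_mul_n_le_scale τ)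
  have hd4 : 4 ≤ m.side := by nlinarith
  have hge := screen_ge (x := m.Zbar q.1 ω * m.Zbar q.2 ω) m.four_le_n m.k₀_lt_n.le
    (fun i => m.T_eq i q ω) hδ hH0 hH h hd4 (min_le_left _ _) (min_le_right _ _)
  rw [← D_eq_screen] at hge
  have hΔ := hs.scale_le (by linarith) hq
  rw [← sq_abs] at hge
  set x := |m.S₁ q.1 q.2 - m.S₂ q.1 q.2|
  set d := m.side
  have e0 : m.scale τ ≤ x * d ^ 2 / 512 := by
    rw [le_div_iff₀ (by norm_num)]
    nlinarith [m.scale_pos (by linarith : 0 < τ)]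
  have e1 : τ * (m.n : ℝ) ^ 3 ≤ (x * d ^ 2 / 512) ^ 2 := by
    rw [← m.scale_sq (by linarith)]
    have := (m.scale_pos (by linarith : 0 < τ)).le
    gcongr
  -- Two of the four powers of `d` are traded for `(n / 2)²`.
  have e2 : (x * d ^ 2 / 512) ^ 2 ≤ x ^ 2 * d ^ 2 / 512 ^ 2 * ((m.n : ℝ) / 2) ^ 2 := by
    have : d ^ 2 ≤ ((m.n : ℝ) / 2) ^ 2 := by gcongr; linarith
    calc (x * d ^ 2 / 512) ^ 2 = x ^ 2 * d ^ 2 / 512 ^ 2 * d ^ 2 := by ring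
      _ ≤ _ := by gcongr
  have e3 : τ * (m.n : ℝ) ≤ x ^ 2 * d ^ 2 / 1024 ^ 2 := by
    have : (τ * (m.n : ℝ)) * (m.n : ℝ) ^ 2 ≤ x ^ 2 * d ^ 2 / 1024 ^ 2 * (m.n : ℝ) ^ 2 := by
      calc _ = τ * (m.n : ℝ) ^ 3 := by ring
        _ ≤ _ := e1.trans e2
        _ = _ := by ring
    exact le_of_mul_le_mul_right this (by positivity)
  -- The leading term `x² d² / (32 n)` is split into halves: one absorbs the loss `2 x²`, the other
  -- exceeds the threshold together with the noise, which is at most `2 τ`.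
  have e4 : 4 * τ ≤ x ^ 2 * (d ^ 2 / (64 * m.n)) := by
    rw [mul_div_assoc', le_div_iff₀ (by positivity)]
    nlinarith [mul_nonneg (sq_nonneg x) (sq_nonneg d)]
  have e5 : 2 ≤ d ^ 2 / (64 * m.n) := by
    rw [le_div_iff₀ (by positivity)]; nlinarith
  have e6 : d ^ 2 / (32 * m.n) = d ^ 2 / (64 * m.n) + d ^ 2 / (64 * m.n) := by field_simp; norm_num
  rw [e6] at hge
  nlinarith [mul_le_mul_of_nonneg_left e5 (sq_nonneg x)]

lemma selected_eq_changed {C τ lam B δ H : ℝ} (hB : 1 ≤ B) (hC : 512 * B ≤ C) (hτ : 1 ≤ τ)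
    (hs : m.SignalSize C τ lam) (h₁ : ∀ b c, |m.S₁ b c| ≤ B) (h₂ : ∀ b c, |m.S₂ b c| ≤ B)
    (hδ : 0 ≤ δ) (hδ' : 108 * δ ≤ 1) (hH0 : 0 ≤ H) (hH : H ≤ τ * √(m.n : ℝ))
    {ω : m.Ω} (h : ∀ q, SegBound (fun i => m.noise i q ω) δ τ H) :
    m.selected τ ω = m.changed := by
  ext q
  rw [mem_selected, mem_changed]
  refine and_congr_right fun _ => ⟨fun hD heq => ?_, fun hne => ?_⟩
  · exact absurd hD (not_lt.2 (D_le_of_eq hδ (by linarith) (by linarith) hH0 hH (h q) heq))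
  · exact lt_D_of_ne hB hC hτ hs h₁ h₂ hδ hδ' hH0 hH (h q) hne

variable (m)

/-- Small thresholds make an exponential bound trivial. -/
lemma prob_le_of_bound {x K c τ τ₀ : ℝ} (hx : x ≤ 1) (hK : 0 ≤ K) (hc : 0 ≤ c)
    (h : τ₀ ≤ τ → x ≤ (m.p : ℝ) ^ 2 * (m.n : ℝ) ^ 2 * (K * Real.exp (-c * √τ))) :
    x ≤ (K + Real.exp (c * √τ₀)) * (m.p : ℝ) ^ 2 * (m.n : ℝ) *
      ((m.n : ℝ) * Real.exp (-c * √τ)) := by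
  have hp := m.one_le_p
  have hn := m.n_ge_four
  have e : (K + Real.exp (c * √τ₀)) * (m.p : ℝ) ^ 2 * (m.n : ℝ) *
      ((m.n : ℝ) * Real.exp (-c * √τ)) =
      (m.p : ℝ) ^ 2 * (m.n : ℝ) ^ 2 * (K * Real.exp (-c * √τ)) +
      (m.p : ℝ) ^ 2 * (m.n : ℝ) ^ 2 * (Real.exp (c * √τ₀) * Real.exp (-c * √τ)) := by ring
  rw [e]
  rcases le_total τ₀ τ with h0 | h0
  · have := h h0
    have : 0 ≤ (m.p : ℝ) ^ 2 * (m.n : ℝ) ^ 2 * (Real.exp (c * √τ₀) * Real.exp (-c * √τ)) := by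
      positivity
    linarith
  · have h1 : 1 ≤ Real.exp (c * √τ₀) * Real.exp (-c * √τ) := by
      rw [← Real.exp_add]
      refine Real.one_le_exp ?_
      have := mul_le_mul_of_nonneg_left (Real.sqrt_le_sqrt h0) hc
      linarith
    have h2 : 1 ≤ (m.p : ℝ) ^ 2 * (m.n : ℝ) ^ 2 :=
      one_le_mul_of_one_le_of_one_le (one_le_pow₀ hp) (one_le_pow₀ (by linarith))
    have h3 : 0 ≤ (m.p : ℝ) ^ 2 * (m.n : ℝ) ^ 2 * (K * Real.exp (-c * √τ)) := by positivity
    have h4 := one_le_mul_of_one_le_of_one_le h2 h1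
    linarith

end ChangePointModel

/-! ### Consequences of the growth condition along a sequence. -/

section limits

variable {c : ℝ} {m : ℕ → ChangePointModel.{u}} {τ : ℕ → ℝ}

lemma GrowthCondition.tendsto_threshold (hc : 0 < c)
    (hn : Tendsto (fun s => (m s).n) atTop atTop) (h : GrowthCondition c m τ) :
    Tendsto τ atTop atTop := by
  have hn' : Tendsto (fun s => ((m s).n : ℝ)) atTop atTop := tendsto_natCast_atTop_atTop.comp hn
  have hlog : Tendsto (fun s => Real.log ((m s).n : ℝ) / c) atTop atTop :=
    (Real.tendsto_log_atTop.comp hn').atTop_div_const hc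
  refine tendsto_atTop_mono' _ ?_ hlog
  -- Once `p n exp (-c τ) < 1`, the inequality `p ≥ 1` forces `τ ≥ log n / c`.
  filter_upwards [h.2.2.eventually_lt_const zero_lt_one] with s hs
  have hp := (m s).one_le_p
  have hn0 := (m s).n_pos
  rw [div_le_iff₀ hc, Real.log_le_iff_le_exp hn0]
  have h1 : ((m s).n : ℝ) * Real.exp (-c * τ s) ≤ 1 := by
    refine le_trans ?_ hs.le
    have := Real.exp_pos (-c * τ s)
    gcongr
    nlinarith
  have h2 : Real.exp (τ s * c) = (Real.exp (-c * τ s))⁻¹ := by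
    rw [← Real.exp_neg]; ring_nf
  rw [h2, ← one_div, le_div_iff₀ (Real.exp_pos _)]
  exact h1

/-- This is the square of the growth condition, hence the rate `2 c`. -/
lemma GrowthCondition.tendsto_fine (h : GrowthCondition c m τ) (K : ℝ) :
    Tendsto (fun s => ((m s).p : ℝ) ^ 2 * ((m s).n : ℝ) ^ 2 * (K * Real.exp (-(2 * c) * τ s)))
      atTop (𝓝 0) := by
  have := (h.2.2.mul h.2.2).const_mul K
  rw [mul_zero, mul_zero] at this
  refine this.congr fun s => ?_
  have e : Real.exp (-(2 * c) * τ s) = Real.exp (-c * τ s) * Real.exp (-c * τ s) := by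
    rw [← Real.exp_add]; ring_nf
  rw [e]; ring

/-- In terms of `x = n^{1/4}` the polynomial factor is eventually at most `x ^ (8 κ + 8)`, and it
loses against `exp (-b x)`. -/
lemma GrowthCondition.tendsto_crude (hn : Tendsto (fun s => (m s).n) atTop atTop)
    (h : GrowthCondition c m τ) {b : ℝ} (hb : 0 < b) (K : ℝ) :
    Tendsto (fun s => ((m s).p : ℝ) ^ 2 * ((m s).n : ℝ) ^ 2 *
      (K * Real.exp (-b * √√((m s).n : ℝ)))) atTop (𝓝 0) := by
  obtain ⟨κ, hκ, hp⟩ := h.2.1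
  have hn' : Tendsto (fun s => ((m s).n : ℝ)) atTop atTop := tendsto_natCast_atTop_atTop.comp hn
  have hx : Tendsto (fun s => √√((m s).n : ℝ)) atTop atTop :=
    Real.tendsto_sqrt_atTop.comp (Real.tendsto_sqrt_atTop.comp hn')
  have h1 := ((tendsto_rpow_mul_exp_neg_mul_atTop_nhds_zero (8 * κ + 8) b hb).comp hx).const_mul |K|
  rw [mul_zero] at h1
  refine squeeze_zero_norm' ?_ h1
  filter_upwards [hp.eventually_lt_const zero_lt_one] with s hs
  have hn0 := (m s).n_pos
  have hpn : ((m s).p : ℝ) ≤ ((m s).n : ℝ) ^ κ := by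
    rw [Real.rpow_neg hn0.le, ← div_eq_mul_inv, div_lt_one (by positivity)] at hs
    exact hs.le
  have hn4 : ((m s).n : ℝ) = √√((m s).n : ℝ) ^ (4 : ℝ) := by
    rw [show (4 : ℝ) = ((4 : ℕ) : ℝ) by norm_num, Real.rpow_natCast,
      show 4 = 2 * 2 by norm_num, pow_mul, Real.sq_sqrt (Real.sqrt_nonneg _), Real.sq_sqrt hn0.le]
  have e : (((m s).n : ℝ) ^ κ) ^ 2 * ((m s).n : ℝ) ^ 2 = √√((m s).n : ℝ) ^ (8 * κ + 8) := by
    have hy : 0 ≤ √√((m s).n : ℝ) := Real.sqrt_nonneg _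
    calc (((m s).n : ℝ) ^ κ) ^ 2 * ((m s).n : ℝ) ^ 2 = ((m s).n : ℝ) ^ (2 * κ + 2) := by
          rw [← Real.rpow_natCast, ← Real.rpow_natCast, ← Real.rpow_mul hn0.le,
            ← Real.rpow_add hn0]
          congr 1; push_cast; ring
      _ = _ := by
          nth_rewrite 1 [hn4]
          rw [← Real.rpow_mul hy]
          congr 1; ring
  simp only [Function.comp_apply]
  rw [Real.norm_eq_abs, abs_mul, abs_mul K,
    abs_of_nonneg (by positivity : (0 : ℝ) ≤ ((m s).p : ℝ) ^ 2 * ((m s).n : ℝ) ^ 2),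
    abs_of_pos (Real.exp_pos _), ← e]
  calc ((m s).p : ℝ) ^ 2 * ((m s).n : ℝ) ^ 2 * (|K| * Real.exp (-b * √√((m s).n : ℝ)))
      ≤ (((m s).n : ℝ) ^ κ) ^ 2 * ((m s).n : ℝ) ^ 2 * (|K| * Real.exp (-b * √√((m s).n : ℝ))) := by
        gcongr
    _ = _ := by ring

end limits

/-- Combination of the bounds for moderate and for large thresholds. -/
lemma GrowthCondition.tendsto_of_regimes {c : ℝ} {m : ℕ → ChangePointModel.{u}} {τ : ℕ → ℝ}
    (hn : Tendsto (fun s => (m s).n) atTop atTop) (h : GrowthCondition c m τ) {b K K' : ℝ}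
    (hb : 0 < b) (hK : 0 ≤ K) (hK' : 0 ≤ K') {f g : ℕ → ℝ} (hf : ∀ s, 0 ≤ f s) (hg0 : ∀ s, 0 ≤ g s)
    (hg : Tendsto g atTop (𝓝 0))
    (h₁ : ∀ᶠ s in atTop, τ s ≤ √((m s).n : ℝ) → f s ≤
      ((m s).p : ℝ) ^ 2 * ((m s).n : ℝ) ^ 2 * (K * Real.exp (-(2 * c) * τ s)) + g s)
    (h₂ : ∀ᶠ s in atTop, √((m s).n : ℝ) ≤ τ s → f s ≤
      ((m s).p : ℝ) ^ 2 * ((m s).n : ℝ) ^ 2 * (K' * Real.exp (-b * √(τ s)))) :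
    Tendsto f atTop (𝓝 0) := by
  have h3 := ((h.tendsto_fine K).add (h.tendsto_crude hn hb K')).add hg
  rw [add_zero, add_zero] at h3
  refine squeeze_zero' (Eventually.of_forall hf) ?_ h3
  filter_upwards [h₁, h₂] with s a₁ a₂
  have p1 : 0 ≤ ((m s).p : ℝ) ^ 2 * ((m s).n : ℝ) ^ 2 * (K * Real.exp (-(2 * c) * τ s)) := by
    positivity
  have p2 : 0 ≤ ((m s).p : ℝ) ^ 2 * ((m s).n : ℝ) ^ 2 *
      (K' * Real.exp (-b * √√((m s).n : ℝ))) := by positivity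
  rcases le_total (τ s) √((m s).n : ℝ) with hc | hc
  · linarith [a₁ hc]
  · have h4 : ((m s).p : ℝ) ^ 2 * ((m s).n : ℝ) ^ 2 * (K' * Real.exp (-b * √(τ s))) ≤
        ((m s).p : ℝ) ^ 2 * ((m s).n : ℝ) ^ 2 * (K' * Real.exp (-b * √√((m s).n : ℝ))) := by
      have := mul_le_mul_of_nonneg_left (Real.sqrt_le_sqrt hc) hb.le
      have h5 : Real.exp (-b * √(τ s)) ≤ Real.exp (-b * √√((m s).n : ℝ)) := by
        rw [Real.exp_le_exp]; linarith
      gcongr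
    linarith [a₂ hc, hg0 s]

/-! ### Screening events and the estimator under uniformly small noise. -/

namespace ChangePointModel

lemma sq_le_mul_sqrt {m : ChangePointModel.{u}} {τ : ℝ} (hτ : 0 ≤ τ) (h : τ ≤ √(m.n : ℝ)) :
    τ ^ 2 ≤ τ * √(m.n : ℝ) := by
  rw [sq]; gcongr

lemma sqrt_n_le (m : ChangePointModel.{u}) : √(m.n : ℝ) ≤ m.n := by
  rw [Real.sqrt_le_left m.n_pos.le]
  nlinarith [m.n_ge_four]

lemma one_sub_le_measureReal {m : ChangePointModel.{u}} {A B : Set m.Ω} (h : ∀ ω, ω ∉ B → ω ∈ A) :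
    1 - m.P.real B ≤ m.P.real A := by
  have h1 : (Set.univ : Set m.Ω) ⊆ A ∪ B := fun ω _ => by
    by_cases hω : ω ∈ B
    · exact Or.inr hω
    · exact Or.inl (h ω hω)
  have h2 := (measureReal_mono (μ := m.P) h1).trans (measureReal_union_le A B)
  rw [probReal_univ] at h2
  linarith

lemma null_event_eq (m : ChangePointModel.{u}) (τ : ℝ) :
    (⋃ q ∈ m.equalEntries, {ω | τ < m.D q ω}) =
      {ω | (m.equalEntries ∩ (m.selected τ ω : Set _)).Nonempty} := by
  ext ω
  simp only [Set.mem_iUnion, Set.mem_ofPred_eq, exists_prop, Set.Nonempty, Set.mem_inter_iff,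
    Finset.mem_coe, mem_selected]
  exact exists_congr fun q => and_congr_right fun hq => by simp [hq.1]

lemma signal_event_eq (m : ChangePointModel.{u}) (τ lam : ℝ) :
    (⋂ q ∈ m.largeEntries lam, {ω | τ < m.D q ω}) =
      {ω | m.largeEntries lam ⊆ (m.selected τ ω : Set _)} := by
  ext ω
  simp only [Set.mem_iInter, Set.mem_ofPred_eq, Set.subset_def, Finset.mem_coe, mem_selected]
  exact forall_congr' fun q => forall_congr' fun hq => by simp [hq.1]

lemma null_event_subset {m : ChangePointModel.{u}} {δ τ H : ℝ} (hδ : 0 ≤ δ) (hδ' : 36 * δ ≤ 1)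
    (hτ : 0 ≤ τ) (hH0 : 0 ≤ H) (hH : H ≤ τ * √(m.n : ℝ)) :
    (⋃ q ∈ m.equalEntries, {ω | τ < m.D q ω}) ⊆
      {ω | ¬ ∀ q, SegBound (fun i => m.noise i q ω) δ τ H} := by
  intro ω hω hall
  simp only [Set.mem_iUnion, Set.mem_ofPred_eq, exists_prop] at hω
  obtain ⟨q, hq, hD⟩ := hω
  exact absurd hD (not_lt.2 (D_le_of_eq hδ hδ' hτ hH0 hH (hall q) hq.2))

lemma mem_signal_event {m : ChangePointModel.{u}} {C τ lam B δ H : ℝ} (hB : 1 ≤ B)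
    (hC : 512 * B ≤ C) (hτ : 1 ≤ τ) (hs : m.SignalSize C τ lam) (h₁ : ∀ b c, |m.S₁ b c| ≤ B)
    (h₂ : ∀ b c, |m.S₂ b c| ≤ B) (hδ : 0 ≤ δ) (hδ' : 108 * δ ≤ 1) (hH0 : 0 ≤ H)
    (hH : H ≤ τ * √(m.n : ℝ)) {ω : m.Ω}
    (h : ω ∉ {ω | ¬ ∀ q, SegBound (fun i => m.noise i q ω) δ τ H}) :
    ω ∈ ⋂ q ∈ m.largeEntries lam, {ω | τ < m.D q ω} := by
  simp only [Set.mem_ofPred_eq, not_not] at h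
  simp only [Set.mem_iInter, Set.mem_ofPred_eq]
  intro q hq
  refine lt_D_of_ne hB hC hτ hs h₁ h₂ hδ hδ' hH0 hH (h q) fun heq => ?_
  have h3 : 0 ≤ lam * m.side ^ 2 := le_trans
    (mul_nonneg (by linarith) (m.scale_pos (by linarith)).le) (hs.le_lam (by linarith))
  have h4 : 0 ≤ lam := nonneg_of_mul_nonneg_left h3 (by have := m.side_pos; positivity)
  have h5 := hq.2
  rw [heq, sub_self, abs_zero] at h5
  linarith

/-- The contrast of the noise is small compared with its scale. -/
lemma abs_contrast_le {n : ℕ} {y : Fin n → ℝ} {X : ℝ}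
    (h : ∀ k ≤ n, |∑ i ∈ seg 0 k, y i| ≤ X) {j : ℕ} (hj : j ≤ n) :
    |contrast y j| ≤ 2 * n * X := by
  have h1 := h j hj
  have h2 := h n le_rfl
  rw [seg_zero_self] at h2
  have hjn : (j : ℝ) ≤ n := by exact_mod_cast hj
  have hX : 0 ≤ X := (abs_nonneg _).trans h1
  rw [contrast]
  refine (abs_sub _ _).trans ?_
  rw [abs_mul, abs_mul, Nat.abs_cast, Nat.abs_cast]
  have e1 : (n : ℝ) * |∑ i ∈ seg 0 j, y i| ≤ n * X := by gcongr
  have e2 : (j : ℝ) * |∑ i, y i| ≤ n * X := by gcongr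
  linarith

lemma _root_.SegBound.abs_sum_le {n : ℕ} {y : Fin n → ℝ} {δ τ H : ℝ} (hδ : 0 ≤ δ) (hτ : 0 ≤ τ)
    (h : SegBound y δ τ H) {k : ℕ} (hk : k ≤ n) :
    |∑ i ∈ seg 0 k, y i| ≤ √(δ * (τ * n + H)) := by
  refine Real.abs_le_sqrt ((h.prefix hk).1.trans ?_)
  gcongr

variable {m : ChangePointModel.{u}}

/-- The peak is `k₀ (n - k₀)`, so the claim reduces to `side² n / 2 ≤ k₀² (n - k₀)`. The extra
factor `k₀` compensates the `k₀ / n` in the drop of the tent. -/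
lemma SignalSize.tent_ge {C τ lam : ℝ} (hC : 0 ≤ C) (h : m.SignalSize C τ lam)
    {b c : Fin m.p} (hbc : m.S₁ b c ≠ m.S₂ b c) :
    C * m.scale τ * m.n / 2 ≤ m.k₀ * (|m.S₁ b c - m.S₂ b c| * tent m.n m.k₀ m.k₀) := by
  have h1 := h.scale_le hC hbc
  have hk := m.k₀_pos
  have hN := m.n_sub_k₀_pos
  have hd := m.side_pos
  have hd1 : m.side ≤ m.k₀ := min_le_left _ _
  have hd2 : m.side ≤ (m.n : ℝ) - m.k₀ := min_le_right _ _
  rw [tent_of_le le_rfl]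
  have key : m.side ^ 2 * (m.n / 2) ≤ (m.k₀ : ℝ) ^ 2 * ((m.n : ℝ) - m.k₀) := by
    rcases le_total (2 * (m.k₀ : ℝ)) m.n with hc | hc
    · calc _ ≤ (m.k₀ : ℝ) ^ 2 * (m.n / 2) := by
            have := m.n_pos
            gcongr
        _ ≤ _ := by gcongr; linarith
    · have e1 : m.side * (m.n / 2) ≤ (m.k₀ : ℝ) ^ 2 := by
        have : m.side ≤ m.k₀ := hd1
        have := m.n_pos
        calc m.side * (m.n / 2) ≤ m.k₀ * m.k₀ := by gcongr; linarith
          _ = _ := (sq _).symm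
      calc m.side ^ 2 * (m.n / 2) = (m.side * (m.n / 2)) * m.side := by ring
        _ ≤ _ := by gcongr
  calc C * m.scale τ * m.n / 2 = C * m.scale τ * (m.n / 2) := by ring
    _ ≤ |m.S₁ b c - m.S₂ b c| * m.side ^ 2 * (m.n / 2) := by
        have := m.n_pos
        gcongr
    _ = |m.S₁ b c - m.S₂ b c| * (m.side ^ 2 * (m.n / 2)) := by ring
    _ ≤ |m.S₁ b c - m.S₂ b c| * ((m.k₀ : ℝ) ^ 2 * ((m.n : ℝ) - m.k₀)) := by gcongr
    _ = _ := by ring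

lemma SignalSize.half_scale_le {C τ lam : ℝ} (hC : 0 ≤ C) (h : m.SignalSize C τ lam)
    {b c : Fin m.p} (hbc : m.S₁ b c ≠ m.S₂ b c) :
    C * m.scale τ / 2 ≤ |m.S₁ b c - m.S₂ b c| * tent m.n m.k₀ m.k₀ := by
  have h1 := h.tent_ge hC hbc
  have h2 : (m.k₀ : ℝ) ≤ m.n := by exact_mod_cast m.k₀_lt_n.le
  have h3 : 0 ≤ |m.S₁ b c - m.S₂ b c| * tent m.n m.k₀ m.k₀ :=
    mul_nonneg (abs_nonneg _) (tent_nonneg m.k₀_lt_n.le m.k₀_lt_n.le)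
  have h4 : C * m.scale τ / 2 * m.n ≤ |m.S₁ b c - m.S₂ b c| * tent m.n m.k₀ m.k₀ * m.n := by
    nlinarith [mul_le_mul_of_nonneg_right h2 h3]
  exact le_of_mul_le_mul_right h4 m.n_pos

/-- The signal dominates its scale linearly. -/
lemma SignalSize.signal_ge {C τ lam ε : ℝ} (hC : 0 ≤ C) (hε : 0 < ε)
    (h : m.SignalSize C τ lam) {b c : Fin m.p} (hbc : m.S₁ b c ≠ m.S₂ b c) :
    ε * C * m.scale τ / 4 * (|m.S₁ b c - m.S₂ b c| * tent m.n m.k₀ m.k₀) ≤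
      ε * m.k₀ / (2 * m.n) * ((m.S₁ b c - m.S₂ b c) ^ 2 * tent m.n m.k₀ m.k₀ ^ 2) := by
  have h1 := h.tent_ge hC hbc
  have hn := m.n_pos
  have h3 : 0 ≤ |m.S₁ b c - m.S₂ b c| * tent m.n m.k₀ m.k₀ :=
    mul_nonneg (abs_nonneg _) (tent_nonneg m.k₀_lt_n.le m.k₀_lt_n.le)
  rw [← mul_pow, ← sq_abs (_ * _), abs_mul,
    abs_of_nonneg (tent_nonneg m.k₀_lt_n.le m.k₀_lt_n.le : 0 ≤ tent m.n m.k₀ m.k₀)]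
  set x := |m.S₁ b c - m.S₂ b c| * tent m.n m.k₀ m.k₀
  rw [div_mul_eq_mul_div, div_mul_eq_mul_div, div_le_div_iff₀ (by norm_num) (by positivity)]
  have := mul_le_mul_of_nonneg_left h1 (by positivity : 0 ≤ ε * x)
  nlinarith

lemma size_le {ε τ : ℝ} (hε : 0 < ε) (hτ : 16 / ε ≤ √τ)
    (h : 256 * m.scale τ ≤ m.side ^ 2) :
    4 * (1 / (m.k₀ : ℝ) + 1 / ((m.n : ℝ) - m.k₀)) ≤ ε * m.k₀ / (2 * m.n) := by
  have hn := m.n_pos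
  have hd := m.side_pos
  have hk := m.k₀_pos
  have hN := m.n_sub_k₀_pos
  have hd1 : m.side ≤ m.k₀ := min_le_left _ _
  have hd2 : m.side ≤ (m.n : ℝ) - m.k₀ := min_le_right _ _
  have e1 : 16 / ε * m.n ≤ m.side ^ 2 := by
    calc 16 / ε * m.n ≤ √τ * m.n := by gcongr
      _ ≤ m.scale τ := m.sqrt_mul_n_le_scale τ
      _ ≤ 256 * m.scale τ := by
        have : 0 ≤ m.scale τ := by unfold scale; positivity
        linarith
      _ ≤ _ := h
  have e2 : 16 * m.n ≤ ε * m.side ^ 2 := by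
    rw [div_mul_eq_mul_div, div_le_iff₀ hε] at e1; linarith
  calc 4 * (1 / (m.k₀ : ℝ) + 1 / ((m.n : ℝ) - m.k₀)) ≤ 4 * (1 / m.side + 1 / m.side) := by gcongr
    _ = 8 / m.side := by ring
    _ ≤ ε * m.side / (2 * m.n) := by
      rw [div_le_div_iff₀ hd (by positivity)]; nlinarith
    _ ≤ _ := by gcongr

/-- The estimator is close to the change point whenever the noise is dominated by the signal. -/
lemma estimator_close {τ ε : ℝ} {khat : m.Ω → ℕ} (hest : m.IsEstimator τ khat) (hε : 0 < ε)
    {ω : m.Ω} (hsel : m.selected τ ω = m.changed)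
    (hsize : 4 * (1 / (m.k₀ : ℝ) + 1 / ((m.n : ℝ) - m.k₀)) ≤ ε * m.k₀ / (2 * m.n))
    {M : Fin m.p × Fin m.p → ℝ}
    (hM : ∀ q ∈ m.changed, ∀ j ≤ m.n, |contrast (fun i => m.noise i q ω) j| ≤ M q)
    (hS : ∀ q ∈ m.changed, ∀ j ≤ m.n, |contrast (fun i => m.noise i q ω) j| ≤
      |m.S₁ q.1 q.2 - m.S₂ q.1 q.2| * tent m.n m.k₀ m.k₀)
    (hlt : ∑ q ∈ m.changed, (5 * (|m.S₁ q.1 q.2 - m.S₂ q.1 q.2| * tent m.n m.k₀ m.k₀) * M q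
        + (m.n : ℝ) ^ 2 * ∑ i, m.noise i q ω ^ 2) <
      ε * m.k₀ / (2 * m.n) * ∑ q ∈ m.changed,
        (m.S₁ q.1 q.2 - m.S₂ q.1 q.2) ^ 2 * tent m.n m.k₀ m.k₀ ^ 2) :
    ¬ ε ≤ |(khat ω : ℝ) / (m.k₀ : ℝ) - 1| := by
  intro hfar
  obtain ⟨hk, hmax⟩ := hest ω
  rw [Finset.mem_Icc] at hk
  have hk₀ := m.k₀_pos
  have hfar' : ε * m.k₀ ≤ |(khat ω : ℝ) - m.k₀| := by
    have e : (khat ω : ℝ) - m.k₀ = ((khat ω : ℝ) / m.k₀ - 1) * m.k₀ := by field_simp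
    rw [e, abs_mul, abs_of_pos hk₀]
    gcongr
  have hle := hmax m.k₀ (Finset.mem_Icc.2 ⟨m.one_le_k₀, m.k₀_lt_n.le⟩)
  have hlt' := sum_quadStat_lt (s₁ := fun q : Fin m.p × Fin m.p => m.S₁ q.1 q.2)
    (s₂ := fun q => m.S₂ q.1 q.2) (x := fun q => m.Zbar q.1 ω * m.Zbar q.2 ω)
    (t := fun q i => m.T i ω q) (y := fun q i => m.noise i q ω) m.one_le_k₀ m.k₀_lt_n hk.1 hk.2
    m.changed (fun q i => m.T_eq i q ω) hε hfar' hsize hM hS hlt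
  rw [U_eq_sum, U_eq_sum, hsel] at hle
  have hn := m.n_pos
  have : (0 : ℝ) < 1 / (m.n : ℝ) ^ 4 := by positivity
  exact absurd (le_of_mul_le_mul_left hle this) (not_le.2 hlt')

lemma contrast_le_signal {C τ lam δ H : ℝ} (hC : 8 ≤ C) (hτ : 0 < τ) (hδ : 0 ≤ δ)
    (hδ' : 108 * δ ≤ 1) (h : m.SignalSize C τ lam) (hH : H ≤ τ * √(m.n : ℝ))
    {q : Fin m.p × Fin m.p} (hq : m.S₁ q.1 q.2 ≠ m.S₂ q.1 q.2) {ω : m.Ω}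
    (hs : SegBound (fun i => m.noise i q ω) δ τ H) {j : ℕ} (hj : j ≤ m.n) :
    |contrast (fun i => m.noise i q ω) j| ≤
      |m.S₁ q.1 q.2 - m.S₂ q.1 q.2| * tent m.n m.k₀ m.k₀ := by
  refine (abs_contrast_le (fun k hk => hs.abs_sum_le hδ hτ.le hk) hj).trans ?_
  refine le_trans ?_ (h.half_scale_le (by linarith) hq)
  have hn := m.n_pos
  have h1 : √(δ * (τ * m.n + H)) ≤ √τ * √(m.n : ℝ) := by
    rw [← Real.sqrt_mul hτ.le]
    refine Real.sqrt_le_sqrt ?_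
    have h2 : τ * m.n + H ≤ 2 * (τ * m.n) := by
      have := mul_le_mul_of_nonneg_left m.sqrt_n_le hτ.le
      linarith
    have h3 : 0 ≤ τ * m.n := by positivity
    calc δ * (τ * m.n + H) ≤ δ * (2 * (τ * m.n)) := by gcongr
      _ ≤ _ := by nlinarith
  calc 2 * m.n * √(δ * (τ * m.n + H)) ≤ 2 * m.n * (√τ * √(m.n : ℝ)) := by gcongr
    _ = 2 * m.scale τ := by rw [scale]; ring
    _ ≤ _ := by
      have := m.scale_pos hτ
      nlinarith

/-- Uniform smallness of the noise makes the estimator close to the change point. -/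
lemma estimator_close_of_segBound {C τ lam B δ ε : ℝ} {khat : m.Ω → ℕ} (hB : 1 ≤ B)
    (hC : 512 * B ≤ C) (hε : 0 < ε) (hτ : 1 ≤ τ) (hτε : 16 / ε ≤ √τ)
    (hs : m.SignalSize C τ lam) (h₁ : ∀ b c, |m.S₁ b c| ≤ B) (h₂ : ∀ b c, |m.S₂ b c| ≤ B)
    (hδ : 0 < δ) (hδ' : 108 * δ ≤ 1) (hδ₁ : δ ≤ ε) (hδ₂ : 100 * δ ≤ ε ^ 2)
    (hest : m.IsEstimator τ khat) {ω : m.Ω}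
    (h : ∀ q, SegBound (fun i => m.noise i q ω) δ τ 0) :
    ¬ ε ≤ |(khat ω : ℝ) / (m.k₀ : ℝ) - 1| := by
  have hn := m.n_pos
  have hτ0 : 0 < τ := by linarith
  have hC8 : 8 ≤ C := by linarith
  have hH : (0 : ℝ) ≤ τ * √(m.n : ℝ) := by positivity
  have hρ := m.scale_pos hτ0
  refine estimator_close hest hε
    (selected_eq_changed hB hC hτ hs h₁ h₂ hδ.le hδ' le_rfl hH h)
    (size_le hε hτε (hs.side_sq_ge hB hC h₁ h₂))
    (M := fun _ => 2 * m.n * √(δ * (τ * m.n + 0)))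
    (fun q _ j hj => abs_contrast_le (fun k hk => (h q).abs_sum_le hδ.le hτ0.le hk) hj)
    (fun q hq j hj => contrast_le_signal hC8 hτ0 hδ.le hδ' hs hH (m.mem_changed.1 hq).2 (h q) hj) ?_
  rw [Finset.mul_sum]
  refine Finset.sum_lt_sum_of_nonempty m.changed_nonempty fun q hq => ?_
  have hne := (m.mem_changed.1 hq).2
  refine lt_of_lt_of_le ?_ (hs.signal_ge (by linarith) hε hne)
  have hx := hs.half_scale_le (by linarith) hne
  set x := |m.S₁ q.1 q.2 - m.S₂ q.1 q.2| * tent m.n m.k₀ m.k₀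
  have hQ := ((h q).prefix le_rfl).2
  rw [seg_zero_self, add_zero] at hQ
  have hM : 2 * m.n * √(δ * (τ * m.n + 0)) = 2 * √δ * m.scale τ := by
    rw [add_zero, Real.sqrt_mul hδ.le, Real.sqrt_mul hτ0.le, scale]; ring
  have hsδ : 10 * √δ ≤ ε := by
    have : √(100 * δ) ≤ ε := by
      rw [← Real.sqrt_sq hε.le]; exact Real.sqrt_le_sqrt hδ₂
    rwa [show (100 : ℝ) * δ = 10 ^ 2 * δ by norm_num, Real.sqrt_mul (by norm_num),
      Real.sqrt_sq (by norm_num)] at this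
  rw [hM]
  have hx4 : 4 * m.scale τ ≤ x := by nlinarith
  have hx0 : 0 < x := by linarith
  -- Noise budget in units of `ε x scale`: at most `1` from the contrasts and `1 / 4` from the
  -- squares, against a signal of at least `2`.
  have e1 : 5 * x * (2 * √δ * m.scale τ) ≤ ε * (x * m.scale τ) := by
    have : 0 ≤ x * m.scale τ := by positivity
    nlinarith
  have e2 : (m.n : ℝ) ^ 2 * ∑ i, m.noise i q ω ^ 2 ≤ ε * (x * m.scale τ) / 4 := by
    calc (m.n : ℝ) ^ 2 * ∑ i, m.noise i q ω ^ 2 ≤ (m.n : ℝ) ^ 2 * (δ * (τ * m.n)) := by gcongr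
      _ = δ * m.scale τ ^ 2 := by rw [m.scale_sq hτ0.le]; ring
      _ ≤ ε * m.scale τ ^ 2 := by gcongr
      _ ≤ _ := by
        have : ε * m.scale τ * (4 * m.scale τ) ≤ ε * m.scale τ * x := by gcongr
        nlinarith
  have e3 : 2 * (ε * (x * m.scale τ)) ≤ ε * C * m.scale τ / 4 * x := by
    have : 0 ≤ ε * (x * m.scale τ) := by positivity
    nlinarith
  have e4 : 0 < ε * (x * m.scale τ) := by positivity
  linarith

end ChangePointModel

/-! ### The estimator for moderate thresholds: grid values and noise in mean. -/

namespace ChangePointModel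

variable (m : ChangePointModel.{u})

/-- The partial sums of the noise components on a grid of blocks of length `b`. -/
noncomputable def gridNoise (J b : ℕ) (q : Fin m.p × Fin m.p) (ω : m.Ω) : ℝ :=
  ∑ j ∈ Finset.range J, (|∑ i ∈ seg 0 (j * b), m.W i q ω|
    + |∑ i ∈ seg 0 (j * b), m.Z i q.1 ω| + |∑ i ∈ seg 0 (j * b), m.Z i q.2 ω|)

lemma abs_sum_noise_le {q : Fin m.p × Fin m.p} {ω : m.Ω} (h1 : |m.Zbar q.1 ω| ≤ 1)
    (h2 : |m.Zbar q.2 ω| ≤ 1) (A : Finset (Fin m.n)) :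
    |∑ i ∈ A, m.noise i q ω| ≤
      |∑ i ∈ A, m.W i q ω| + |∑ i ∈ A, m.Z i q.1 ω| + |∑ i ∈ A, m.Z i q.2 ω| := by
  rw [sum_noise]
  have e1 : |m.Zbar q.1 ω * ∑ i ∈ A, m.Z i q.2 ω| ≤ |∑ i ∈ A, m.Z i q.2 ω| := by
    rw [abs_mul]; exact mul_le_of_le_one_left (abs_nonneg _) h1
  have e2 : |m.Zbar q.2 ω * ∑ i ∈ A, m.Z i q.1 ω| ≤ |∑ i ∈ A, m.Z i q.1 ω| := by
    rw [abs_mul]; exact mul_le_of_le_one_left (abs_nonneg _) h2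
  have e3 := abs_sub (∑ i ∈ A, m.W i q ω - m.Zbar q.1 ω * ∑ i ∈ A, m.Z i q.2 ω)
    (m.Zbar q.2 ω * ∑ i ∈ A, m.Z i q.1 ω)
  have e4 := abs_sub (∑ i ∈ A, m.W i q ω) (m.Zbar q.1 ω * ∑ i ∈ A, m.Z i q.2 ω)
  linarith

/-- Partial sums are controlled by their values on a grid and by the increments over short
intervals. -/
lemma abs_sum_noise_le_grid {J : ℕ} (hJ : 0 < J) {δ τ H : ℝ} (hδ : 0 ≤ δ) (hτ : 0 ≤ τ)
    {q : Fin m.p × Fin m.p} {ω : m.Ω} (h1 : |m.Zbar q.1 ω| ≤ 1) (h2 : |m.Zbar q.2 ω| ≤ 1)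
    (h : SegBound (fun i => m.noise i q ω) δ τ H) {k : ℕ} (hk : k ≤ m.n) :
    |∑ i ∈ seg 0 k, m.noise i q ω| ≤ m.gridNoise J (m.n / J + 1) q ω
      + √(δ * (τ * ((m.n : ℝ) / J + 1) + H)) := by
  -- Blocks of this length satisfy `n < J b`, so every `k ≤ n` lies less than `b` above one of the
  -- `J` grid points. The value at that point is bounded by the sum over the whole grid.
  set b := m.n / J + 1 with hb
  have hb0 : 0 < b := Nat.succ_pos _
  have hjb : k / b * b ≤ k := Nat.div_mul_le_self k b
  have hJb : m.n < J * b := by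
    have := Nat.lt_mul_div_succ m.n hJ
    exact this
  have hkJ : k / b < J := by
    rw [Nat.div_lt_iff_lt_mul hb0]; exact hk.trans_lt hJb
  rw [← sum_seg_add (Nat.zero_le _) hjb]
  refine (abs_add_le _ _).trans (add_le_add ?_ ?_)
  · refine (m.abs_sum_noise_le h1 h2 _).trans ?_
    exact Finset.single_le_sum (f := fun j => |∑ i ∈ seg 0 (j * b), m.W i q ω|
      + |∑ i ∈ seg 0 (j * b), m.Z i q.1 ω| + |∑ i ∈ seg 0 (j * b), m.Z i q.2 ω|)
      (fun _ _ => by positivity) (Finset.mem_range.2 hkJ)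
  · refine Real.abs_le_sqrt ((h _ _ hjb hk).1.trans ?_)
    gcongr
    have h3 : k ≤ k / b * b + b := by
      have := Nat.lt_div_mul_add hb0 (a := k)
      omega
    have h4 : (k : ℝ) ≤ ((k / b * b : ℕ) : ℝ) + b := by exact_mod_cast h3
    have h5 : (b : ℝ) ≤ (m.n : ℝ) / J + 1 := by
      rw [hb]; push_cast; gcongr; exact Nat.cast_div_le
    linarith

variable {m}

section expectations
variable {a B v : ℝ}

/-- A tilt of order `n^{-1/2}` keeps the moment generating function of the sum bounded, which gives
the central limit order `√n` for its mean absolute value. -/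
lemma _root_.MGFBound.integral_abs_sum_le {Y : Fin m.n → m.Ω → ℝ} (ha : 0 < a) (hv : 0 < v)
    (hi : iIndepFun Y m.P) (hm : ∀ i, Measurable (Y i)) (h : ∀ i, MGFBound (Y i) m.P v (a / 2))
    (A : Finset (Fin m.n)) : Integrable (fun ω => |∑ i ∈ A, Y i ω|) m.P ∧
      ∫ ω, |∑ i ∈ A, Y i ω| ∂m.P ≤ 2 * Real.exp v / min 1 (a / 2) * √(m.n : ℝ) := by
  obtain ⟨s, hs⟩ : ∃ s, s = min 1 (a / 2) := ⟨_, rfl⟩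
  have hs0 : 0 < s := by rw [hs]; positivity
  have hs1 : s ≤ 1 := by rw [hs]; exact min_le_left _ _
  have hs2 : s ≤ a / 2 := by rw [hs]; exact min_le_right _ _
  have hn := m.n_pos
  have hr : 1 ≤ √(m.n : ℝ) := by
    rw [← Real.sqrt_one]; exact Real.sqrt_le_sqrt (by linarith [m.n_ge_four])
  have hr0 : 0 < √(m.n : ℝ) := by linarith
  have hmeas : Measurable fun ω => ∑ i ∈ A, Y i ω := Finset.measurable_sum _ fun i _ => hm i
  obtain ⟨h1, h2⟩ := (MGFBound.sum hi hm h A).integral_abs_le hmeas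
    (s := s / √(m.n : ℝ)) (by positivity) ((div_le_self hs0.le hr).trans hs2)
  refine ⟨h1, h2.trans ?_⟩
  rw [← hs]
  have hcard : (A.card : ℝ) ≤ m.n := by
    exact_mod_cast (Finset.card_le_univ A).trans_eq (Fintype.card_fin _)
  have he : v * A.card * (s / √(m.n : ℝ)) ^ 2 ≤ v := by
    rw [div_pow, Real.sq_sqrt hn.le]
    calc v * A.card * (s ^ 2 / m.n) ≤ v * m.n * (1 / m.n) := by
          gcongr
          exact pow_le_one₀ hs0.le hs1
      _ = v := by field_simp
  calc _ ≤ 2 * Real.exp v / (s / √(m.n : ℝ)) := by gcongr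
    _ = _ := by field_simp

lemma NoiseBounds.gridNoise_integral_le (ha : 0 < a) (hv : 0 < v) (hm : m.NoiseBounds a B v)
    (J b : ℕ) (q : Fin m.p × Fin m.p) : Integrable (m.gridNoise J b q) m.P ∧
      ∫ ω, m.gridNoise J b q ω ∂m.P ≤
        J * (3 * (2 * Real.exp v / min 1 (a / 2) * √(m.n : ℝ))) := by
  have hW := fun A => MGFBound.integral_abs_sum_le ha hv (m.indep_W q)
    (fun i => m.measurable_W i q) (fun i => hm.mgf_W i q) A
  have hZ := fun c A => MGFBound.integral_abs_sum_le ha hv (m.indep_Z c)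
    (fun i => m.measurable_Z i c) (fun i => hm.mgf_Z i c (a / 2)) A
  have hi : ∀ j ∈ Finset.range J, Integrable (fun ω => |∑ i ∈ seg 0 (j * b), m.W i q ω|
      + |∑ i ∈ seg 0 (j * b), m.Z i q.1 ω| + |∑ i ∈ seg 0 (j * b), m.Z i q.2 ω|) m.P :=
    fun j _ => ((hW _).1.add (hZ _ _).1).add (hZ _ _).1
  refine ⟨integrable_finsetSum _ hi, ?_⟩
  simp only [gridNoise]
  rw [integral_finsetSum _ hi]
  refine (Finset.sum_le_card_nsmul _ _ (3 * (2 * Real.exp v / min 1 (a / 2) * √(m.n : ℝ)))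
    fun j _ => ?_).trans_eq (by rw [Finset.card_range, nsmul_eq_mul])
  have h12 : Integrable (fun ω => |∑ i ∈ seg 0 (j * b), m.W i q ω|
      + |∑ i ∈ seg 0 (j * b), m.Z i q.1 ω|) m.P := (hW _).1.add (hZ _ _).1
  rw [integral_add h12 (hZ _ _).1, integral_add (hW _).1 (hZ _ _).1]
  linarith [(hW (seg 0 (j * b))).2, (hZ q.1 (seg 0 (j * b))).2, (hZ q.2 (seg 0 (j * b))).2]

lemma NoiseBounds.env_sq_integral_le (ha : 0 < a) (hm : m.NoiseBounds a B v) (i : Fin m.n)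
    (q : Fin m.p × Fin m.p) : Integrable (fun ω => m.env i q ω ^ 2) m.P ∧
      ∫ ω, m.env i q ω ^ 2 ∂m.P ≤ 2 / a ^ 2 * B := by
  have hpt : ∀ ω, m.env i q ω ^ 2 ≤ 2 / a ^ 2 * Real.exp (a * m.env i q ω) := by
    intro ω
    have h0 : 0 ≤ a * m.env i q ω := mul_nonneg ha.le (m.env_nonneg i q ω)
    have := Real.quadratic_le_exp_of_nonneg h0
    rw [div_mul_eq_mul_div, le_div_iff₀ (by positivity)]
    nlinarith
  have hi0 := (hm.integrable_env i q).const_mul (2 / a ^ 2)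
  have hi : Integrable (fun ω => m.env i q ω ^ 2) m.P := by
    refine hi0.mono' ?_ (ae_of_all _ fun ω => ?_)
    · exact ((m.measurable_env i q).pow_const 2).aestronglyMeasurable
    · rw [Real.norm_eq_abs, abs_of_nonneg (sq_nonneg _)]
      exact hpt ω
  refine ⟨hi, (integral_mono hi hi0 hpt).trans ?_⟩
  rw [integral_const_mul]
  have := hm.exp_env i q
  gcongr

end expectations

/-- The part of the noise at position `q` that is controlled in mean. -/
noncomputable def meanNoise (m : ChangePointModel.{u}) (J : ℕ) (q : Fin m.p × Fin m.p) (ω : m.Ω) :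
    ℝ :=
  10 * m.n * (|m.S₁ q.1 q.2 - m.S₂ q.1 q.2| * tent m.n m.k₀ m.k₀)
      * m.gridNoise J (m.n / J + 1) q ω + (m.n : ℝ) ^ 2 * ∑ i, m.env i q ω ^ 2

/-- The signal in the change point statistic at position `q`. -/
noncomputable def signal (m : ChangePointModel.{u}) (ε : ℝ) (q : Fin m.p × Fin m.p) : ℝ :=
  ε * m.k₀ / (2 * m.n) * ((m.S₁ q.1 q.2 - m.S₂ q.1 q.2) ^ 2 * tent m.n m.k₀ m.k₀ ^ 2)

lemma meanNoise_integral_le {a B v C ε : ℝ} (ha : 0 < a) (hv : 0 < v) (hB : 1 ≤ B) (hC : 8 ≤ C)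
    (hε : 0 < ε) (J : ℕ) :
    ∃ K > 0, ∀ m : ChangePointModel.{u}, m.NoiseBounds a B v → ∀ τ lam : ℝ, 1 ≤ τ →
      m.SignalSize C τ lam → ∀ q ∈ m.changed, Integrable (m.meanNoise J q) m.P ∧
        ∫ ω, m.meanNoise J q ω ∂m.P ≤ K / √τ * m.signal ε q := by
  obtain ⟨K₁, hK₁⟩ : ∃ K₁, K₁ = 2 * Real.exp v / min 1 (a / 2) := ⟨_, rfl⟩
  have hK₁0 : 0 < K₁ := by rw [hK₁]; positivity
  obtain ⟨K₂, hK₂⟩ : ∃ K₂, K₂ = 2 / a ^ 2 * B := ⟨_, rfl⟩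
  have hK₂0 : 0 < K₂ := by rw [hK₂]; positivity
  refine ⟨(30 * J * K₁ + K₂) / ε, by positivity, fun m hm τ lam hτ hs q hq => ?_⟩
  have hτ0 : 0 < τ := by linarith
  have hn := m.n_pos
  have hne := (m.mem_changed.1 hq).2
  have hsg := hs.signal_ge (by linarith) hε hne
  have hx := hs.half_scale_le (by linarith) hne
  have hρ := m.scale_pos hτ0
  have hsτ : 1 ≤ √τ := by rw [← Real.sqrt_one]; exact Real.sqrt_le_sqrt hτ
  obtain ⟨hg1, hg2⟩ := hm.gridNoise_integral_le ha hv J (m.n / J + 1) q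
  have he := fun i => hm.env_sq_integral_le ha i q
  rw [← hK₁] at hg2
  rw [← hK₂] at he
  unfold meanNoise signal
  set x := |m.S₁ q.1 q.2 - m.S₂ q.1 q.2| * tent m.n m.k₀ m.k₀
  set sg := ε * m.k₀ / (2 * m.n) * ((m.S₁ q.1 q.2 - m.S₂ q.1 q.2) ^ 2 * tent m.n m.k₀ m.k₀ ^ 2)
  have i1 : Integrable (fun ω => 10 * m.n * x * m.gridNoise J (m.n / J + 1) q ω) m.P :=
    hg1.const_mul _
  have i2 : Integrable (fun ω => (m.n : ℝ) ^ 2 * ∑ i, m.env i q ω ^ 2) m.P :=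
    (integrable_finsetSum _ fun i _ => (he i).1).const_mul _
  refine ⟨i1.add i2, ?_⟩
  rw [integral_add i1 i2, integral_const_mul, integral_const_mul,
    integral_finsetSum _ fun i _ => (he i).1]
  have hx4 : 4 * m.scale τ ≤ x := by nlinarith
  have hx0 : 0 < x := by linarith
  have e0 : ε * (2 * (m.scale τ * x)) ≤ sg := by
    refine le_trans ?_ hsg
    have : 0 ≤ ε * (m.scale τ * x) := by positivity
    nlinarith
  -- The mean contrast has order `n · √n = scale / √τ`; this is where the gain `1 / √τ` arises.
  have e1 : 10 * m.n * x * ∫ ω, m.gridNoise J (m.n / J + 1) q ω ∂m.P ≤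
      30 * J * K₁ / √τ * (m.scale τ * x) := by
    calc _ ≤ 10 * m.n * x * (J * (3 * (K₁ * √(m.n : ℝ)))) := by gcongr
      _ = _ := by rw [scale]; field_simp; ring
  have e2 : (m.n : ℝ) ^ 2 * ∑ i, ∫ ω, m.env i q ω ^ 2 ∂m.P ≤ K₂ / √τ * (m.scale τ * x) := by
    have h1 : ∑ i, ∫ ω, m.env i q ω ^ 2 ∂m.P ≤ m.n * K₂ := by
      refine (Finset.sum_le_card_nsmul _ _ K₂ fun i _ => (he i).2).trans_eq ?_
      rw [Finset.card_univ, Fintype.card_fin, nsmul_eq_mul]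
    -- The squares contribute order `n³`, while `scale x ≥ scale² = τ n³`.
    have h2 : (m.n : ℝ) ^ 3 * √τ ≤ m.scale τ * x := by
      calc (m.n : ℝ) ^ 3 * √τ ≤ (m.n : ℝ) ^ 3 * τ := by
            have : √τ ≤ τ := by
              nlinarith [Real.mul_self_sqrt hτ0.le]
            gcongr
        _ = m.scale τ * m.scale τ := by rw [← sq, m.scale_sq hτ0.le]; ring
        _ ≤ _ := by gcongr; linarith
    calc _ ≤ (m.n : ℝ) ^ 2 * (m.n * K₂) := by gcongr
      _ = K₂ / √τ * ((m.n : ℝ) ^ 3 * √τ) := by field_simp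
      _ ≤ _ := by gcongr
  have e3 : m.scale τ * x ≤ sg / ε := by
    rw [le_div_iff₀ hε]
    have : 0 ≤ ε * (m.scale τ * x) := by positivity
    linarith
  calc _ ≤ (30 * J * K₁ + K₂) / √τ * (m.scale τ * x) := by
        rw [add_div, add_mul]; exact add_le_add e1 e2
    _ ≤ (30 * J * K₁ + K₂) / √τ * (sg / ε) := by gcongr
    _ = _ := by field_simp

lemma meanNoise_nonneg (m : ChangePointModel.{u}) (J : ℕ) (q : Fin m.p × Fin m.p) (ω : m.Ω) :
    0 ≤ m.meanNoise J q ω := by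
  have h1 := tent_nonneg m.k₀_lt_n.le m.k₀_lt_n.le
  have h2 : 0 ≤ m.gridNoise J (m.n / J + 1) q ω := Finset.sum_nonneg fun _ _ => by positivity
  unfold meanNoise
  positivity

lemma signal_pos {C τ lam ε : ℝ} (hC : 8 ≤ C) (hτ : 0 < τ) (hε : 0 < ε)
    (hs : m.SignalSize C τ lam) {q : Fin m.p × Fin m.p} (hq : q ∈ m.changed) :
    0 < m.signal ε q := by
  have hne := (m.mem_changed.1 hq).2
  have hρ := m.scale_pos hτ
  have hx := hs.half_scale_le (by linarith) hne
  refine lt_of_lt_of_le ?_ (hs.signal_ge (by linarith) hε hne)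
  have h1 : 0 < C * m.scale τ := by positivity
  have : 0 < ε * C * m.scale τ / 4 := by positivity
  exact mul_pos this (by linarith)

/-- The averaged noise is dominated by the signal with high probability. -/
lemma exists_meanNoise_event {a B v C ε : ℝ} (ha : 0 < a) (hv : 0 < v) (hB : 1 ≤ B) (hC : 8 ≤ C)
    (hε : 0 < ε) (J : ℕ) :
    ∃ K > 0, ∀ m : ChangePointModel.{u}, m.NoiseBounds a B v → ∀ τ lam : ℝ, 1 ≤ τ →
      m.SignalSize C τ lam →
        m.P.real {ω | 1 / 2 * ∑ q ∈ m.changed, m.signal ε q ≤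
          ∑ q ∈ m.changed, m.meanNoise J q ω} ≤ K / √τ := by
  obtain ⟨K, hK, h⟩ := meanNoise_integral_le.{u} ha hv hB hC hε J
  refine ⟨2 * K, by positivity, fun m hm τ lam hτ hs => ?_⟩
  have h' := h m hm τ lam hτ hs
  have hS : 0 < ∑ q ∈ m.changed, m.signal ε q :=
    Finset.sum_pos (fun q hq => signal_pos hC (by linarith) hε hs hq) m.changed_nonempty
  have hi : Integrable (fun ω => ∑ q ∈ m.changed, m.meanNoise J q ω) m.P :=
    integrable_finsetSum _ fun q hq => (h' q hq).1
  -- Markov's inequality for the sum over all changed positions: noise and signal are compared in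
  -- total, so no factor counting the positions appears.
  have hmk := mul_meas_ge_le_integral_of_nonneg
    (ae_of_all _ fun ω => Finset.sum_nonneg fun q _ => m.meanNoise_nonneg J q ω) hi
    (1 / 2 * ∑ q ∈ m.changed, m.signal ε q)
  have hE : ∫ ω, ∑ q ∈ m.changed, m.meanNoise J q ω ∂m.P ≤
      K / √τ * ∑ q ∈ m.changed, m.signal ε q := by
    rw [integral_finsetSum _ fun q hq => (h' q hq).1, Finset.mul_sum]
    exact Finset.sum_le_sum fun q hq => (h' q hq).2
  have := hmk.trans hE
  set S := ∑ q ∈ m.changed, m.signal ε q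
  refine le_of_mul_le_mul_left ?_ (by positivity : 0 < 1 / 2 * S)
  calc _ ≤ _ := this
    _ = _ := by ring

/-- For moderate thresholds the estimator is close to the change point once the averaged noise is
dominated by the signal. -/
lemma estimator_close_of_meanNoise {C τ lam B δ ε : ℝ} {khat : m.Ω → ℕ} {J : ℕ} (hJ : 0 < J)
    (hB : 1 ≤ B) (hC : 512 * B ≤ C) (hε : 0 < ε) (hτ : 1 ≤ τ) (hτε : 16 / ε ≤ √τ)
    (hτn : τ ≤ √(m.n : ℝ)) (hJn : (m.n : ℝ) / J + 1 + √(m.n : ℝ) ≤ ε ^ 2 / 400 * m.n)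
    (hs : m.SignalSize C τ lam) (h₁ : ∀ b c, |m.S₁ b c| ≤ B) (h₂ : ∀ b c, |m.S₂ b c| ≤ B)
    (hδ : 0 ≤ δ) (hδ' : 108 * δ ≤ 1) (hest : m.IsEstimator τ khat) {ω : m.Ω}
    (h : ∀ q, SegBound (fun i => m.noise i q ω) δ τ (τ ^ 2) ∧ |m.Zbar q.1 ω| ≤ 1 ∧
      |m.Zbar q.2 ω| ≤ 1)
    (hmean : ∑ q ∈ m.changed, m.meanNoise J q ω < 1 / 2 * ∑ q ∈ m.changed, m.signal ε q) :
    ¬ ε ≤ |(khat ω : ℝ) / (m.k₀ : ℝ) - 1| := by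
  have hn := m.n_pos
  have hτ0 : 0 < τ := by linarith
  have hC8 : 8 ≤ C := by linarith
  have hH0 : 0 ≤ τ ^ 2 := sq_nonneg τ
  have hH : τ ^ 2 ≤ τ * √(m.n : ℝ) := sq_le_mul_sqrt hτ0.le hτn
  have hρ := m.scale_pos hτ0
  obtain ⟨E, hE⟩ : ∃ E, E = √(δ * (τ * ((m.n : ℝ) / J + 1) + τ ^ 2)) := ⟨_, rfl⟩
  -- With `τ ≤ √n` the excess `τ²` is at most `τ √n`, so `hJn` bounds the radicand by `(ε / 20)² τ
  -- n`.
  have hEle : 20 * m.n * E ≤ ε * m.scale τ := by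
    have h3 : E ≤ √((ε / 20) ^ 2 * (τ * m.n)) := by
      rw [hE]
      refine Real.sqrt_le_sqrt ?_
      have h4 : 0 ≤ τ * ((m.n : ℝ) / J + 1) + τ ^ 2 := by positivity
      calc δ * (τ * ((m.n : ℝ) / J + 1) + τ ^ 2) ≤ 1 * (τ * ((m.n : ℝ) / J + 1) + τ ^ 2) := by
            gcongr; linarith
        _ = τ * ((m.n : ℝ) / J + 1 + τ) := by ring
        _ ≤ τ * (ε ^ 2 / 400 * m.n) := by gcongr; linarith
        _ = _ := by ring
    rw [Real.sqrt_mul (sq_nonneg _), Real.sqrt_sq (by positivity), Real.sqrt_mul hτ0.le] at h3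
    calc 20 * m.n * E ≤ 20 * m.n * (ε / 20 * (√τ * √(m.n : ℝ))) := by gcongr
      _ = _ := by rw [scale]; ring
  have hM : ∀ q ∈ m.changed, ∀ j ≤ m.n, |contrast (fun i => m.noise i q ω) j| ≤
      2 * m.n * (m.gridNoise J (m.n / J + 1) q ω + E) := by
    intro q _ j hj
    refine abs_contrast_le (fun k hk => ?_) hj
    rw [hE]
    exact m.abs_sum_noise_le_grid hJ hδ hτ0.le (h q).2.1 (h q).2.2 (h q).1 hk
  refine estimator_close hest hε
    (selected_eq_changed hB hC hτ hs h₁ h₂ hδ hδ' hH0 hH fun q => (h q).1)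
    (size_le hε hτε (hs.side_sq_ge hB hC h₁ h₂)) hM
    (fun q hq j hj =>
      contrast_le_signal hC8 hτ0 hδ hδ' hs hH (m.mem_changed.1 hq).2 (h q).1 hj) ?_
  have hS : 0 < ∑ q ∈ m.changed, m.signal ε q :=
    Finset.sum_pos (fun q hq => signal_pos hC8 hτ0 hε hs hq) m.changed_nonempty
  have hterm : ∀ q ∈ m.changed, 5 * (|m.S₁ q.1 q.2 - m.S₂ q.1 q.2| * tent m.n m.k₀ m.k₀) *
      (2 * m.n * (m.gridNoise J (m.n / J + 1) q ω + E)) + (m.n : ℝ) ^ 2 * ∑ i, m.noise i q ω ^ 2 ≤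
      m.meanNoise J q ω + 1 / 4 * m.signal ε q := by
    intro q hq
    have hne := (m.mem_changed.1 hq).2
    have hsg := hs.signal_ge (by linarith) hε hne
    have hx := hs.half_scale_le (by linarith) hne
    have hQ : ∑ i, m.noise i q ω ^ 2 ≤ ∑ i, m.env i q ω ^ 2 := by
      refine Finset.sum_le_sum fun i _ => ?_
      rw [← sq_abs (m.noise i q ω)]
      have := m.abs_noise_le_env (h q).2.1 (h q).2.2 i
      gcongr
    have hQ' := mul_le_mul_of_nonneg_left hQ (sq_nonneg (m.n : ℝ))
    unfold meanNoise
    change ε * C * m.scale τ / 4 * _ ≤ m.signal ε q at hsg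
    set x := |m.S₁ q.1 q.2 - m.S₂ q.1 q.2| * tent m.n m.k₀ m.k₀
    have hx0 : 0 < x := by
      have : 0 < C * m.scale τ := by positivity
      linarith
    -- The block increments use at most a quarter of the signal and `hmean` grants the rest less
    -- than half, so the total stays below the signal.
    have e1 : 5 * x * (2 * m.n * E) ≤ 1 / 4 * m.signal ε q := by
      have h5 := mul_le_mul_of_nonneg_left hEle hx0.le
      have h6 : 0 ≤ ε * m.scale τ * x := by positivity
      have h7 : 8 * (ε * m.scale τ * x) ≤ C * (ε * m.scale τ * x) := by gcongr
      linarith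
    linarith
  calc _ ≤ ∑ q ∈ m.changed, (m.meanNoise J q ω + 1 / 4 * m.signal ε q) :=
        Finset.sum_le_sum hterm
    _ = ∑ q ∈ m.changed, m.meanNoise J q ω + 1 / 4 * ∑ q ∈ m.changed, m.signal ε q := by
        rw [Finset.sum_add_distrib, Finset.mul_sum]
    _ < ∑ q ∈ m.changed, m.signal ε q := by linarith
    _ = _ := by rw [Finset.mul_sum]; rfl

end ChangePointModel

/-! ### Finite-sample bounds from the crude event. -/

namespace ChangePointModel

section bounds
variable {a B v : ℝ} (ha : 0 < a) (hv : 0 < v)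
include ha hv

lemma exists_null_bound : ∃ c₁ > 0, ∃ c₂ > 0, ∀ (m : ChangePointModel.{u}) (τ : ℝ), 0 < τ →
    m.NoiseBounds a B v → m.P.real (⋃ q ∈ m.equalEntries, {ω | τ < m.D q ω}) ≤
      c₁ * (m.p : ℝ) ^ 2 * (m.n : ℝ) * ((m.n : ℝ) * Real.exp (-c₂ * √τ)) := by
  obtain ⟨c, hc, h⟩ := exists_crude_event.{u} (B := B) ha hv (δ := 1 / 1000) (by norm_num)
  refine ⟨6 + Real.exp (c * √1), by positivity, c, hc, fun m τ hτ hm => ?_⟩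
  refine m.prob_le_of_bound measureReal_le_one (by norm_num) hc.le fun hτ1 => ?_
  exact (measureReal_mono (null_event_subset (by norm_num) (by norm_num) hτ.le le_rfl
    (by positivity))).trans (h m hm τ hτ1)

lemma exists_signal_bound (hB : 1 ≤ B) : ∃ c₃ > 0, ∃ c₄ > 0,
    ∀ (m : ChangePointModel.{u}) (τ lam : ℝ), 0 < τ → m.NoiseBounds a B v →
      m.SignalSize (512 * B) τ lam →
      1 - c₃ * (m.p : ℝ) ^ 2 * (m.n : ℝ) * ((m.n : ℝ) * Real.exp (-c₄ * √τ)) ≤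
        m.P.real (⋂ q ∈ m.largeEntries lam, {ω | τ < m.D q ω}) := by
  obtain ⟨c, hc, h⟩ := exists_crude_event.{u} (B := B) ha hv (δ := 1 / 1000) (by norm_num)
  refine ⟨6 + Real.exp (c * √1), by positivity, c, hc, fun m τ lam hτ hm hs => ?_⟩
  have hle : 1 - m.P.real (⋂ q ∈ m.largeEntries lam, {ω | τ < m.D q ω}) ≤
      (6 + Real.exp (c * √1)) * (m.p : ℝ) ^ 2 * (m.n : ℝ) *
        ((m.n : ℝ) * Real.exp (-c * √τ)) := by
    have h0 : 0 ≤ m.P.real (⋂ q ∈ m.largeEntries lam, {ω | τ < m.D q ω}) := measureReal_nonneg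
    refine m.prob_le_of_bound (by linarith) (by norm_num) hc.le fun hτ1 => ?_
    have h1 := one_sub_le_measureReal (m := m) fun ω hω => mem_signal_event (ω := ω) hB le_rfl hτ1
      hs hm.abs_S₁ hm.abs_S₂ (δ := 1 / 1000) (by norm_num) (by norm_num) le_rfl
      (by positivity) hω
    linarith [h m hm τ hτ1]
  linarith

/-- The first form serves the limit for large thresholds. The second holds for every `τ`, the
constant being enlarged so that it is trivial below `τ₀`. -/
lemma exists_estimator_bound (hB : 1 ≤ B) {ε : ℝ} (hε : 0 < ε) : ∃ c₅ > 0, ∃ c₆ > 0, ∃ τ₀ : ℝ,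
    ∀ (m : ChangePointModel.{u}) (τ lam : ℝ) (khat : m.Ω → ℕ), m.NoiseBounds a B v →
      m.SignalSize (512 * B) τ lam → m.IsEstimator τ khat →
      (τ₀ ≤ τ → m.P.real {ω | ε ≤ |(khat ω : ℝ) / (m.k₀ : ℝ) - 1|} ≤
        (m.p : ℝ) ^ 2 * (m.n : ℝ) ^ 2 * (6 * Real.exp (-c₆ * √τ))) ∧
      m.P.real {ω | ε ≤ |(khat ω : ℝ) / (m.k₀ : ℝ) - 1|} ≤
        c₅ * (m.p : ℝ) ^ 2 * (m.n : ℝ) * ((m.n : ℝ) * Real.exp (-c₆ * √τ)) := by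
  obtain ⟨δ, hδe⟩ : ∃ δ, δ = min (1 / 1000) (min ε (ε ^ 2 / 100)) := ⟨_, rfl⟩
  have hδ : 0 < δ := by rw [hδe]; positivity
  have hδ' : δ ≤ 1 / 1000 := by rw [hδe]; exact min_le_left _ _
  have hδ₁ : δ ≤ ε := by rw [hδe]; exact (min_le_right _ _).trans (min_le_left _ _)
  have hδ₂ : δ ≤ ε ^ 2 / 100 := by rw [hδe]; exact (min_le_right _ _).trans (min_le_right _ _)
  obtain ⟨c, hc, h⟩ := exists_crude_event.{u} (B := B) ha hv hδ
  obtain ⟨τ₀, hτ₀⟩ : ∃ τ₀, τ₀ = max 1 ((16 / ε) ^ 2) := ⟨_, rfl⟩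
  refine ⟨6 + Real.exp (c * √τ₀), by positivity, c, hc, τ₀, fun m τ lam khat hm hs hest => ?_⟩
  have key : τ₀ ≤ τ → m.P.real {ω | ε ≤ |(khat ω : ℝ) / (m.k₀ : ℝ) - 1|} ≤
      (m.p : ℝ) ^ 2 * (m.n : ℝ) ^ 2 * (6 * Real.exp (-c * √τ)) := by
    intro hτ
    have hτ1 : 1 ≤ τ := (le_max_left _ _).trans (hτ₀ ▸ hτ)
    have hτε : 16 / ε ≤ √τ := Real.le_sqrt_of_sq_le ((le_max_right _ _).trans (hτ₀ ▸ hτ))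
    refine (measureReal_mono ?_).trans (h m hm τ hτ1)
    intro ω hω hall
    exact estimator_close_of_segBound hB le_rfl hε hτ1 hτε hs hm.abs_S₁ hm.abs_S₂ hδ (by linarith)
      hδ₁ (by linarith) hest hall hω
  exact ⟨key, m.prob_le_of_bound measureReal_le_one (by norm_num) hc.le key⟩

end bounds

end ChangePointModel

open ChangePointModel

/-! ### Limits along sequences and the final assembly. -/

section sequences

variable {a B v : ℝ} (ha : 0 < a) (hv : 0 < v) {c K : ℝ} {m : ℕ → ChangePointModel.{u}}
  {τ : ℕ → ℝ}
include ha hv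

/-- The exceptional event of the noise has vanishing probability for moderate thresholds and is
negligible for large thresholds, so that any event it controls vanishes. -/
lemma tendsto_of_segBound (hc : 0 < c) (hK : 0 < K)
    (hfine : ∀ m : ChangePointModel.{u}, m.NoiseBounds a B v → ∀ τ : ℝ, 0 < τ → τ ≤ m.n →
      m.P.real {ω | ¬ ∀ q, SegBound (fun i => m.noise i q ω) (1 / 1000) τ (τ ^ 2) ∧
        |m.Zbar q.1 ω| ≤ 1 ∧ |m.Zbar q.2 ω| ≤ 1} ≤
        (m.p : ℝ) ^ 2 * (m.n : ℝ) ^ 2 * (K * Real.exp (-(2 * c) * τ)))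
    (hn : Tendsto (fun s => (m s).n) atTop atTop) (hm : ∀ s, (m s).NoiseBounds a B v)
    (hg : GrowthCondition c m τ) {f : ℕ → ℝ} (hf0 : ∀ s, 0 ≤ f s)
    (hf : ∀ s H, 1 ≤ τ s → 0 ≤ H → H ≤ τ s * √((m s).n : ℝ) → f s ≤ (m s).P.real
      {ω | ¬ ∀ q, SegBound (fun i => (m s).noise i q ω) (1 / 1000) (τ s) H}) :
    Tendsto f atTop (𝓝 0) := by
  obtain ⟨b, hb, hcrude⟩ := exists_crude_event.{u} (B := B) ha hv (δ := 1 / 1000) (by norm_num)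
  have hτ := hg.tendsto_threshold hc hn
  refine hg.tendsto_of_regimes hn hb hK.le (by norm_num : (0 : ℝ) ≤ 6) hf0 (g := fun _ => 0)
    (fun _ => le_rfl) tendsto_const_nhds ?_ ?_
  · filter_upwards [hτ.eventually_ge_atTop 1] with s hs hle
    rw [add_zero]
    -- The hypothesis `hf` allows any admissible excess: `H = τ²` in this regime and `H = 0` in the
    -- other.
    refine (hf s _ hs (sq_nonneg _) (sq_le_mul_sqrt (by linarith) hle)).trans
      ((measureReal_mono ?_).trans
        (hfine (m s) (hm s) (τ s) (by linarith) (hle.trans (m s).sqrt_n_le)))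
    intro ω hω hall
    exact hω fun q => (hall q).1
  · filter_upwards [hτ.eventually_ge_atTop 1] with s hs _
    refine (hf s 0 hs le_rfl ?_).trans (hcrude (m s) (hm s) (τ s) hs)
    have : 0 ≤ τ s := by linarith
    positivity

/-- The fine event is used with the fixed `δ = 1 / 1000`, so `c` does not depend on `ε`. The
accuracy enters through the number `J` of blocks and the Markov bound `K' / √τ`, which vanishes as
`τ → ∞`. -/
lemma tendsto_estimator (hB : 1 ≤ B) (hc : 0 < c) (hK : 0 < K)
    (hfine : ∀ m : ChangePointModel.{u}, m.NoiseBounds a B v → ∀ τ : ℝ, 0 < τ → τ ≤ m.n →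
      m.P.real {ω | ¬ ∀ q, SegBound (fun i => m.noise i q ω) (1 / 1000) τ (τ ^ 2) ∧
        |m.Zbar q.1 ω| ≤ 1 ∧ |m.Zbar q.2 ω| ≤ 1} ≤
        (m.p : ℝ) ^ 2 * (m.n : ℝ) ^ 2 * (K * Real.exp (-(2 * c) * τ)))
    (hn : Tendsto (fun s => (m s).n) atTop atTop) (hm : ∀ s, (m s).NoiseBounds a B v)
    (hg : GrowthCondition c m τ) {lam : ℕ → ℝ}
    (hs : ∀ s, (m s).SignalSize (512 * B) (τ s) (lam s)) {khat : ∀ s, (m s).Ω → ℕ}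
    (hest : ∀ s, (m s).IsEstimator (τ s) (khat s)) {ε : ℝ} (hε : 0 < ε) :
    Tendsto (fun s => (m s).P.real {ω | ε ≤ |(khat s ω : ℝ) / ((m s).k₀ : ℝ) - 1|})
      atTop (𝓝 0) := by
  obtain ⟨_, _, b, hb, τ₀, hcrude⟩ := exists_estimator_bound.{u} ha hv hB hε
  obtain ⟨J, hJ⟩ := exists_nat_ge (1200 / ε ^ 2)
  have hJ0 : (0 : ℝ) < J := lt_of_lt_of_le (by positivity) hJ
  have hJ1 : 0 < J := by exact_mod_cast hJ0
  obtain ⟨K', hK', hmean⟩ := exists_meanNoise_event.{u} ha hv hB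
    (by linarith : (8 : ℝ) ≤ 512 * B) hε J
  have hτ := hg.tendsto_threshold hc hn
  have hsqrt : Tendsto (fun s => √(τ s)) atTop atTop := Real.tendsto_sqrt_atTop.comp hτ
  have hsn : Tendsto (fun s => √((m s).n : ℝ)) atTop atTop :=
    Real.tendsto_sqrt_atTop.comp (tendsto_natCast_atTop_atTop.comp hn)
  refine hg.tendsto_of_regimes hn hb hK.le (by norm_num : (0 : ℝ) ≤ 6)
    (fun _ => measureReal_nonneg) (g := fun s => K' / √(τ s)) (fun _ => by positivity)
    (tendsto_const_nhds.div_atTop hsqrt) ?_ ?_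
  · filter_upwards [hτ.eventually_ge_atTop 1, hsqrt.eventually_ge_atTop (16 / ε),
      hsn.eventually_ge_atTop (1200 / ε ^ 2)] with s h1 hsε hns hle
    have hn0 := (m s).n_pos
    -- The budget `ε² n / 400` is three times `ε² n / 1200`: one part for `n / J` and two for `1 +
    -- √n ≤ 2 √n`.
    have hJn : ((m s).n : ℝ) / J + 1 + √((m s).n : ℝ) ≤ ε ^ 2 / 400 * (m s).n := by
      have hr1 : 1 ≤ √((m s).n : ℝ) := by
        rw [← Real.sqrt_one]; exact Real.sqrt_le_sqrt (by linarith [(m s).n_ge_four])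
      have e1 : ((m s).n : ℝ) / J ≤ ε ^ 2 / 1200 * (m s).n := by
        rw [div_le_iff₀ hJ0]
        rw [div_le_iff₀ (by positivity)] at hJ
        nlinarith
      have e2 : 2 * √((m s).n : ℝ) ≤ ε ^ 2 / 600 * (m s).n := by
        rw [div_le_iff₀ (by positivity)] at hns
        have := Real.mul_self_sqrt hn0.le
        nlinarith
      linarith
    refine le_trans (measureReal_mono (μ := (m s).P) (s₂ :=
      {ω | ¬ ∀ q, SegBound (fun i => (m s).noise i q ω) (1 / 1000) (τ s) (τ s ^ 2) ∧
        |(m s).Zbar q.1 ω| ≤ 1 ∧ |(m s).Zbar q.2 ω| ≤ 1} ∪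
      {ω | 1 / 2 * ∑ q ∈ (m s).changed, (m s).signal ε q ≤
          ∑ q ∈ (m s).changed, (m s).meanNoise J q ω}) ?_)
      ((measureReal_union_le _ _).trans (add_le_add
        (hfine (m s) (hm s) (τ s) (by linarith) (hle.trans (m s).sqrt_n_le))
        (hmean (m s) (hm s) (τ s) (lam s) h1 (hs s))))
    intro ω hω
    by_contra hcon
    simp only [Set.mem_union, Set.mem_ofPred_eq, not_or, not_not, not_le] at hcon
    exact estimator_close_of_meanNoise hJ1 hB le_rfl hε h1 hsε hle hJn (hs s) (hm s).abs_S₁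
      (hm s).abs_S₂ (by norm_num) (by norm_num) (hest s) hcon.1 hcon.2 hω
  · filter_upwards [hτ.eventually_ge_atTop τ₀] with s h1 _
    exact (hcrude (m s) (τ s) (lam s) (khat s) (hm s) (hs s) (hest s)).1 h1

end sequences

/-- For `A c ≥ 3` the exponential is at most `exp (-3 L)` with `L = max (log p) (log n)`. Two of the
three factors `exp (-L)` cancel `p` and `n`, and the third is at most `1 / n`. -/
lemma growthCondition_log {c A : ℝ} (hc : 0 < c) (hA : 3 / c ≤ A) {m : ℕ → ChangePointModel.{u}}
    (hn : Tendsto (fun s => (m s).n) atTop atTop)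
    (h₁ : ∃ ε : ℝ, 0 < ε ∧ ε < 1 ∧ ∀ᶠ s in atTop, ((m s).n : ℝ) ^ ε < ((m s).k₀ : ℝ))
    (h₂ : ∃ K : ℝ, 0 < K ∧
      Tendsto (fun s => ((m s).p : ℝ) * ((m s).n : ℝ) ^ (-K)) atTop (𝓝 0)) :
    GrowthCondition c m
      (fun s => A * max (Real.log ((m s).p : ℝ)) (Real.log ((m s).n : ℝ))) := by
  refine ⟨h₁, h₂, ?_⟩
  have hn' : Tendsto (fun s => ((m s).n : ℝ)⁻¹) atTop (𝓝 0) :=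
    tendsto_inv_atTop_zero.comp (tendsto_natCast_atTop_atTop.comp hn)
  refine squeeze_zero (fun s => by positivity) (fun s => ?_) hn'
  have hp := (m s).one_le_p
  have hn0 := (m s).n_pos
  have hn4 := (m s).n_ge_four
  have hlog : 0 ≤ Real.log ((m s).n : ℝ) := Real.log_nonneg (by linarith)
  rw [div_le_iff₀ hc] at hA
  set L := max (Real.log ((m s).p : ℝ)) (Real.log ((m s).n : ℝ))
  have hL0 : 0 ≤ L := hlog.trans (le_max_right _ _)
  have e1 : ((m s).p : ℝ) ≤ Real.exp L := by
    rw [← Real.log_le_iff_le_exp (by linarith)]; exact le_max_left _ _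
  have e2 : ((m s).n : ℝ) ≤ Real.exp L := by
    rw [← Real.log_le_iff_le_exp hn0]; exact le_max_right _ _
  have e3 : Real.exp (-c * (A * L)) ≤ Real.exp (-(3 * L)) := by
    rw [Real.exp_le_exp]; nlinarith
  rw [le_inv_comm₀ (by positivity) hn0]
  have e4 : ((m s).p : ℝ) * (m s).n * Real.exp (-c * (A * L)) ≤ Real.exp (-L) := by
    calc _ ≤ Real.exp L * Real.exp L * Real.exp (-(3 * L)) := by gcongr
      _ = _ := by rw [← Real.exp_add, ← Real.exp_add]; ring_nf
  rw [le_inv_comm₀ hn0 (by positivity)]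
  refine e4.trans ?_
  rw [Real.exp_neg]
  gcongr

theorem corollary3p1 (C₁ C₂ M : ℝ) (hC₁ : 0 < C₁) (hC₂ : 0 < C₂) (hM : 0 < M) :
    ∃ C > 0, ∃ c > 0,
      -- no position with equal entries is selected
      ((∃ c₁ > 0, ∃ c₂ > 0, ∀ (m : ChangePointModel.{u}) (τ : ℝ), 0 < τ →
          m.SubGaussianBounded C₁ C₂ M →
          m.P.real (⋃ q ∈ m.equalEntries, {ω | τ < m.D q ω}) =
            m.P.real {ω | (m.equalEntries ∩ (m.selected τ ω : Set _)).Nonempty} ∧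
          m.P.real (⋃ q ∈ m.equalEntries, {ω | τ < m.D q ω}) ≤
            c₁ * (m.p : ℝ) ^ 2 * (m.n : ℝ) *
              (Real.exp (-c₂ * τ) + Real.exp (-c₂ * (m.n : ℝ) ^ (1 / 4 : ℝ) * √τ) +
                (m.n : ℝ) * Real.exp (-c₂ * √τ))) ∧
        (∀ (m : ℕ → ChangePointModel.{u}) (τ : ℕ → ℝ),
          Tendsto (fun s => (m s).n) atTop atTop →
          (∀ s, 0 < τ s) →
          (∀ s, (m s).SubGaussianBounded C₁ C₂ M) →
          GrowthCondition c m τ →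
          Tendsto (fun s => (m s).P.real
            (⋃ q ∈ (m s).equalEntries, {ω | τ s < (m s).D q ω})) atTop (𝓝 0))) ∧
      -- all positions with a large difference are selected
      ((∃ c₃ > 0, ∃ c₄ > 0, ∀ (m : ChangePointModel.{u}) (τ lam : ℝ), 0 < τ →
          m.SubGaussianBounded C₁ C₂ M →
          m.SignalSize C τ lam →
          m.P.real (⋂ q ∈ m.largeEntries lam, {ω | τ < m.D q ω}) =
            m.P.real {ω | m.largeEntries lam ⊆ (m.selected τ ω : Set _)} ∧
          1 - c₃ * (m.p : ℝ) ^ 2 * (m.n : ℝ) *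
              (Real.exp (-c₄ * τ) + Real.exp (-c₄ * (m.n : ℝ) ^ (1 / 4 : ℝ) * √τ) +
                (m.n : ℝ) * Real.exp (-c₄ * √τ)) ≤
            m.P.real (⋂ q ∈ m.largeEntries lam, {ω | τ < m.D q ω})) ∧
        (∀ (m : ℕ → ChangePointModel.{u}) (τ lam : ℕ → ℝ),
          Tendsto (fun s => (m s).n) atTop atTop →
          (∀ s, 0 < τ s) →
          (∀ s, (m s).SubGaussianBounded C₁ C₂ M) →
          (∀ s, (m s).SignalSize C (τ s) (lam s)) →
          GrowthCondition c m τ →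
          Tendsto (fun s => (m s).P.real
            (⋂ q ∈ (m s).largeEntries (lam s), {ω | τ s < (m s).D q ω})) atTop (𝓝 1))) ∧
      -- consistency of the change point estimator
      ((∀ ε > 0, ∃ c₅ > 0, ∃ c₆ > 0, ∀ (m : ChangePointModel.{u}) (τ lam : ℝ)
          (khat : m.Ω → ℕ), 0 < τ →
          m.SubGaussianBounded C₁ C₂ M →
          m.SignalSize C τ lam →
          m.IsEstimator τ khat →
          m.P.real {ω | ε ≤ |(khat ω : ℝ) / (m.k₀ : ℝ) - 1|} ≤
            c₅ * (m.p : ℝ) ^ 2 * (m.n : ℝ) *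
              (Real.exp (-c₆ * τ) + (m.n : ℝ) * Real.exp (-c₆ * √τ))) ∧
        (∀ (m : ℕ → ChangePointModel.{u}) (τ lam : ℕ → ℝ) (khat : ∀ s, (m s).Ω → ℕ),
          Tendsto (fun s => (m s).n) atTop atTop →
          (∀ s, 0 < τ s) →
          (∀ s, (m s).SubGaussianBounded C₁ C₂ M) →
          (∀ s, (m s).SignalSize C (τ s) (lam s)) →
          GrowthCondition c m τ →
          (∀ s, (m s).IsEstimator (τ s) (khat s)) →
          ∀ ε > 0, Tendsto (fun s => (m s).P.real
            {ω | ε ≤ |(khat s ω : ℝ) / ((m s).k₀ : ℝ) - 1|}) atTop (𝓝 0))) ∧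
      -- logarithmic thresholds satisfy the growth condition
      (∃ A₀ > 0, ∀ A ≥ A₀, ∀ m : ℕ → ChangePointModel.{u},
        Tendsto (fun s => (m s).n) atTop atTop →
        (∃ ε : ℝ, 0 < ε ∧ ε < 1 ∧ ∀ᶠ s in atTop, ((m s).n : ℝ) ^ ε < ((m s).k₀ : ℝ)) →
        (∃ K : ℝ, 0 < K ∧
          Tendsto (fun s => ((m s).p : ℝ) * ((m s).n : ℝ) ^ (-K)) atTop (𝓝 0)) →
        GrowthCondition c m
          (fun s => A * max (Real.log ((m s).p : ℝ)) (Real.log ((m s).n : ℝ)))) := by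
  obtain ⟨a, ha, B, hB, v, hv, hNB⟩ := exists_noiseBounds.{u} C₁ C₂ M hC₁ hC₂
  obtain ⟨c', hc', K, hK, hfine'⟩ :=
    exists_fine_event.{u} (v := v) ha hv hB (δ := 1 / 1000) (by norm_num)
  -- The union bound costs `p² n²`, the square of the factor in the growth condition, so only half
  -- of the fine exponent is available.
  obtain ⟨c, hcc⟩ : ∃ c, c = c' / 2 := ⟨_, rfl⟩
  have hc : 0 < c := by rw [hcc]; positivity
  have hc2 : c' = 2 * c := by rw [hcc]; ring
  rw [hc2] at hfine'
  refine ⟨512 * B, by linarith, c, hc, ⟨?_, ?_⟩, ⟨?_, ?_⟩, ⟨?_, ?_⟩, ?_⟩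
  · obtain ⟨c₁, hc₁, c₂, hc₂, h⟩ := exists_null_bound.{u} (B := B) ha hv
    refine ⟨c₁, hc₁, c₂, hc₂, fun m τ hτ hm => ⟨by rw [null_event_eq], ?_⟩⟩
    refine (h m τ hτ (hNB m hm)).trans ?_
    -- Only the last exponential of the bracket is needed; the others are nonnegative.
    gcongr
    exact le_add_of_nonneg_left (by positivity)
  · intro m τ hn hτ hm hg
    refine tendsto_of_segBound ha hv hc hK hfine' hn (fun s => hNB _ (hm s)) hg
      (fun _ => measureReal_nonneg) fun s H _ hH0 hH => measureReal_mono ?_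
    exact null_event_subset (by norm_num) (by norm_num) (hτ s).le hH0 hH
  · obtain ⟨c₃, hc₃, c₄, hc₄, h⟩ := exists_signal_bound.{u} ha hv hB
    refine ⟨c₃, hc₃, c₄, hc₄, fun m τ lam hτ hm hs => ⟨by rw [signal_event_eq], ?_⟩⟩
    refine le_trans ?_ (h m τ lam hτ (hNB m hm) hs)
    gcongr
    exact le_add_of_nonneg_left (by positivity)
  · intro m τ lam hn hτ hm hs hg
    have h0 : Tendsto (fun s => 1 - (m s).P.real
        (⋂ q ∈ (m s).largeEntries (lam s), {ω | τ s < (m s).D q ω})) atTop (𝓝 0) := by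
      refine tendsto_of_segBound ha hv hc hK hfine' hn (fun s => hNB _ (hm s)) hg
        (fun _ => sub_nonneg.2 measureReal_le_one) fun s H h1 hH0 hH => ?_
      have h2 := one_sub_le_measureReal (m := m s) fun ω hω => mem_signal_event (ω := ω) hB le_rfl
        h1 (hs s) (hNB _ (hm s)).abs_S₁ (hNB _ (hm s)).abs_S₂ (δ := 1 / 1000) (by norm_num)
        (by norm_num) hH0 hH hω
      linarith
    have h1 := h0.const_sub 1
    simpa using h1
  · intro ε hε
    obtain ⟨c₅, hc₅, c₆, hc₆, _, h⟩ := exists_estimator_bound.{u} ha hv hB hε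
    refine ⟨c₅, hc₅, c₆, hc₆, fun m τ lam khat _ hm hs hest => ?_⟩
    refine (h m τ lam khat (hNB m hm) hs hest).2.trans ?_
    gcongr
    exact le_add_of_nonneg_left (by positivity)
  · intro m τ lam khat hn _ hm hs hg hest ε hε
    exact tendsto_estimator ha hv hB hc hK hfine' hn (fun s => hNB _ (hm s)) hg hs hest hε
  · exact ⟨3 / c, by positivity, fun A hA m hn h₁ h₂ => growthCondition_log hc hA hn h₁ h₂⟩
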